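/- For real $a,c$ and $x>0$ let $\Psi(a,c;x)$ be Tricomi's confluent hypergeometric function: for $c\notin\mathbb Z$, $$\Psi(a,c;x)=\frac{\Gamma(1-c)}{\Gamma(a-c+1)}\,{}_1F_1[a;c;x]+\frac{\Gamma(c-1)}{\Gamma(a)}\,x^{1-c}\,{}_1F_1[a-c+1;2-c;x],\qquad {}_1F_1[a;c;x]=\sum_{k\ge0}\frac{(a)_k}{(c)_k\,k!}x^k,$$ (with $1/\Gamma=0$ at the poles of $\Gamma$), and for $c\in\mathbb Z$ it is the limit of this expression as $c'\to c$, $c'\neq c$. Let $\alpha,\beta\in\mathbb R$ satisfy $|\alpha-\beta|<\tfrac12$ and $\alpha,\beta\notin\mathbb Z+\tfrac12$. Put $$\mu_{\alpha,\beta}(y)=|y|^{\beta-\alpha}e^{-|y|}\times\begin{cases}\cos\pi\beta,& y>0,\\ \cos\pi\alpha,& y<0,\end{cases}$$ and for $n\in\mathbb Z$ $$\mathcal L_n^{\alpha,\beta}(y)=\begin{cases}\dfrac{1}{\Gamma(1/2-n-\alpha)}\,\Psi(1/2+n+\beta,\,1-\alpha+\beta;\,y),& y>0,\\[2mm] \dfrac{1}{\Gamma(1/2+n+\beta)}\,\Psi(1/2-n-\alpha,\,1-\alpha+\beta;\,-y),&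 y<0.\end{cases}$$ Then the functions $\mathcal L_n^{\alpha,\beta}$, $n\in\mathbb Z$, belong to $L^2(\mathbb R,|\mu_{\alpha,\beta}(y)|\,dy)$, the products $\mathcal L_m^{\alpha,\beta}\mathcal L_n^{\alpha,\beta}\mu_{\alpha,\beta}$ are integrable on $\mathbb R$, and $$\int_{-\infty}^{\infty}\mathcal L_m^{\alpha,\beta}(y)\,\mathcal L_n^{\alpha,\beta}(y)\,\mu_{\alpha,\beta}(y)\,dy=0\quad(m\ne n),\qquad \int_{-\infty}^{\infty}\bigl|\mathcal L_n^{\alpha,\beta}(y)\bigr|^2\mu_{\alpha,\beta}(y)\,dy=\frac{(-1)^n\pi}{\Gamma(1/2+n+\beta)\,\Gamma(1/2-n-\alpha)}\ne0,$$ and their complex linear span is dense in $L^2(\mathbb R,|\mu_{\alpha,\beta}(y)|\,dy)$. In particular, whenever $\cos\pi\alpha\cdot\cos\pi\beta>0$, so that $\mu_{\alpha,\beta}$ has constant sign, they form an orthogonal basis of the Hilbert space $L^2(\mathbb R,|\mu_{\alpha,\beta}(y)|\,dy)$: divided by $\bigl|\tfrac{(-1)^n\pi}{\Gamma(1/2+n+\beta)\Gamma(1/2-n-\alpha)}\bigr|^{1/2}$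 they form an orthonormal (Hilbert) basis. -/

import Mathlib

open Filter Topology

/-- Kummer's confluent hypergeometric function `₁F₁[a; c; x] = ∑ (a)ₙ / ((c)ₙ n!) xⁿ`
(meaningful when `c` is not one of `0, -1, -2, …`). -/
noncomputable def kummerF (a c x : ℝ) : ℝ :=
  ∑' n : ℕ, (ascPochhammer ℝ n).eval a / ((ascPochhammer ℝ n).eval c * (n.factorial : ℝ)) * x ^ n

/-- The connection formula
`Γ(1-c)/Γ(a-c+1) ₁F₁[a; c; x] + Γ(c-1)/Γ(a) x^(1-c) ₁F₁[a-c+1; 2-c; x]`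
for real `a`, `c` with `c` not an integer, and `x > 0`. Since `Real.Gamma` is `0` at its poles and
`t / 0 = 0`, the quotient `1 / Γ` vanishes at the poles of `Γ`, as it should. -/
noncomputable def tricomiFormula (a c x : ℝ) : ℝ :=
  Real.Gamma (1 - c) / Real.Gamma (a - c + 1) * kummerF a c x
    + Real.Gamma (c - 1) / Real.Gamma a * x ^ (1 - c) * kummerF (a - c + 1) (2 - c) x

open Classical in
/-- Tricomi's confluent hypergeometric function `Ψ(a, c; x)` for `x > 0`: the connection formula
when `c` is not an integer, and its limit `c' → c`, `c' ≠ c`, when `c` is an integer. -/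
noncomputable def tricomiPsi (a c x : ℝ) : ℝ :=
  if ∃ k : ℤ, c = (k : ℝ) then limUnder (𝓝[≠] c) (fun c' : ℝ => tricomiFormula a c' x)
  else tricomiFormula a c x

/-- The function `𝓛ₙ^{α,β}` on the real line (its value at the single point `0` is irrelevant). -/
noncomputable def perturbedLaguerre (α β : ℝ) (n : ℤ) (y : ℝ) : ℝ :=
  if 0 < y then
    1 / Real.Gamma (1 / 2 - n - α) * tricomiPsi (1 / 2 + n + β) (1 - α + β) y
  else if y < 0 then
    1 / Real.Gamma (1 / 2 + n + β) * tricomiPsi (1 / 2 - n - α) (1 - α + β) (-y)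
  else 0

/-- The (possibly signed) weight `μ_{α,β}`: `|y|^(β-α) e^(-|y|)` times `cos πβ` for `y > 0` and
`cos πα` for `y < 0`. -/
noncomputable def laguerreWeight (α β : ℝ) (y : ℝ) : ℝ :=
  |y| ^ (β - α) * Real.exp (-|y|) *
    (if 0 < y then Real.cos (Real.pi * β) else Real.cos (Real.pi * α))

/-- The positive measure `|μ_{α,β}(y)| dy` on the real line. -/
noncomputable def laguerreMeasure (α β : ℝ) : MeasureTheory.Measure ℝ :=
  MeasureTheory.volume.withDensity (fun y : ℝ => ENNReal.ofReal |laguerreWeight α β y|)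

/-- The value `(-1)ⁿ π / (Γ(1/2+n+β) Γ(1/2-n-α))` of the inner square of `𝓛ₙ^{α,β}`. -/
noncomputable def laguerreSquare (α β : ℝ) (n : ℤ) : ℝ :=
  (-1 : ℝ) ^ n * Real.pi / (Real.Gamma (1 / 2 + n + β) * Real.Gamma (1 / 2 - n - α))

open Filter Topology MeasureTheory Set
open scoped FourierTransform Convolution ComplexConjugate ContDiff

/-! Put z = 1/2 + 2πiξ. The functions `y^(σ-1) e^(-y/2) Ψ` on the two half-lines, with first
parameters q and p where p + q = σ, glue to a function `tricomiPair p q` on the line whose Fourier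
transform is z^(-p) z̄^(-q) (`hasFourier_tricomiPair`). Replacing (p, q) by (p + n, q - n)
multiplies the transform by wⁿ, where w = z̄/z maps the line injectively into the unit circle,
missing only -1. On the Fourier side the family is thus a trigonometric system times a fixed
function.

Up to elementary factors, 𝓛ₙ is such a pair in two ways: directly, with p + q = 1 - α + β
(`tricomiPair_eq_perturbedLaguerre`), and after Kummer's transformation, with p + q = 1 + α - β
(`laguerreSquare_mul_tricomiPair`). In the second form the reflection formula for Γ produces the
cosines of the weight. The condition |α - β| < 1/2 says that both sums lie in (1/2, 3/2), so that
both forms are in L². Writing one factor of 𝓛ₘ 𝓛ₙ μ in each form, Plancherel reduces the integral to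
that of |z|^(-2) w^(m-n). For m = n this is a Cauchy density of mass 1. Otherwise it is a multiple
of the derivative of w^(m-n), which has the same limit at both ends (`integral_rootSymbol_int`).

For density, let G annihilate all pairs. A Schwartz function f has a transform which, divided by a
fixed symbol v, tends to 0 at infinity, so by Stone–Weierstrass on the compactified line it is
uniformly close to a Laurent polynomial in w. Hence f is close, both in L² and uniformly, to a
combination of the pairs (`exists_sub_sum_le`). This suffices because G is integrable near 0 and
square integrable away from 0 (`ae_eq_zero_of_integral_tricomiPair`).

The Fourier transform itself rests on Laplace's integral for Ψ, obtained from a uniqueness statement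
for Kummer's equation, continued across c = 1 by a limit and to a ≤ 0 by recurrences in a.
Convolving a Gamma density with a reflected one realises the symbols with p, q > 0. Contiguous
relations then reach all non-integer p, q with sum in (1/2, 3/2). -/

/-! ### Kummer's series: convergence, derivative, contiguity, differential equation -/

/-- The coefficient `(a)ₖ / ((c)ₖ k!)` of Kummer's series. -/
noncomputable def kummerCoeff (a c : ℝ) (k : ℕ) : ℝ :=
  (ascPochhammer ℝ k).eval a / ((ascPochhammer ℝ k).eval c * (k.factorial : ℝ))

lemma kummerF_eq_tsum (a c x : ℝ) : kummerF a c x = ∑' k, kummerCoeff a c k * x ^ k := rfl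

@[simp] lemma kummerCoeff_zero (a c : ℝ) : kummerCoeff a c 0 = 1 := by simp [kummerCoeff]

lemma ascPochhammer_eval_pos {c : ℝ} (hc : 0 < c) (k : ℕ) : 0 < (ascPochhammer ℝ k).eval c :=
  ascPochhammer_pos k c hc

lemma ascPochhammer_eval_succ_left (a : ℝ) (k : ℕ) :
    (ascPochhammer ℝ (k + 1)).eval a = a * (ascPochhammer ℝ k).eval (a + 1) := by
  simp [ascPochhammer_succ_left, Polynomial.eval_comp]

lemma kummerCoeff_succ {c : ℝ} (hc : 0 < c) (a : ℝ) (k : ℕ) :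
    kummerCoeff a c (k + 1) = kummerCoeff a c k * ((a + k) / ((c + k) * (k + 1))) := by
  have h1 := ascPochhammer_eval_pos hc k
  have h2 : 0 < c + k := by positivity
  simp only [kummerCoeff, ascPochhammer_succ_eval, Nat.factorial_succ]
  push_cast
  field_simp

lemma kummerCoeff_succ_mul {c : ℝ} (hc : 0 < c) (a : ℝ) (k : ℕ) :
    ((k : ℝ) + 1) * kummerCoeff a c (k + 1) = a / c * kummerCoeff (a + 1) (c + 1) k := by
  have h1 := ascPochhammer_eval_pos (by positivity : 0 < c + 1) k
  simp only [kummerCoeff, ascPochhammer_eval_succ_left, Nat.factorial_succ]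
  push_cast
  field_simp

lemma summable_kummer {c : ℝ} (hc : 0 < c) (a x : ℝ) :
    Summable fun k : ℕ => kummerCoeff a c k * x ^ k := by
  -- This bounds |a + n| / (c + n) for every n, so the ratio of consecutive terms is at most K|x| /
  -- (n + 1).
  set K : ℝ := |a| / c + 1
  have hK : Tendsto (fun n : ℕ => K * |x| / ((n : ℝ) + 1)) atTop (𝓝 0) := by
    refine Tendsto.div_atTop tendsto_const_nhds ?_
    exact tendsto_atTop_add_const_right _ _ tendsto_natCast_atTop_atTop
  refine summable_of_ratio_norm_eventually_le (r := 1 / 2) (by norm_num) ?_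
  filter_upwards [hK.eventually (ge_mem_nhds (by norm_num : (0 : ℝ) < 1 / 2))] with n hn
  have h2 : 0 < c + n := by positivity
  have h3 : |a + n| ≤ K * (c + n) := by
    have e : K * (c + n) = |a| + |a| / c * n + c + n := by
      simp only [K]; field_simp; ring
    have : 0 ≤ |a| / c * n := by positivity
    have := abs_add_le a n
    rw [abs_of_nonneg (by positivity : (0 : ℝ) ≤ n)] at this
    linarith
  have h4 : |a + n| / ((c + n) * (n + 1)) * |x| ≤ 1 / 2 := by
    refine le_trans ?_ hn
    rw [div_mul_eq_mul_div, div_le_div_iff₀ (by positivity) (by positivity)]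
    have := mul_le_mul_of_nonneg_right h3 (by positivity : 0 ≤ |x| * ((n : ℝ) + 1))
    nlinarith
  rw [kummerCoeff_succ hc, pow_succ]
  simp only [norm_mul, Real.norm_eq_abs, abs_div,
    abs_of_pos (by positivity : 0 < (c + n) * ((n : ℝ) + 1))]
  have := mul_le_mul_of_nonneg_left h4 (by positivity : 0 ≤ |kummerCoeff a c n| * |x ^ n|)
  linarith

lemma hasDerivAt_kummerF {c : ℝ} (hc : 0 < c) (a x : ℝ) :
    HasDerivAt (kummerF a c) (a / c * kummerF (a + 1) (c + 1) x) x := by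
  set R : ℝ := |x| + 1
  have hder : ∀ (n : ℕ) (y : ℝ), y ∈ Metric.ball (0 : ℝ) R →
      HasDerivAt (fun z => kummerCoeff a c n * z ^ n)
        (kummerCoeff a c n * (n * y ^ (n - 1))) y := fun n y _ => by
    simpa using (hasDerivAt_pow n y).const_mul (kummerCoeff a c n)
  have hs : Summable fun n : ℕ => |kummerCoeff a c n| * (n * R ^ (n - 1)) := by
    rw [← summable_nat_add_iff 1]
    have := ((summable_kummer (by positivity : 0 < c + 1) (a + 1) R).mul_left (a / c)).abs
    refine this.congr fun k => ?_
    have hR : 0 ≤ R := by positivity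
    rw [← mul_assoc, ← kummerCoeff_succ_mul hc, abs_mul, abs_mul, abs_pow, abs_of_nonneg hR,
      abs_of_pos (by positivity : 0 < (k : ℝ) + 1), Nat.add_sub_cancel]
    push_cast
    ring
  have hx : x ∈ Metric.ball (0 : ℝ) R := by simp [R]
  have key := hasDerivAt_tsum_of_isPreconnected hs Metric.isOpen_ball
    (convex_ball (0 : ℝ) R).isPreconnected hder (fun n y hy => ?_) hx
    (summable_kummer hc a x) hx
  · refine key.congr_deriv ?_
    have h0 : Summable fun n : ℕ => kummerCoeff a c n * (n * x ^ (n - 1)) := by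
      refine Summable.of_norm_bounded hs fun n => ?_
      rw [norm_mul, norm_mul, norm_pow, Real.norm_eq_abs, Real.norm_natCast, Real.norm_eq_abs]
      gcongr
      simp [R]
    rw [h0.tsum_eq_zero_add, kummerF_eq_tsum, ← tsum_mul_left]
    simp only [Nat.cast_zero, zero_mul, mul_zero, zero_add]
    refine tsum_congr fun k => ?_
    rw [← mul_assoc (a / c), ← kummerCoeff_succ_mul hc]
    rw [Nat.add_sub_cancel]
    push_cast
    ring
  · rw [norm_mul, norm_mul, norm_pow, Real.norm_eq_abs, Real.norm_natCast, Real.norm_eq_abs]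
    gcongr
    simpa using (mem_ball_zero_iff.1 hy).le

lemma kummerF_zero_right (a c : ℝ) : kummerF a c 0 = 1 := by
  rw [kummerF_eq_tsum, tsum_eq_single 0 (fun k hk => by simp [hk])]
  simp

/-- Comparison of coefficients of x^(k+1). The factor x shifts one index, so the constant terms are
split off first; they cancel because (c - a) + (2a - c) - a = 0. -/
lemma kummerF_contiguous {c : ℝ} (hc : 0 < c) (a x : ℝ) :
    (c - a) * kummerF (a - 1) c x + (2 * a - c + x) * kummerF a c x - a * kummerF (a + 1) c x
      = 0 := by
  have h1 := summable_kummer hc (a - 1) x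
  have h2 := summable_kummer hc a x
  have h3 := summable_kummer hc (a + 1) x
  have e : ∀ k : ℕ, (c - a) * kummerCoeff (a - 1) c (k + 1)
      + (2 * a - c) * kummerCoeff a c (k + 1) - a * kummerCoeff (a + 1) c (k + 1)
      + kummerCoeff a c k = 0 := fun k => by
    have hp := ascPochhammer_eval_pos hc k
    have h2 : 0 < c + k := by positivity
    have e1 : (ascPochhammer ℝ (k + 1)).eval (a - 1) = (a - 1) * (ascPochhammer ℝ k).eval a := by
      rw [ascPochhammer_eval_succ_left, sub_add_cancel]
    have e2 : a * (ascPochhammer ℝ (k + 1)).eval (a + 1)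
        = (ascPochhammer ℝ k).eval a * (a + k) * (a + k + 1) := by
      rw [← ascPochhammer_eval_succ_left, ascPochhammer_succ_eval, ascPochhammer_succ_eval]
      push_cast; ring
    have e3 : a * kummerCoeff (a + 1) c (k + 1) = (ascPochhammer ℝ k).eval a * (a + k) *
        (a + k + 1) / ((ascPochhammer ℝ (k + 1)).eval c * ((k + 1).factorial : ℝ)) := by
      rw [← e2, kummerCoeff]; ring
    rw [e3]
    simp only [kummerCoeff, e1, ascPochhammer_succ_eval, Nat.factorial_succ]
    push_cast
    field_simp
    ring
  have z1 := h1.tsum_eq_zero_add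
  have z2 := h2.tsum_eq_zero_add
  have z3 := h3.tsum_eq_zero_add
  have s1 := ((summable_nat_add_iff 1).2 h1).mul_left (c - a)
  have s2 := ((summable_nat_add_iff 1).2 h2).mul_left (2 * a - c)
  have s3 := ((summable_nat_add_iff 1).2 h3).mul_left a
  have s4 := h2.mul_left x
  have t := ((s1.add s2).sub s3).add s4
  have key : ∑' k : ℕ, ((c - a) * (kummerCoeff (a - 1) c (k + 1) * x ^ (k + 1))
      + (2 * a - c) * (kummerCoeff a c (k + 1) * x ^ (k + 1))
      - a * (kummerCoeff (a + 1) c (k + 1) * x ^ (k + 1)) + x * (kummerCoeff a c k * x ^ k))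
      = 0 := by
    refine (tsum_congr ?_).trans tsum_zero
    intro k
    linear_combination x ^ (k + 1) * e k
  rw [((s1.add s2).sub s3).tsum_add s4, (s1.add s2).tsum_sub s3, s1.tsum_add s2, tsum_mul_left,
    tsum_mul_left, tsum_mul_left, tsum_mul_left] at key
  simp only [kummerF_eq_tsum]
  simp only [kummerCoeff_zero, pow_zero, mul_one] at z1 z2 z3
  linear_combination key + (c - a) * z1 + (2 * a - c) * z2 - a * z3

/-- Kummer's equation, with both derivatives already replaced by series with shifted parameters. -/
lemma kummerF_ode {c : ℝ} (hc : 0 < c) (a x : ℝ) :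
    x * (a / c * ((a + 1) / (c + 1) * kummerF (a + 1 + 1) (c + 1 + 1) x))
      + (c - x) * (a / c * kummerF (a + 1) (c + 1) x) - a * kummerF a c x = 0 := by
  have hc1 : 0 < c + 1 := by positivity
  have hc2 : 0 < c + 1 + 1 := by positivity
  have h1 := summable_kummer hc a x
  have h2 := summable_kummer hc1 (a + 1) x
  have h3 := summable_kummer hc2 (a + 1 + 1) x
  have z1 := h1.tsum_eq_zero_add
  have z2 := h2.tsum_eq_zero_add
  have s1 := ((summable_nat_add_iff 1).2 h1).mul_left a
  have s2 := ((summable_nat_add_iff 1).2 h2).mul_left a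
  have s3 := h3.mul_left (x * (a / c * ((a + 1) / (c + 1))))
  have s4 := h2.mul_left (x * (a / c))
  have e : ∀ k : ℕ, a / c * ((a + 1) / (c + 1) * kummerCoeff (a + 1 + 1) (c + 1 + 1) k)
      + a * kummerCoeff (a + 1) (c + 1) (k + 1) - a / c * kummerCoeff (a + 1) (c + 1) k
      - a * kummerCoeff a c (k + 1) = 0 := fun k => by
    rw [← kummerCoeff_succ_mul hc1 (a + 1) k, ← kummerCoeff_succ_mul hc a k]
    have := kummerCoeff_succ_mul hc a (k + 1)
    have h5 := kummerCoeff_succ hc a (k + 1)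
    have h6 : (0 : ℝ) < c + (k + 1) := by positivity
    have h7 : a * kummerCoeff (a + 1) (c + 1) (k + 1)
        = c * ((((k + 1 : ℕ) : ℝ) + 1) * kummerCoeff a c (k + 1 + 1)) := by
      rw [this]; field_simp
    have h8 : a / c * (((k : ℝ) + 1) * kummerCoeff (a + 1) (c + 1) (k + 1))
        = (k + 1) * ((((k + 1 : ℕ) : ℝ) + 1) * kummerCoeff a c (k + 1 + 1)) := by
      rw [this]; ring
    rw [h8, h7, h5]
    push_cast
    field_simp
    ring
  have key : ∑' k : ℕ, (x * (a / c * ((a + 1) / (c + 1)))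
        * (kummerCoeff (a + 1 + 1) (c + 1 + 1) k * x ^ k)
      + a * (kummerCoeff (a + 1) (c + 1) (k + 1) * x ^ (k + 1))
      - x * (a / c) * (kummerCoeff (a + 1) (c + 1) k * x ^ k)
      - a * (kummerCoeff a c (k + 1) * x ^ (k + 1))) = 0 := by
    refine (tsum_congr ?_).trans tsum_zero
    intro k
    linear_combination x ^ (k + 1) * e k
  rw [((s3.add s2).sub s4).tsum_sub s1, (s3.add s2).tsum_sub s4, s3.tsum_add s2, tsum_mul_left,
    tsum_mul_left, tsum_mul_left, tsum_mul_left] at key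
  simp only [← kummerF_eq_tsum] at key z1 z2
  have ec : c * (a / c) = a := by field_simp
  simp only [kummerCoeff_zero, pow_zero, mul_one] at z1 z2
  rw [sub_mul, ← mul_assoc c, ec]
  linear_combination key + a * z2 - a * z1

lemma one_le_kummerF {a c x : ℝ} (ha : 0 < a) (hc : 0 < c) (hx : 0 ≤ x) : 1 ≤ kummerF a c x := by
  have h := (summable_kummer hc a x).sum_le_tsum {0} (fun k _ => ?_)
  · simpa [kummerF_eq_tsum] using h
  · have := ascPochhammer_eval_pos ha k
    have := ascPochhammer_eval_pos hc k
    unfold kummerCoeff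
    positivity

/-! ### Symmetry and recurrence of the connection formula -/

/-- The value 0 of 1/Γ at the poles is compatible with the functional equation, so later recurrences
need no case distinction. -/
lemma one_div_Gamma_eq (s : ℝ) : 1 / Real.Gamma s = s * (1 / Real.Gamma (s + 1)) := by
  rcases eq_or_ne s 0 with rfl | hs
  · simp
  · rw [Real.Gamma_add_one hs]
    field_simp

/-- The substitution (a, c) ↦ (a - c + 1, 2 - c) interchanges the two summands. -/
lemma tricomiFormula_kummer (a c : ℝ) {x : ℝ} (hx : 0 < x) :
    tricomiFormula a c x = x ^ (1 - c) * tricomiFormula (a - c + 1) (2 - c) x := by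
  unfold tricomiFormula
  have h : x ^ (1 - c) * x ^ (1 - (2 - c)) = 1 := by
    rw [← Real.rpow_add hx]; ring_nf; simp
  have e1 : (1 - (2 - c)) = c - 1 := by ring
  have e2 : a - c + 1 - (2 - c) + 1 = a := by ring
  have e3 : 2 - c - 1 = 1 - c := by ring
  have e4 : 2 - (2 - c) = c := by ring
  rw [e1] at h ⊢
  rw [e2, e3, e4]
  linear_combination (-(Real.Gamma (1 - c) / Real.Gamma (a - c + 1) * kummerF a c x)) * h

/-- Each summand satisfies the relation by itself, through `kummerF_contiguous`; the range of c
keeps both lower parameters c and 2 - c positive. -/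
lemma tricomiFormula_recurrence {c : ℝ} (hc0 : 0 < c) (hc2 : c < 2) (a x : ℝ) :
    tricomiFormula (a - 1) c x + (c - 2 * a - x) * tricomiFormula a c x
      + a * (a - c + 1) * tricomiFormula (a + 1) c x = 0 := by
  unfold tricomiFormula
  have g1 := one_div_Gamma_eq (a - c)
  have g2 := one_div_Gamma_eq (a - c + 1)
  have g3 := one_div_Gamma_eq (a - 1)
  have g4 := one_div_Gamma_eq a
  have k1 := kummerF_contiguous hc0 a x
  have k2 := kummerF_contiguous (by linarith : 0 < 2 - c) (a - c + 1) x
  have e1 : a - 1 - c + 1 = a - c := by ring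
  have e2 : a + 1 - c + 1 = a - c + 1 + 1 := by ring
  have e3 : a - c + 1 - 1 = a - c := by ring
  rw [sub_add_cancel] at g3
  rw [e3] at k2
  rw [e1, e2]
  set A := kummerF (a - 1) c x
  set B := kummerF a c x
  set C := kummerF (a + 1) c x
  set A' := kummerF (a - c) (2 - c) x
  set B' := kummerF (a - c + 1) (2 - c) x
  set C' := kummerF (a - c + 1 + 1) (2 - c) x
  set X := x ^ (1 - c)
  simp only [div_eq_mul_one_div (Real.Gamma (1 - c)), div_eq_mul_one_div (Real.Gamma (c - 1))]
  rw [g1, g3]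
  rw [g2, g4]
  linear_combination (-Real.Gamma (1 - c) * (a - c + 1) * (1 / Real.Gamma (a - c + 1 + 1))) * k1
    + (-Real.Gamma (c - 1) * a * (1 / Real.Gamma (a + 1))) * X * k2

/-! ### Laplace integrals: contiguity, symmetry, behaviour at the origin -/

/-- The integrand `s^(a-1) (1+s)^k e^(-xs)` of the Laplace integral for Tricomi's function. -/
noncomputable def laplaceKernel (a k x s : ℝ) : ℝ :=
  s ^ (a - 1) * (1 + s) ^ k * Real.exp (-(x * s))

/-- The Laplace integral `∫₀^∞ s^(a-1) (1+s)^k e^(-xs) ds`; for `k = c - a - 1` it is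
`Γ(a) Ψ(a, c; x)`. -/
noncomputable def laplaceInt (a k x : ℝ) : ℝ := ∫ s in Ioi (0 : ℝ), laplaceKernel a k x s

lemma measurable_laplaceKernel (a k x : ℝ) : Measurable (laplaceKernel a k x) := by
  unfold laplaceKernel
  fun_prop

lemma laplaceKernel_nonneg (a k x : ℝ) {s : ℝ} (hs : 0 < s) : 0 ≤ laplaceKernel a k x s := by
  unfold laplaceKernel
  positivity

/-- The inequality exp t ≥ 1 + t gives 1 + s ≤ K exp(xs/m) as soon as K ≥ 1 and Kx/m ≥ 1; it is then
raised to a power m ≥ k. -/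
lemma one_add_rpow_le_exp (k : ℝ) {x : ℝ} (hx : 0 < x) :
    ∃ C : ℝ, 0 < C ∧ ∀ s : ℝ, 0 ≤ s → (1 + s) ^ k ≤ C * Real.exp (x * s) := by
  set m := max k 1
  have hm : 0 < m := lt_max_of_lt_right one_pos
  set K := max 1 (m / x)
  have hK1 : 1 ≤ K := le_max_left _ _
  refine ⟨K ^ m, by positivity, fun s hs => ?_⟩
  have h1 : 1 + s ≤ K * Real.exp (x / m * s) := by
    have e := Real.add_one_le_exp (x / m * s)
    have h2 : 1 ≤ K * (x / m) := by
      have : m / x * (x / m) ≤ K * (x / m) := by gcongr; exact le_max_right _ _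
      have e : m / x * (x / m) = 1 := by field_simp
      linarith
    calc 1 + s ≤ K * (x / m * s + 1) := by nlinarith
      _ ≤ _ := by gcongr
  calc (1 + s) ^ k ≤ (1 + s) ^ m :=
        Real.rpow_le_rpow_of_exponent_le (by linarith) (le_max_left _ _)
    _ ≤ (K * Real.exp (x / m * s)) ^ m := by gcongr
    _ = K ^ m * Real.exp (x * s) := by
        rw [Real.mul_rpow (by positivity) (Real.exp_pos _).le, ← Real.exp_mul]
        congr 2
        field_simp

lemma integrableOn_rpow_mul_exp {a x : ℝ} (ha : 0 < a) (hx : 0 < x) :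
    IntegrableOn (fun s : ℝ => s ^ (a - 1) * Real.exp (-(x * s))) (Ioi 0) := by
  have := integrableOn_rpow_mul_exp_neg_mul_rpow (s := a - 1) (p := 1) (b := x) (by linarith)
    one_pos hx
  simpa using this

lemma integrableOn_laplaceKernel {a x : ℝ} (ha : 0 < a) (k : ℝ) (hx : 0 < x) :
    IntegrableOn (laplaceKernel a k x) (Ioi 0) := by
  obtain ⟨C, hC, h⟩ := one_add_rpow_le_exp k (half_pos hx)
  refine Integrable.mono' ((integrableOn_rpow_mul_exp ha (half_pos hx)).const_mul C)
    (measurable_laplaceKernel a k x).aestronglyMeasurable ?_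
  refine (ae_restrict_iff' measurableSet_Ioi).2 (ae_of_all _ fun s (hs : 0 < s) => ?_)
  rw [Real.norm_of_nonneg (laplaceKernel_nonneg a k x hs), laplaceKernel]
  have e : Real.exp (-(x * s)) = Real.exp (-(x / 2 * s)) * Real.exp (-(x / 2 * s)) := by
    rw [← Real.exp_add]; ring_nf
  have e2 : Real.exp (x / 2 * s) * Real.exp (-(x / 2 * s)) = 1 := by
    rw [← Real.exp_add]; simp
  calc _ ≤ s ^ (a - 1) * (C * Real.exp (x / 2 * s)) * Real.exp (-(x * s)) := by
        gcongr; exact h s hs.le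
    _ = C * (s ^ (a - 1) * Real.exp (-(x / 2 * s)))
        * (Real.exp (x / 2 * s) * Real.exp (-(x / 2 * s))) := by rw [e]; ring
    _ = _ := by rw [e2, mul_one]

lemma laplaceInt_nonneg (a k x : ℝ) : 0 ≤ laplaceInt a k x :=
  setIntegral_nonneg measurableSet_Ioi fun _ hs => laplaceKernel_nonneg a k x hs

lemma laplaceInt_add_one_right {a x : ℝ} (ha : 0 < a) (k : ℝ) (hx : 0 < x) :
    laplaceInt a (k + 1) x = laplaceInt a k x + laplaceInt (a + 1) k x := by
  unfold laplaceInt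
  rw [← integral_add (integrableOn_laplaceKernel ha k hx)
    (integrableOn_laplaceKernel (by linarith) k hx)]
  refine setIntegral_congr_fun measurableSet_Ioi fun s (hs : 0 < s) => ?_
  have e1 : (1 + s) ^ (k + 1) = (1 + s) ^ k * (1 + s) := by
    rw [Real.rpow_add (by linarith), Real.rpow_one]
  have e2 : s ^ (a + 1 - 1) = s ^ (a - 1) * s := by
    rw [show a + 1 - 1 = a - 1 + 1 by ring, Real.rpow_add hs, Real.rpow_one]
  simp only [laplaceKernel, e1, e2]
  ring

lemma tendsto_rpow_one_add_rpow_exp {a k x : ℝ} (hx : 0 < x) :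
    Tendsto (fun s : ℝ => s ^ a * (1 + s) ^ k * Real.exp (-(x * s))) atTop (𝓝 0) := by
  obtain ⟨C, hC, h⟩ := one_add_rpow_le_exp k (half_pos hx)
  have h0 := (tendsto_rpow_mul_exp_neg_mul_atTop_nhds_zero a (x / 2) (half_pos hx)).const_mul C
  rw [mul_zero] at h0
  refine squeeze_zero' ?_ ?_ h0
  · filter_upwards [eventually_gt_atTop 0] with s hs
    positivity
  · filter_upwards [eventually_gt_atTop 0] with s hs
    have e : Real.exp (-(x * s)) = Real.exp (-(x / 2) * s) * Real.exp (-(x / 2 * s)) := by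
      rw [← Real.exp_add]; ring_nf
    have e2 : Real.exp (x / 2 * s) * Real.exp (-(x / 2 * s)) = 1 := by
      rw [← Real.exp_add]; simp
    calc _ ≤ s ^ a * (C * Real.exp (x / 2 * s)) * Real.exp (-(x * s)) := by
          gcongr; exact h s hs.le
      _ = C * (s ^ a * Real.exp (-(x / 2) * s))
          * (Real.exp (x / 2 * s) * Real.exp (-(x / 2 * s))) := by rw [e]; ring
      _ = _ := by rw [e2, mul_one]

/-- Integration by parts for the Laplace integral. -/
lemma laplaceInt_parts {a x : ℝ} (ha : 0 < a) (k : ℝ) (hx : 0 < x) :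
    a * laplaceInt a (k + 1) x + (k + 1) * laplaceInt (a + 1) k x
      - x * laplaceInt (a + 1) (k + 1) x = 0 := by
  have i1 := (integrableOn_laplaceKernel ha (k + 1) hx).const_mul a
  have i2 := (integrableOn_laplaceKernel (by linarith : 0 < a + 1) k hx).const_mul (k + 1)
  have i3 := (integrableOn_laplaceKernel (by linarith : 0 < a + 1) (k + 1) hx).const_mul x
  have i12 : Integrable (fun s => a * laplaceKernel a (k + 1) x s
      + (k + 1) * laplaceKernel (a + 1) k x s) (volume.restrict (Ioi 0)) := i1.add i2
  -- The boundary terms of s^a (1+s)^(k+1) e^(-xs) vanish: at 0 since a > 0, at infinity by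
  -- exponential decay.
  have key := integral_Ioi_of_hasDerivAt_of_tendsto
    (f := fun s : ℝ => s ^ a * (1 + s) ^ (k + 1) * Real.exp (-(x * s))) (a := 0) ?_ ?_
    (i12.sub i3) (tendsto_rpow_one_add_rpow_exp hx)
  · simp only [Pi.sub_apply] at key
    rw [integral_sub i12 i3, integral_add i1 i2, integral_const_mul, integral_const_mul,
      integral_const_mul, Real.zero_rpow ha.ne'] at key
    simpa [laplaceInt] using key
  · refine ContinuousAt.continuousWithinAt ?_
    have h1 : ContinuousAt (fun s : ℝ => s ^ a) 0 :=
      Real.continuousAt_rpow_const _ _ (Or.inr ha.le)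
    have h2 : ContinuousAt (fun s : ℝ => (1 + s) ^ (k + 1)) 0 :=
      ContinuousAt.rpow_const (by fun_prop) (Or.inl (by norm_num))
    exact (h1.mul h2).mul (by fun_prop)
  · intro s (hs : 0 < s)
    have d1 := Real.hasDerivAt_rpow_const (x := s) (p := a) (Or.inl hs.ne')
    have d2 := ((hasDerivAt_id s).const_add 1).rpow_const (p := k + 1)
      (Or.inl (by simp only [id]; linarith))
    have d3 := (((hasDerivAt_id s).const_mul x).neg).exp
    refine ((d1.mul d2).mul d3).congr_deriv ?_
    have e1 : (1 + s) ^ (k + 1) = (1 + s) ^ k * (1 + s) := by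
      rw [Real.rpow_add (by linarith), Real.rpow_one]
    have e2 : s ^ a = s ^ (a - 1) * s := by
      conv_lhs => rw [show a = a - 1 + 1 by ring, Real.rpow_add hs, Real.rpow_one]
    simp only [laplaceKernel, Pi.sub_apply, Pi.neg_apply, Pi.mul_apply, id,
      add_sub_cancel_right, e1, e2]
    ring

/-- The integral `∫₀^∞ e^(-r) r^(a-1) (x+r)^k dr`, a rescaling of the Laplace integral. -/
noncomputable def shiftedGammaInt (a k x : ℝ) : ℝ :=
  ∫ r in Ioi (0 : ℝ), Real.exp (-r) * r ^ (a - 1) * (x + r) ^ k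

/-- Substitution r = xs. It isolates a power of x, which makes the limit x → 0 accessible by
dominated convergence. -/
lemma laplaceInt_eq_shiftedGammaInt (a k : ℝ) {x : ℝ} (hx : 0 < x) :
    laplaceInt a k x = x ^ (-(a + k)) * shiftedGammaInt a k x := by
  have h := integral_comp_mul_left_Ioi
    (fun r : ℝ => Real.exp (-r) * r ^ (a - 1) * (x + r) ^ k) 0 hx
  rw [mul_zero, smul_eq_mul] at h
  have h2 : shiftedGammaInt a k x = x * ∫ s in Ioi (0 : ℝ),
      Real.exp (-(x * s)) * (x * s) ^ (a - 1) * (x + x * s) ^ k := by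
    rw [h, shiftedGammaInt]
    field_simp
  rw [h2, laplaceInt, ← integral_const_mul, ← integral_const_mul]
  refine setIntegral_congr_fun measurableSet_Ioi fun s (hs : 0 < s) => ?_
  have e1 : x + x * s = x * (1 + s) := by ring
  have e2 : x ^ (-(a + k)) * (x * (x ^ (a - 1) * x ^ k)) = 1 := by
    nth_rewrite 2 [← Real.rpow_one x]
    rw [← Real.rpow_add hx, ← Real.rpow_add hx, ← Real.rpow_add hx,
      show -(a + k) + (1 + (a - 1 + k)) = 0 by ring, Real.rpow_zero]
  simp only [laplaceKernel]
  rw [e1, Real.mul_rpow hx.le hs.le, Real.mul_rpow hx.le (by linarith)]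
  linear_combination (-(s ^ (a - 1) * (1 + s) ^ k * Real.exp (-(x * s)))) * e2

/-- `Γ(-k) J(a, k; x) = Γ(a) ∫ e^(-r) r^(-k-1) (x+r)^(-a) dr`. -/
lemma Gamma_mul_laplaceInt {a k x : ℝ} (ha : 0 < a) (hk : k < 0) (hx : 0 < x) :
    Real.Gamma (-k) * laplaceInt a k x = Real.Gamma a * shiftedGammaInt (-k) (-a) x := by
  -- Fubini for this F: integrating out r produces Γ(-k) (1+s)^k, integrating out s produces Γ(a)
  -- (x+r)^(-a).
  set F : ℝ → ℝ → ℝ := fun s r =>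
    s ^ (a - 1) * Real.exp (-(x * s)) * (r ^ (-k - 1) * Real.exp (-((1 + s) * r))) with hF
  have hin : ∀ s : ℝ, 0 < s → ∫ r in Ioi (0 : ℝ), F s r
      = Real.Gamma (-k) * laplaceKernel a k x s := fun s hs => by
    simp only [hF]
    rw [integral_const_mul, Real.integral_rpow_mul_exp_neg_mul_Ioi (by linarith) (by linarith),
      laplaceKernel, one_div, Real.inv_rpow (by linarith), Real.rpow_neg (by linarith), inv_inv]
    ring
  have hnn : ∀ s r : ℝ, 0 < s → 0 < r → 0 ≤ F s r := fun s r hs hr => by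
    simp only [hF]; positivity
  have hint : Integrable (Function.uncurry F)
      ((volume.restrict (Ioi 0)).prod (volume.restrict (Ioi 0))) := by
    have hmeas : Measurable (Function.uncurry F) := by
      simp only [hF, Function.uncurry_def]
      fun_prop
    rw [integrable_prod_iff hmeas.aestronglyMeasurable]
    constructor
    · refine (ae_restrict_iff' measurableSet_Ioi).2 (ae_of_all _ fun s (hs : 0 < s) => ?_)
      exact (integrableOn_rpow_mul_exp (a := -k) (x := 1 + s) (by linarith)
        (by linarith)).const_mul (s ^ (a - 1) * Real.exp (-(x * s)))
    · refine ((integrableOn_laplaceKernel ha k hx).const_mul (Real.Gamma (-k))).congr ?_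
      refine (ae_restrict_iff' measurableSet_Ioi).2 (ae_of_all _ fun s (hs : 0 < s) => ?_)
      simp only [Function.uncurry]
      rw [← hin s hs]
      refine setIntegral_congr_fun measurableSet_Ioi fun r (hr : 0 < r) => ?_
      exact (Real.norm_of_nonneg (hnn s r hs hr)).symm
  have hswap := integral_integral_swap hint
  have h1 : ∫ s in Ioi (0 : ℝ), ∫ r in Ioi (0 : ℝ), F s r
      = Real.Gamma (-k) * laplaceInt a k x := by
    rw [laplaceInt, ← integral_const_mul]
    exact setIntegral_congr_fun measurableSet_Ioi fun s hs => hin s hs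
  rw [← h1, hswap, shiftedGammaInt, ← integral_const_mul]
  refine setIntegral_congr_fun measurableSet_Ioi fun r (hr : 0 < r) => ?_
  have e : ∀ s : ℝ, F s r = r ^ (-k - 1) * Real.exp (-r)
      * (s ^ (a - 1) * Real.exp (-((x + r) * s))) := fun s => by
    have : Real.exp (-(x * s)) * Real.exp (-((1 + s) * r))
        = Real.exp (-r) * Real.exp (-((x + r) * s)) := by
      rw [← Real.exp_add, ← Real.exp_add]; ring_nf
    simp only [hF]
    linear_combination s ^ (a - 1) * r ^ (-k - 1) * this
  simp only [e]
  rw [integral_const_mul, Real.integral_rpow_mul_exp_neg_mul_Ioi ha (by linarith), one_div,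
    Real.inv_rpow (by linarith), Real.rpow_neg (by linarith)]
  ring

/-- Kummer's transformation for the Laplace integral. -/
lemma laplaceInt_kummer {a k x : ℝ} (ha : 0 < a) (hk : k < 0) (hx : 0 < x) :
    Real.Gamma (-k) * laplaceInt a k x
      = Real.Gamma a * (x ^ (-(a + k)) * laplaceInt (-k) (-a) x) := by
  rw [Gamma_mul_laplaceInt ha hk hx, laplaceInt_eq_shiftedGammaInt (-k) (-a) hx, ← mul_assoc
    (x ^ (-(a + k))), ← Real.rpow_add hx]
  ring_nf
  simp

lemma hasDerivAt_laplaceInt {a x : ℝ} (ha : 0 < a) (k : ℝ) (hx : 0 < x) :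
    HasDerivAt (laplaceInt a k) (-laplaceInt (a + 1) k x) x := by
  have hb := integrableOn_laplaceKernel (by linarith : 0 < a + 1) k (half_pos hx)
  have key := hasDerivAt_integral_of_dominated_loc_of_deriv_le
    (μ := volume.restrict (Ioi (0 : ℝ))) (F := fun y s => laplaceKernel a k y s)
    (F' := fun y s => -laplaceKernel (a + 1) k y s) (x₀ := x) (s := Ioi (x / 2))
    (bound := laplaceKernel (a + 1) k (x / 2)) (Ioi_mem_nhds (by linarith))
    (Eventually.of_forall fun y => (measurable_laplaceKernel a k y).aestronglyMeasurable)
    (integrableOn_laplaceKernel ha k hx)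
    (measurable_laplaceKernel (a + 1) k x).neg.aestronglyMeasurable ?_ hb ?_
  · have := key.2
    rwa [integral_neg] at this
  · refine (ae_restrict_iff' measurableSet_Ioi).2 (ae_of_all _ fun s (hs : 0 < s) y hy => ?_)
    rw [norm_neg, Real.norm_of_nonneg (laplaceKernel_nonneg _ _ _ hs)]
    simp only [laplaceKernel]
    have : x / 2 < y := hy
    gcongr
  · refine (ae_restrict_iff' measurableSet_Ioi).2 (ae_of_all _ fun s (hs : 0 < s) y hy => ?_)
    have d := (((hasDerivAt_id y).mul_const s).neg).exp.const_mul (s ^ (a - 1) * (1 + s) ^ k)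
    refine d.congr_deriv ?_
    have e2 : s ^ (a + 1 - 1) = s ^ (a - 1) * s := by
      rw [show a + 1 - 1 = a - 1 + 1 by ring, Real.rpow_add hs, Real.rpow_one]
    simp only [laplaceKernel, e2, id]
    simp
    ring

/-- As k ≤ 0, (x+r)^k ≤ r^k, so the integrand of Γ(a + k) dominates. -/
lemma tendsto_shiftedGammaInt {a k : ℝ} (hk : k ≤ 0) (hak : 0 < a + k) :
    Tendsto (shiftedGammaInt a k) (𝓝[>] 0) (𝓝 (Real.Gamma (a + k))) := by
  rw [Real.Gamma_eq_integral hak]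
  refine tendsto_integral_filter_of_dominated_convergence
    (fun r : ℝ => Real.exp (-r) * r ^ (a + k - 1)) ?_ ?_ (Real.GammaIntegral_convergent hak) ?_
  · refine Eventually.of_forall fun x => ?_
    exact (by fun_prop : Measurable fun r : ℝ =>
      Real.exp (-r) * r ^ (a - 1) * (x + r) ^ k).aestronglyMeasurable
  · filter_upwards [self_mem_nhdsWithin] with x (hx : 0 < x)
    refine (ae_restrict_iff' measurableSet_Ioi).2 (ae_of_all _ fun r (hr : 0 < r) => ?_)
    rw [Real.norm_of_nonneg (by positivity), mul_assoc,
      show a + k - 1 = a - 1 + k by ring, Real.rpow_add hr]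
    have := Real.rpow_le_rpow_of_nonpos hr (by linarith : r ≤ x + r) hk
    gcongr
  · refine (ae_restrict_iff' measurableSet_Ioi).2 (ae_of_all _ fun r (hr : 0 < r) => ?_)
    have h : ContinuousAt (fun x : ℝ => Real.exp (-r) * r ^ (a - 1) * (x + r) ^ k) 0 :=
      continuousAt_const.mul (ContinuousAt.rpow_const (by fun_prop) (Or.inl (by simp [hr.ne'])))
    have h2 := h.tendsto.mono_left (nhdsWithin_le_nhds (s := Ioi 0))
    convert h2 using 2
    rw [show a + k - 1 = a - 1 + k by ring, Real.rpow_add hr, zero_add]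
    ring

lemma tendsto_rpow_mul_laplaceInt {a k : ℝ} (hk : k ≤ 0) (hak : 0 < a + k) :
    Tendsto (fun x => x ^ (a + k) * laplaceInt a k x) (𝓝[>] 0) (𝓝 (Real.Gamma (a + k))) := by
  refine (tendsto_shiftedGammaInt hk hak).congr' ?_
  filter_upwards [self_mem_nhdsWithin] with x (hx : 0 < x)
  rw [laplaceInt_eq_shiftedGammaInt a k hx, ← mul_assoc, ← Real.rpow_add hx]
  simp

/-- The case complementary to `tendsto_rpow_mul_laplaceInt`: `Gamma_mul_laplaceInt` exchanges (a, k)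
with (-k, -a), which makes the sum of the parameters positive. -/
lemma tendsto_laplaceInt {a k : ℝ} (ha : 0 < a) (hak : a + k < 0) :
    Tendsto (laplaceInt a k) (𝓝[>] 0)
      (𝓝 (Real.Gamma a * Real.Gamma (-(a + k)) / Real.Gamma (-k))) := by
  have hk : k < 0 := by linarith
  have hg : Real.Gamma (-k) ≠ 0 := (Real.Gamma_pos_of_pos (by linarith)).ne'
  have h := (tendsto_shiftedGammaInt (a := -k) (k := -a) (by linarith) (by linarith)).const_mul
    (Real.Gamma a / Real.Gamma (-k))
  rw [show -k + -a = -(a + k) by ring] at h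
  convert h.congr' ?_ using 2
  · ring
  · filter_upwards [self_mem_nhdsWithin] with x (hx : 0 < x)
    have := Gamma_mul_laplaceInt ha hk hx
    field_simp
    linarith

lemma tendsto_laplaceInt_right {a x : ℝ} (ha : 0 < a) (hx : 0 < x) (k : ℝ) :
    Tendsto (fun k' => laplaceInt a k' x) (𝓝 k) (𝓝 (laplaceInt a k x)) := by
  refine tendsto_integral_filter_of_dominated_convergence (laplaceKernel a (k + 1) x) ?_ ?_
    (integrableOn_laplaceKernel ha _ hx) ?_
  · exact Eventually.of_forall fun k' => (measurable_laplaceKernel a k' x).aestronglyMeasurable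
  · filter_upwards [Iio_mem_nhds (by linarith : k < k + 1)] with k' (hk' : k' < k + 1)
    refine (ae_restrict_iff' measurableSet_Ioi).2 (ae_of_all _ fun s (hs : 0 < s) => ?_)
    rw [Real.norm_of_nonneg (laplaceKernel_nonneg _ _ _ hs)]
    simp only [laplaceKernel]
    gcongr
    linarith
  · refine (ae_restrict_iff' measurableSet_Ioi).2 (ae_of_all _ fun s (hs : 0 < s) => ?_)
    simp only [laplaceKernel]
    have : ContinuousAt (fun k' : ℝ => (1 + s) ^ k') k :=
      Real.continuousAt_const_rpow (by linarith)
    exact (this.tendsto.const_mul _).mul_const _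

/-- Split at s = 1: the part near 0 is bounded independently of x, and the tail is compared with
s^(τ-2) e^(-xs), whose integral is Γ(τ-1) x^(1-τ). The free exponent τ > 1 avoids a separate
logarithmic estimate. -/
lemma laplaceInt_le {a k τ : ℝ} (ha : 0 < a) (hτ : 1 < τ) (hk : a + k + 1 ≤ τ) :
    ∃ C : ℝ, 0 < C ∧ ∀ x : ℝ, 0 < x → laplaceInt a k x ≤ C * (1 + x ^ (1 - τ)) := by
  set M : ℝ := 2 ^ |k|
  have hM : 0 < M := by positivity
  have hG : 0 < Real.Gamma (τ - 1) := Real.Gamma_pos_of_pos (by linarith)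
  have i0 : IntegrableOn (fun s : ℝ => s ^ (a - 1)) (Ioc 0 1) := by
    have := intervalIntegral.intervalIntegrable_rpow' (a := 0) (b := 1) (r := a - 1) (by linarith)
    rwa [intervalIntegrable_iff_integrableOn_Ioc_of_le zero_le_one] at this
  have i1 : Integrable ((Ioc (0 : ℝ) 1).indicator fun s : ℝ => s ^ (a - 1)) :=
    i0.integrable_indicator measurableSet_Ioc
  set B := ∫ s in Ioi (0 : ℝ), (Ioc (0 : ℝ) 1).indicator (fun s : ℝ => s ^ (a - 1)) s
  have hB : 0 ≤ B := setIntegral_nonneg measurableSet_Ioi fun s (hs : 0 < s) =>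
    indicator_nonneg (fun t ht => Real.rpow_nonneg ht.1.le _) _
  refine ⟨M * (B + Real.Gamma (τ - 1)), by positivity, fun x hx => ?_⟩
  have i2 := integrableOn_rpow_mul_exp (by linarith : 0 < τ - 1) hx
  have hle : laplaceInt a k x ≤ ∫ s in Ioi (0 : ℝ),
      M * ((Ioc (0 : ℝ) 1).indicator (fun s : ℝ => s ^ (a - 1)) s
        + s ^ (τ - 1 - 1) * Real.exp (-(x * s))) := by
    refine setIntegral_mono_on (integrableOn_laplaceKernel ha k hx)
      ((i1.integrableOn.add i2).const_mul M) measurableSet_Ioi fun s (hs : 0 < s) => ?_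
    have hexp : Real.exp (-(x * s)) ≤ 1 := Real.exp_le_one_iff.2 (by nlinarith)
    rcases le_or_gt s 1 with h1 | h1
    · rw [indicator_of_mem (show s ∈ Ioc (0 : ℝ) 1 from ⟨hs, h1⟩), laplaceKernel]
      have hb : (1 + s) ^ k ≤ M := calc
        (1 + s) ^ k ≤ (1 + s) ^ |k| :=
          Real.rpow_le_rpow_of_exponent_le (by linarith) (le_abs_self k)
        _ ≤ 2 ^ |k| := Real.rpow_le_rpow (by linarith) (by linarith) (abs_nonneg k)
      have p : 0 ≤ s ^ (a - 1) := by positivity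
      calc s ^ (a - 1) * (1 + s) ^ k * Real.exp (-(x * s)) ≤ s ^ (a - 1) * M * 1 := by
            gcongr
        _ ≤ _ := by
            have : 0 ≤ M * (s ^ (τ - 1 - 1) * Real.exp (-(x * s))) := by positivity
            linarith
    · rw [indicator_of_notMem (fun h => absurd h.2 (not_le.2 h1)), zero_add, laplaceKernel]
      have hb : (1 + s) ^ k ≤ M * s ^ k := by
        rcases le_or_gt 0 k with hk0 | hk0
        · calc (1 + s) ^ k ≤ (2 * s) ^ k := by gcongr; linarith
            _ = 2 ^ k * s ^ k := Real.mul_rpow (by norm_num) hs.le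
            _ = _ := by simp only [M, abs_of_nonneg hk0]
        · calc (1 + s) ^ k ≤ s ^ k := Real.rpow_le_rpow_of_nonpos hs (by linarith) hk0.le
            _ ≤ M * s ^ k := le_mul_of_one_le_left (by positivity)
              (Real.one_le_rpow (by norm_num) (abs_nonneg k))
      have hp : s ^ (a - 1) * s ^ k ≤ s ^ (τ - 1 - 1) := by
        rw [← Real.rpow_add hs]
        exact Real.rpow_le_rpow_of_exponent_le h1.le (by linarith)
      calc s ^ (a - 1) * (1 + s) ^ k * Real.exp (-(x * s))
          ≤ s ^ (a - 1) * (M * s ^ k) * Real.exp (-(x * s)) := by gcongr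
        _ = M * (s ^ (a - 1) * s ^ k) * Real.exp (-(x * s)) := by ring
        _ ≤ M * s ^ (τ - 1 - 1) * Real.exp (-(x * s)) := by gcongr
        _ = _ := by ring
  refine hle.trans ?_
  rw [integral_const_mul, integral_add i1.integrableOn i2,
    Real.integral_rpow_mul_exp_neg_mul_Ioi (by linarith) hx, one_div, Real.inv_rpow hx.le,
    ← Real.rpow_neg hx.le, show -(τ - 1) = 1 - τ by ring, mul_assoc]
  have hX : 0 ≤ x ^ (1 - τ) := by positivity
  change M * (B + _) ≤ _
  gcongr
  nlinarith [mul_nonneg hB hX]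

/-! ### Kummer's equation and uniqueness from data at the origin -/

lemma eq_zero_of_hasDerivAt_zero {f : ℝ → ℝ} (hf : ∀ x, 0 < x → HasDerivAt f 0 x)
    (h0 : Tendsto f (𝓝[>] 0) (𝓝 0)) {x : ℝ} (hx : 0 < x) : f x = 0 := by
  have hc : ∀ y, 0 < y → f y = f x := fun y hy =>
    isOpen_Ioi.is_const_of_deriv_eq_zero isPreconnected_Ioi
      (fun z hz => (hf z hz).differentiableAt.differentiableWithinAt)
      (fun z hz => (hf z hz).deriv) hy hx
  refine tendsto_nhds_unique (Tendsto.congr' ?_ tendsto_const_nhds) h0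
  filter_upwards [self_mem_nhdsWithin] with y hy using (hc y hy).symm

/-- `u` solves Kummer's equation `x u'' + (c - x) u' - a u = 0` on `(0, ∞)`, with `v = x^c u'`. -/
def IsKummerSolution (a c : ℝ) (u v : ℝ → ℝ) : Prop :=
  ∀ x : ℝ, 0 < x → HasDerivAt u (x ^ (-c) * v x) x ∧
    HasDerivAt v (v x + a * x ^ (c - 1) * u x) x

lemma IsKummerSolution.lin {a c : ℝ} {u₁ v₁ u₂ v₂ : ℝ → ℝ} (h₁ : IsKummerSolution a c u₁ v₁)
    (h₂ : IsKummerSolution a c u₂ v₂) (r s : ℝ) :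
    IsKummerSolution a c (fun x => r * u₁ x + s * u₂ x) (fun x => r * v₁ x + s * v₂ x) := by
  intro x hx
  refine ⟨(((h₁ x hx).1.const_mul r).add ((h₂ x hx).1.const_mul s)).congr_deriv ?_,
    (((h₁ x hx).2.const_mul r).add ((h₂ x hx).2.const_mul s)).congr_deriv ?_⟩ <;> ring

lemma isKummerSolution_kummerF {c : ℝ} (hc : 0 < c) (a : ℝ) :
    IsKummerSolution a c (kummerF a c)
      (fun x => x ^ c * (a / c * kummerF (a + 1) (c + 1) x)) := by
  intro x hx
  have e1 : x ^ (-c) * x ^ c = 1 := by rw [← Real.rpow_add hx]; simp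
  have e2 : x ^ c = x ^ (c - 1) * x := by
    conv_lhs => rw [show c = c - 1 + 1 by ring, Real.rpow_add hx, Real.rpow_one]
  refine ⟨(hasDerivAt_kummerF hc a x).congr_deriv ?_, ?_⟩
  · rw [← mul_assoc, e1, one_mul]
  · have d := (Real.hasDerivAt_rpow_const (p := c) (Or.inl hx.ne')).mul
      ((hasDerivAt_kummerF (by positivity : 0 < c + 1) (a + 1) x).const_mul (a / c))
    refine d.congr_deriv ?_
    have := kummerF_ode hc a x
    beta_reduce
    rw [e2]
    linear_combination x ^ (c - 1) * this

lemma isKummerSolution_kummerF_second {c : ℝ} (hc : c < 2) (a : ℝ) :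
    IsKummerSolution a c (fun x => x ^ (1 - c) * kummerF (a - c + 1) (2 - c) x)
      (fun x => (1 - c) * kummerF (a - c + 1) (2 - c) x
        + x * ((a - c + 1) / (2 - c) * kummerF (a - c + 1 + 1) (2 - c + 1) x)) := by
  intro x hx
  have hd : 0 < 2 - c := by linarith
  have d0 := hasDerivAt_kummerF hd (a - c + 1) x
  have d1 := (hasDerivAt_kummerF (by positivity : 0 < 2 - c + 1) (a - c + 1 + 1) x).const_mul
    ((a - c + 1) / (2 - c))
  have e2 : x ^ (1 - c) = x ^ (-c) * x := by
    rw [show 1 - c = -c + 1 by ring, Real.rpow_add hx, Real.rpow_one]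
  have e3 : x ^ (c - 1) * x ^ (1 - c) = 1 := by rw [← Real.rpow_add hx]; simp
  constructor
  · have d := (Real.hasDerivAt_rpow_const (p := 1 - c) (Or.inl hx.ne')).mul d0
    refine d.congr_deriv ?_
    rw [e2, show 1 - c - 1 = -c by ring]
    ring
  · have d := (d0.const_mul (1 - c)).add ((hasDerivAt_id x).mul d1)
    refine d.congr_deriv ?_
    have := kummerF_ode hd (a - c + 1) x
    simp only [id]
    linear_combination this - a * kummerF (a - c + 1) (2 - c) x * e3

/-- The differential equation is `laplaceInt_parts` with all exponents brought down to k = c - a - 1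
by `laplaceInt_add_one_right`. -/
lemma isKummerSolution_laplaceInt {a : ℝ} (ha : 0 < a) (c : ℝ) :
    IsKummerSolution a c (laplaceInt a (c - a - 1))
      (fun x => x ^ c * (-laplaceInt (a + 1) (c - a - 1) x)) := by
  intro x hx
  have e1 : x ^ (-c) * x ^ c = 1 := by rw [← Real.rpow_add hx]; simp
  have e2 : x ^ c = x ^ (c - 1) * x := by
    conv_lhs => rw [show c = c - 1 + 1 by ring, Real.rpow_add hx, Real.rpow_one]
  have ha1 : 0 < a + 1 := by linarith
  refine ⟨(hasDerivAt_laplaceInt ha _ hx).congr_deriv ?_, ?_⟩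
  · rw [← mul_assoc, e1, one_mul]
  · have d := (Real.hasDerivAt_rpow_const (p := c) (Or.inl hx.ne')).mul
      (hasDerivAt_laplaceInt ha1 (c - a - 1) hx).neg
    refine d.congr_deriv ?_
    have h1 := laplaceInt_parts ha (c - a - 1) hx
    have h2 := laplaceInt_add_one_right ha (c - a - 1) hx
    have h3 := laplaceInt_add_one_right ha1 (c - a - 1) hx
    rw [h2, h3] at h1
    simp only [Pi.neg_apply]
    rw [e2]
    linear_combination -x ^ (c - 1) * h1

lemma continuous_kummerF {c : ℝ} (hc : 0 < c) (a : ℝ) : Continuous (kummerF a c) :=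
  continuous_iff_continuousAt.2 fun x => (hasDerivAt_kummerF hc a x).continuousAt

lemma tendsto_kummerF_nhdsGT {c : ℝ} (hc : 0 < c) (a : ℝ) :
    Tendsto (kummerF a c) (𝓝[>] 0) (𝓝 1) := by
  have := (continuous_kummerF hc a).tendsto 0
  rw [kummerF_zero_right] at this
  exact this.mono_left nhdsWithin_le_nhds

lemma tendsto_rpow_nhdsGT {p : ℝ} (hp : 0 < p) :
    Tendsto (fun x : ℝ => x ^ p) (𝓝[>] 0) (𝓝 0) := by
  have := (Real.continuousAt_rpow_const 0 p (Or.inr hp.le)).tendsto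
  rw [Real.zero_rpow hp.ne'] at this
  exact this.mono_left nhdsWithin_le_nhds

/-- Compare with the positive solution M = ₁F₁. The Wronskian vM - uV times e^(-y) is constant and
tends to 0, hence vanishes. Then u/M has zero derivative and limit 0. The data use v = x^c u'
because u' itself may be singular at 0. -/
lemma IsKummerSolution.eq_zero {a c : ℝ} (ha : 0 < a) (hc : 0 < c) {u v : ℝ → ℝ}
    (h : IsKummerSolution a c u v) (hu : Tendsto u (𝓝[>] 0) (𝓝 0))
    (hv : Tendsto v (𝓝[>] 0) (𝓝 0)) {x : ℝ} (hx : 0 < x) : u x = 0 := by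
  set M := kummerF a c
  set V : ℝ → ℝ := fun x => x ^ c * (a / c * kummerF (a + 1) (c + 1) x)
  have hM : IsKummerSolution a c M V := isKummerSolution_kummerF hc a
  have hMpos : ∀ y, 0 < y → 0 < M y := fun y hy =>
    zero_lt_one.trans_le (one_le_kummerF ha hc hy.le)
  have tM : Tendsto M (𝓝[>] 0) (𝓝 1) := tendsto_kummerF_nhdsGT hc a
  have tV : Tendsto V (𝓝[>] 0) (𝓝 0) := by
    simpa using (tendsto_rpow_nhdsGT hc).mul
      ((tendsto_kummerF_nhdsGT (by positivity : 0 < c + 1) (a + 1)).const_mul (a / c))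
  have hW : ∀ y, 0 < y → v y * M y = u y * V y := by
    intro y hy
    have := eq_zero_of_hasDerivAt_zero (f := fun y => Real.exp (-y) * (v y * M y - u y * V y))
      (fun z hz => ?_) ?_ hy
    · have h2 := (mul_eq_zero.1 this).resolve_left (Real.exp_pos _).ne'
      linarith
    · have d := ((hasDerivAt_id z).neg.exp).mul
        (((h z hz).2.mul (hM z hz).1).sub ((h z hz).1.mul (hM z hz).2))
      refine d.congr_deriv ?_
      simp only [id, Pi.neg_apply, Pi.sub_apply, Pi.mul_apply]
      ring
    · have te : Tendsto (fun y : ℝ => Real.exp (-y)) (𝓝[>] 0) (𝓝 1) := by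
        have : Continuous fun y : ℝ => Real.exp (-y) := by fun_prop
        simpa using (this.tendsto 0).mono_left nhdsWithin_le_nhds
      simpa using te.mul ((hv.mul tM).sub (hu.mul tV))
  have h0 := eq_zero_of_hasDerivAt_zero (f := fun y => u y / M y) (fun z hz => ?_) ?_ hx
  · exact (div_eq_zero_iff.1 h0).resolve_right (hMpos x hx).ne'
  · refine ((h z hz).1.div (hM z hz).1 (hMpos z hz).ne').congr_deriv ?_
    rw [div_eq_zero_iff]
    left
    linear_combination z ^ (-c) * hW z hz
  · have := hu.div tM one_ne_zero
    rwa [zero_div] at this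

/-! ### Laplace's integral for Tricomi's function -/

/-- Laplace's integral for Tricomi's function, for `0 < c < 1`. -/
lemma tricomiFormula_eq_laplaceInt_of_lt_one {a c x : ℝ} (ha : 0 < a) (hc : 0 < c) (hc1 : c < 1)
    (hx : 0 < x) : tricomiFormula a c x = laplaceInt a (c - a - 1) x / Real.Gamma a := by
  have hG : Real.Gamma a ≠ 0 := (Real.Gamma_pos_of_pos ha).ne'
  set A := Real.Gamma (1 - c) / Real.Gamma (a - c + 1)
  set B := Real.Gamma (c - 1) / Real.Gamma a
  have hT := (isKummerSolution_kummerF hc a).lin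
    (isKummerSolution_kummerF_second (by linarith : c < 2) a) A B
  -- The difference of the two sides solves Kummer's equation. Its value tends to 0 because both
  -- sides tend to Γ(1-c)/Γ(a-c+1), and its v tends to 0 because Γ(c) = (c-1) Γ(c-1).
  have hD := hT.lin (isKummerSolution_laplaceInt ha c) 1 (-(1 / Real.Gamma a))
  have t1 := tendsto_kummerF_nhdsGT hc a
  have t2 := tendsto_kummerF_nhdsGT (by linarith : 0 < c + 1) (a + 1)
  have t3 := tendsto_kummerF_nhdsGT (by linarith : 0 < 2 - c) (a - c + 1)
  have t4 := tendsto_kummerF_nhdsGT (by linarith : 0 < 2 - c + 1) (a - c + 1 + 1)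
  have t5 := tendsto_rpow_nhdsGT (by linarith : 0 < 1 - c)
  have t6 := tendsto_rpow_nhdsGT hc
  have t7 : Tendsto (fun x : ℝ => x) (𝓝[>] 0) (𝓝 0) := tendsto_id.mono_left nhdsWithin_le_nhds
  have t8 := tendsto_laplaceInt ha (k := c - a - 1) (by linarith)
  have t9 := tendsto_rpow_mul_laplaceInt (a := a + 1) (k := c - a - 1) (by linarith)
    (by linarith)
  have key := hD.eq_zero ha hc ?_ ?_ hx
  · unfold tricomiFormula
    change A * _ + B * _ * _ = _
    rw [div_eq_mul_one_div]
    linear_combination key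
  · have := (((t1.const_mul A).add ((t5.mul t3).const_mul B)).const_mul 1).add
      (t8.const_mul (-(1 / Real.Gamma a)))
    convert this using 2
    simp only [A]
    rw [show -(a + (c - a - 1)) = 1 - c by ring, show -(c - a - 1) = a - c + 1 by ring]
    field_simp
    ring
  · have := ((((t6.mul (t2.const_mul (a / c))).const_mul A).add
      (((t3.const_mul (1 - c)).add
        (t7.mul (t4.const_mul ((a - c + 1) / (2 - c))))).const_mul B)).const_mul 1).add
      (t9.const_mul (1 / Real.Gamma a))
    have hg : Real.Gamma c = (c - 1) * Real.Gamma (c - 1) := by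
      have := Real.Gamma_add_one (s := c - 1) (by linarith)
      rwa [sub_add_cancel] at this
    convert this using 2
    · rw [show a + 1 + (c - a - 1) = c by ring]
      ring
    · rw [show a + 1 + (c - a - 1) = c by ring, hg]
      simp only [B]
      ring

/-- The three-term recurrence in `a` for the Laplace integral. -/
lemma laplaceInt_recurrence {a x : ℝ} (ha : 0 < a) (k : ℝ) (hx : 0 < x) :
    a * laplaceInt a (k + 1) x + (k - a - x) * laplaceInt (a + 1) k x
      - k * laplaceInt (a + 1 + 1) (k - 1) x = 0 := by
  have ha1 : 0 < a + 1 := by linarith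
  have h1 := laplaceInt_parts ha k hx
  have h2 := laplaceInt_parts ha1 (k - 1) hx
  have h3 := laplaceInt_add_one_right ha1 k hx
  have h4 := laplaceInt_add_one_right (by linarith : 0 < a + 1 + 1) (k - 1) hx
  rw [sub_add_cancel] at h2 h4
  rw [h3] at h1
  linear_combination h1 - h2

/-- If a > c - 1, Kummer's transformation leads to 2 - c in (0, 1) with first parameter still
positive. For 0 < a ≤ c - 1 both sides obey the same recurrence, and a + 1, a + 2 are already
covered. -/
lemma tricomiFormula_eq_laplaceInt_of_one_lt {a c x : ℝ} (ha : 0 < a) (hc : 1 < c) (hc2 : c < 2)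
    (hx : 0 < x) : tricomiFormula a c x = laplaceInt a (c - a - 1) x / Real.Gamma a := by
  have main : ∀ a, c - 1 < a →
      tricomiFormula a c x = laplaceInt a (c - a - 1) x / Real.Gamma a := by
    intro a hac
    have ha : 0 < a := by linarith
    have hG : Real.Gamma a ≠ 0 := (Real.Gamma_pos_of_pos ha).ne'
    have hG2 : Real.Gamma (a - c + 1) ≠ 0 := (Real.Gamma_pos_of_pos (by linarith)).ne'
    rw [tricomiFormula_kummer a c hx, tricomiFormula_eq_laplaceInt_of_lt_one (by linarith)
      (by linarith) (by linarith) hx]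
    have := laplaceInt_kummer ha (k := c - a - 1) (by linarith) hx
    rw [show -(c - a - 1) = a - c + 1 by ring, show -(a + (c - a - 1)) = 1 - c by ring] at this
    rw [show 2 - c - (a - c + 1) - 1 = -a by ring]
    field_simp
    linear_combination -this
  by_cases h : c - 1 < a
  · exact main a h
  have m1 := main (a + 1) (by linarith)
  have m2 := main (a + 1 + 1) (by linarith)
  have r1 := tricomiFormula_recurrence (by linarith : 0 < c) hc2 (a + 1) x
  have r2 := laplaceInt_recurrence ha (c - a - 2) hx
  have hG : Real.Gamma a ≠ 0 := (Real.Gamma_pos_of_pos ha).ne'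
  have ha1 : a + 1 ≠ 0 := by positivity
  rw [add_sub_cancel_right, m1, m2, Real.Gamma_add_one ha1, Real.Gamma_add_one ha.ne',
    show c - (a + 1) - 1 = c - a - 2 by ring, show c - (a + 1 + 1) - 1 = c - a - 2 - 1 by ring]
    at r1
  rw [show c - a - 2 + 1 = c - a - 1 by ring] at r2
  rw [eq_div_iff hG]
  field_simp at r1
  have : a * (tricomiFormula a c x * Real.Gamma a) = a * laplaceInt a (c - a - 1) x := by
    linear_combination r1 - r2
  exact mul_left_cancel₀ ha.ne' this

lemma tendsto_tricomiFormula_one_of_pos {a x : ℝ} (ha : 0 < a) (hx : 0 < x) :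
    Tendsto (fun c => tricomiFormula a c x) (𝓝[≠] 1)
      (𝓝 (laplaceInt a (1 - a - 1) x / Real.Gamma a)) := by
  have h1 : Tendsto (fun c : ℝ => c - a - 1) (𝓝[≠] 1) (𝓝 (1 - a - 1)) :=
    (by fun_prop : Continuous fun c : ℝ => c - a - 1).tendsto 1 |>.mono_left nhdsWithin_le_nhds
  have h2 := ((tendsto_laplaceInt_right ha hx (1 - a - 1)).comp h1).div_const (Real.Gamma a)
  refine h2.congr' ?_
  filter_upwards [self_mem_nhdsWithin, nhdsWithin_le_nhds (Ioo_mem_nhds zero_lt_one one_lt_two)]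
    with c hne hc
  rcases lt_or_gt_of_ne hne with h | h
  · exact (tricomiFormula_eq_laplaceInt_of_lt_one ha hc.1 h hx).symm
  · exact (tricomiFormula_eq_laplaceInt_of_one_lt ha h hc.2 hx).symm

/-- `limUnder` is meaningful only once a limit exists. For a > 0 it is the Laplace integral; the
recurrence carries existence downwards in a by unit steps. -/
lemma tendsto_tricomiFormula_one (a : ℝ) {x : ℝ} (hx : 0 < x) :
    Tendsto (fun c => tricomiFormula a c x) (𝓝[≠] 1) (𝓝 (tricomiPsi a 1 x)) := by
  have ex : ∀ n : ℕ, ∀ a : ℝ, 0 < a + n →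
      ∃ L, Tendsto (fun c => tricomiFormula a c x) (𝓝[≠] 1) (𝓝 L) := by
    intro n
    induction n with
    | zero => exact fun a ha => ⟨_, tendsto_tricomiFormula_one_of_pos (by simpa using ha) hx⟩
    | succ n ih =>
      intro a ha
      push_cast at ha
      obtain ⟨L₁, h₁⟩ := ih (a + 1) (by linarith)
      obtain ⟨L₂, h₂⟩ := ih (a + 1 + 1) (by linarith)
      have c1 : Tendsto (fun c : ℝ => c - 2 * (a + 1) - x) (𝓝[≠] 1) (𝓝 (1 - 2 * (a + 1) - x)) :=
        ((by fun_prop : Continuous fun c : ℝ => c - 2 * (a + 1) - x).tendsto 1).mono_left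
          nhdsWithin_le_nhds
      have c2 : Tendsto (fun c : ℝ => (a + 1) * (a + 1 - c + 1)) (𝓝[≠] 1)
          (𝓝 ((a + 1) * (a + 1 - 1 + 1))) :=
        ((by fun_prop : Continuous fun c : ℝ => (a + 1) * (a + 1 - c + 1)).tendsto 1).mono_left
          nhdsWithin_le_nhds
      refine ⟨_, (((c1.mul h₁).add (c2.mul h₂)).neg).congr' ?_⟩
      filter_upwards [nhdsWithin_le_nhds (Ioo_mem_nhds zero_lt_one one_lt_two)] with c hc
      have := tricomiFormula_recurrence hc.1 hc.2 (a + 1) x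
      rw [add_sub_cancel_right] at this
      linarith
  obtain ⟨n, hn⟩ := exists_nat_gt (-a)
  rw [tricomiPsi, if_pos ⟨1, by simp⟩]
  exact tendsto_nhds_limUnder (ex n a (by linarith))

lemma eq_one_of_eq_intCast {c : ℝ} (hc0 : 0 < c) (hc2 : c < 2) (h : ∃ k : ℤ, c = k) : c = 1 := by
  obtain ⟨k, rfl⟩ := h
  have h1 : 0 < k := by exact_mod_cast hc0
  have h2 : k < 2 := by exact_mod_cast hc2
  have : k = 1 := by omega
  simp [this]

/-- The three-term recurrence in `a` for Tricomi's function. -/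
lemma tricomiPsi_recurrence {c x : ℝ} (hc0 : 0 < c) (hc2 : c < 2) (a : ℝ) (hx : 0 < x) :
    tricomiPsi (a - 1) c x + (c - 2 * a - x) * tricomiPsi a c x
      + a * (a - c + 1) * tricomiPsi (a + 1) c x = 0 := by
  by_cases h : ∃ k : ℤ, c = k
  · obtain rfl := eq_one_of_eq_intCast hc0 hc2 h
    have c1 : Tendsto (fun c : ℝ => c - 2 * a - x) (𝓝[≠] 1) (𝓝 (1 - 2 * a - x)) :=
      ((by fun_prop : Continuous fun c : ℝ => c - 2 * a - x).tendsto 1).mono_left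
        nhdsWithin_le_nhds
    have c2 : Tendsto (fun c : ℝ => a * (a - c + 1)) (𝓝[≠] 1) (𝓝 (a * (a - 1 + 1))) :=
      ((by fun_prop : Continuous fun c : ℝ => a * (a - c + 1)).tendsto 1).mono_left
        nhdsWithin_le_nhds
    have t := ((tendsto_tricomiFormula_one (a - 1) hx).add
      (c1.mul (tendsto_tricomiFormula_one a hx))).add
      (c2.mul (tendsto_tricomiFormula_one (a + 1) hx))
    refine tendsto_nhds_unique t (tendsto_const_nhds.congr' ?_)
    filter_upwards [nhdsWithin_le_nhds (Ioo_mem_nhds zero_lt_one one_lt_two)] with c hc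
    exact (tricomiFormula_recurrence hc.1 hc.2 a x).symm
  · simp only [tricomiPsi, if_neg h]
    exact tricomiFormula_recurrence hc0 hc2 a x

/-- Kummer's transformation for Tricomi's function. -/
lemma tricomiPsi_kummer {c x : ℝ} (hc0 : 0 < c) (hc2 : c < 2) (a : ℝ) (hx : 0 < x) :
    tricomiPsi a c x = x ^ (1 - c) * tricomiPsi (a - c + 1) (2 - c) x := by
  by_cases h : ∃ k : ℤ, c = k
  · obtain rfl := eq_one_of_eq_intCast hc0 hc2 h
    norm_num
  · have h' : ¬ ∃ k : ℤ, 2 - c = k := fun ⟨k, hk⟩ => h ⟨2 - k, by push_cast; linarith⟩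
    simp only [tricomiPsi, if_neg h, if_neg h']
    exact tricomiFormula_kummer a c hx

/-- Laplace's integral for Tricomi's function. -/
lemma tricomiPsi_eq_laplaceInt {a c x : ℝ} (ha : 0 < a) (hc0 : 0 < c) (hc2 : c < 2)
    (hx : 0 < x) : tricomiPsi a c x = laplaceInt a (c - a - 1) x / Real.Gamma a := by
  by_cases h : ∃ k : ℤ, c = k
  · obtain rfl := eq_one_of_eq_intCast hc0 hc2 h
    exact tendsto_nhds_unique (tendsto_tricomiFormula_one a hx)
      (tendsto_tricomiFormula_one_of_pos ha hx)
  · have hne : c ≠ 1 := fun h1 => h ⟨1, by simp [h1]⟩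
    simp only [tricomiPsi, if_neg h]
    rcases lt_or_gt_of_ne hne with h1 | h1
    · exact tricomiFormula_eq_laplaceInt_of_lt_one ha hc0 h1 hx
    · exact tricomiFormula_eq_laplaceInt_of_one_lt ha h1 hc2 hx

/-! ### The symbols z^(-p) z̄^(-q) -/

/-- The linear factor `1/2 + 2πiξ`. -/
noncomputable def rootFactor (ξ : ℝ) : ℂ := 1 / 2 + 2 * Real.pi * ξ * Complex.I

/-- The function `(1/2 + 2πiξ)^(-p) (1/2 - 2πiξ)^(-q)`. -/
noncomputable def rootSymbol (p q : ℝ) (ξ : ℝ) : ℂ :=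
  rootFactor ξ ^ (-p : ℂ) * rootFactor (-ξ) ^ (-q : ℂ)

lemma rootFactor_re (ξ : ℝ) : (rootFactor ξ).re = 1 / 2 := by
  simp [rootFactor]

lemma rootFactor_im (ξ : ℝ) : (rootFactor ξ).im = 2 * Real.pi * ξ := by
  simp [rootFactor]

lemma rootFactor_mem_slitPlane (ξ : ℝ) : rootFactor ξ ∈ Complex.slitPlane :=
  Or.inl (by rw [rootFactor_re]; norm_num)

lemma rootFactor_ne_zero (ξ : ℝ) : rootFactor ξ ≠ 0 :=
  Complex.slitPlane_ne_zero (rootFactor_mem_slitPlane ξ)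

lemma rootFactor_add_neg (ξ : ℝ) : rootFactor ξ + rootFactor (-ξ) = 1 := by
  simp only [rootFactor]
  push_cast
  ring

lemma conj_rootFactor (ξ : ℝ) : conj (rootFactor ξ) = rootFactor (-ξ) := by
  apply Complex.ext
  · rw [Complex.conj_re, rootFactor_re, rootFactor_re]
  · rw [Complex.conj_im, rootFactor_im, rootFactor_im]; ring

lemma norm_rootFactor_neg (ξ : ℝ) : ‖rootFactor (-ξ)‖ = ‖rootFactor ξ‖ := by
  rw [← conj_rootFactor, Complex.norm_conj]

lemma hasDerivAt_rootFactor (ξ : ℝ) : HasDerivAt rootFactor (2 * Real.pi * Complex.I) ξ := by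
  have h := (((hasDerivAt_id ξ).ofReal_comp.const_mul (2 * Real.pi : ℂ)).mul_const
    Complex.I).const_add (1 / 2 : ℂ)
  refine h.congr_deriv ?_
  simp

lemma hasDerivAt_rootFactor_neg (ξ : ℝ) :
    HasDerivAt (fun ξ : ℝ => rootFactor (-ξ)) (-(2 * Real.pi * Complex.I)) ξ := by
  refine ((hasDerivAt_rootFactor (-ξ)).scomp ξ (hasDerivAt_neg ξ)).congr_deriv ?_
  simp

lemma rootSymbol_add_one_left (p q ξ : ℝ) :
    rootSymbol (p + 1) q ξ * rootFactor ξ = rootSymbol p q ξ := by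
  have : rootFactor ξ ^ (-p : ℂ) = rootFactor ξ ^ (-(p + 1 : ℝ) : ℂ) * rootFactor ξ := by
    rw [show (-p : ℂ) = -((p + 1 : ℝ) : ℂ) + 1 by push_cast; ring,
      Complex.cpow_add _ _ (rootFactor_ne_zero ξ), Complex.cpow_one]
  simp only [rootSymbol, this]
  ring

lemma rootSymbol_neg (p q ξ : ℝ) : rootSymbol p q (-ξ) = rootSymbol q p ξ := by
  simp only [rootSymbol, neg_neg]
  ring

lemma rootSymbol_add_one_right (p q ξ : ℝ) :
    rootSymbol p (q + 1) ξ * rootFactor (-ξ) = rootSymbol p q ξ := by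
  rw [← rootSymbol_neg, ← rootSymbol_neg q p]
  exact rootSymbol_add_one_left q p (-ξ)

/-- This is z + z̄ = 1, the source of all contiguous relations between symbols. -/
lemma rootSymbol_add_one_add (p q ξ : ℝ) :
    rootSymbol (p + 1) (q + 1) ξ = rootSymbol (p + 1) q ξ + rootSymbol p (q + 1) ξ := by
  rw [← rootSymbol_add_one_right (p + 1) q, ← rootSymbol_add_one_left p (q + 1)]
  linear_combination (-rootSymbol (p + 1) (q + 1) ξ) * rootFactor_add_neg ξ

lemma hasDerivAt_rootSymbol (p q ξ : ℝ) :
    HasDerivAt (rootSymbol p q)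
      (-(2 * Real.pi * Complex.I) * (p * rootSymbol (p + 1) q ξ - q * rootSymbol p (q + 1) ξ))
      ξ := by
  have h1 := ((hasDerivAt_id (rootFactor ξ)).cpow_const (c := (-p : ℂ))
    (rootFactor_mem_slitPlane ξ)).scomp ξ (hasDerivAt_rootFactor ξ)
  have h2 := ((hasDerivAt_id (rootFactor (-ξ))).cpow_const (c := (-q : ℂ))
    (rootFactor_mem_slitPlane (-ξ))).scomp ξ (hasDerivAt_rootFactor_neg ξ)
  refine (h1.mul h2).congr_deriv ?_
  simp only [rootSymbol, id, Function.comp, smul_eq_mul]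
  rw [show (-p : ℂ) - 1 = -((p + 1 : ℝ) : ℂ) by push_cast; ring,
    show (-q : ℂ) - 1 = -((q + 1 : ℝ) : ℂ) by push_cast; ring]
  ring

lemma continuous_rootSymbol (p q : ℝ) : Continuous (rootSymbol p q) :=
  continuous_iff_continuousAt.2 fun ξ => (hasDerivAt_rootSymbol p q ξ).continuousAt

lemma norm_rootSymbol (p q ξ : ℝ) : ‖rootSymbol p q ξ‖ = ‖rootFactor ξ‖ ^ (-(p + q)) := by
  rw [rootSymbol, norm_mul, ← Complex.ofReal_neg, ← Complex.ofReal_neg, Complex.norm_cpow_real,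
    Complex.norm_cpow_real, norm_rootFactor_neg,
    ← Real.rpow_add (norm_pos_iff.2 (rootFactor_ne_zero ξ))]
  ring_nf

lemma conj_rootSymbol (p q ξ : ℝ) : conj (rootSymbol p q ξ) = rootSymbol q p ξ := by
  have h : ∀ (r ξ : ℝ), conj (rootFactor ξ ^ (-r : ℂ)) = rootFactor (-ξ) ^ (-r : ℂ) := by
    intro r ξ
    rw [← conj_rootFactor, Complex.conj_cpow _ _ (Complex.slitPlane_arg_ne_pi
      (rootFactor_mem_slitPlane _))]
    simp
  simp only [rootSymbol, map_mul, h, neg_neg]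
  ring

lemma rootSymbol_mul (p q r s ξ : ℝ) :
    rootSymbol p q ξ * rootSymbol r s ξ = rootSymbol (p + r) (q + s) ξ := by
  simp only [rootSymbol]
  push_cast
  rw [show -((p : ℂ) + r) = -p + -r by ring, show -((q : ℂ) + s) = -q + -s by ring,
    Complex.cpow_add _ _ (rootFactor_ne_zero _), Complex.cpow_add _ _ (rootFactor_ne_zero _)]
  ring

lemma abs_le_norm_rootFactor (ξ : ℝ) : |ξ| ≤ ‖rootFactor ξ‖ := by
  have h := Complex.abs_im_le_norm (rootFactor ξ)
  rw [rootFactor_im, abs_mul, abs_of_pos (by positivity : 0 < 2 * Real.pi)] at h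
  have : |ξ| ≤ 2 * Real.pi * |ξ| := le_mul_of_one_le_left (abs_nonneg ξ)
    (by linarith [Real.pi_gt_three])
  linarith

lemma tendsto_rootSymbol {p q : ℝ} (h : 0 < p + q) (l : Filter ℝ)
    (hl : Tendsto (fun ξ : ℝ => |ξ|) l atTop) : Tendsto (rootSymbol p q) l (𝓝 0) := by
  rw [tendsto_zero_iff_norm_tendsto_zero]
  simp only [norm_rootSymbol]
  exact (tendsto_rpow_neg_atTop h).comp (tendsto_atTop_mono abs_le_norm_rootFactor hl)

/-! ### Functions with a prescribed Fourier transform -/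

/-- Integrable function on the line with a given Fourier transform. -/
structure HasFourier (f : ℝ → ℂ) (u : ℝ → ℂ) : Prop where
  integrable : Integrable f
  eq : 𝓕 f = u

lemma integrable_exp_mul {f : ℝ → ℂ} (hf : Integrable f) (ξ : ℝ) :
    Integrable fun y : ℝ => Complex.exp (((-2 * Real.pi * y * ξ : ℝ) : ℂ) * Complex.I) * f y := by
  refine hf.bdd_mul (c := 1) (by fun_prop : Continuous fun y : ℝ =>
    Complex.exp (((-2 * Real.pi * y * ξ : ℝ) : ℂ) * Complex.I)).aestronglyMeasurable ?_
  exact ae_of_all _ fun y => (Complex.norm_exp_ofReal_mul_I _).le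

lemma HasFourier.lin {f g u v : ℝ → ℂ} (hf : HasFourier f u) (hg : HasFourier g v) (a b : ℂ) :
    HasFourier (fun y => a * f y + b * g y) (fun ξ => a * u ξ + b * v ξ) := by
  refine ⟨(hf.integrable.const_mul a).add (hg.integrable.const_mul b), ?_⟩
  ext ξ
  rw [← hf.eq, ← hg.eq]
  simp only [Real.fourier_real_eq_integral_exp_smul, smul_eq_mul]
  rw [← integral_const_mul, ← integral_const_mul, ← integral_add
    ((integrable_exp_mul hf.integrable ξ).const_mul a)
    ((integrable_exp_mul hg.integrable ξ).const_mul b)]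
  congr 1
  ext y
  ring

lemma HasFourier.congr_ae {f g u : ℝ → ℂ} (hf : HasFourier f u) (h : f =ᵐ[volume] g) :
    HasFourier g u := by
  refine ⟨hf.integrable.congr h, ?_⟩
  ext ξ
  rw [← hf.eq]
  simp only [Real.fourier_real_eq_integral_exp_smul]
  refine integral_congr_ae ?_
  filter_upwards [h] with y hy
  rw [hy]

lemma HasFourier.hasDerivAt {f u v : ℝ → ℂ} (hf : HasFourier f u)
    (hyf : HasFourier (fun y : ℝ => (y : ℂ) * f y) v) (ξ : ℝ) :
    HasDerivAt u (-(2 * Real.pi * Complex.I) * v ξ) ξ := by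
  have h := Real.hasDerivAt_fourier hf.integrable (by simpa using hyf.integrable) ξ
  rw [hf.eq] at h
  refine h.congr_deriv ?_
  rw [← hyf.eq]
  simp only [Real.fourier_real_eq_integral_exp_smul, smul_eq_mul]
  rw [← integral_const_mul]
  congr 1
  ext y
  ring

lemma HasFourier.mul_id_rootSymbol {f : ℝ → ℂ} {p q : ℝ} (hf : HasFourier f (rootSymbol p q))
    (hyf : Integrable fun y : ℝ => (y : ℂ) * f y) :
    HasFourier (fun y : ℝ => (y : ℂ) * f y)
      (fun ξ => p * rootSymbol (p + 1) q ξ - q * rootSymbol p (q + 1) ξ) := by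
  refine ⟨hyf, ?_⟩
  ext ξ
  have h1 := hf.hasDerivAt ⟨hyf, rfl⟩ ξ
  have h2 := h1.unique (hasDerivAt_rootSymbol p q ξ)
  exact mul_left_cancel₀ (by simp [Real.pi_ne_zero]) h2

/-- The transform of f and the symbol have the same derivative, so they differ by a constant. The
constant is 0 by the Riemann–Lebesgue lemma and the decay of the symbol. -/
lemma HasFourier.of_mul_id {f : ℝ → ℂ} {p q : ℝ} (hpq : 0 < p + q) (hf : Integrable f)
    (hyf : HasFourier (fun y : ℝ => (y : ℂ) * f y)
      (fun ξ => p * rootSymbol (p + 1) q ξ - q * rootSymbol p (q + 1) ξ)) :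
    HasFourier f (rootSymbol p q) := by
  refine ⟨hf, ?_⟩
  have hd : ∀ ξ, HasDerivAt (fun ξ => 𝓕 f ξ - rootSymbol p q ξ) 0 ξ := fun ξ =>
    ((HasFourier.hasDerivAt ⟨hf, rfl⟩ hyf ξ).sub (hasDerivAt_rootSymbol p q ξ)).congr_deriv
      (sub_self _)
  have t1 : Tendsto (𝓕 f) atTop (𝓝 0) :=
    (Real.zero_at_infty_fourier f).mono_left atTop_le_cocompact
  have t2 := tendsto_rootSymbol hpq atTop tendsto_abs_atTop_atTop
  have t3 := t1.sub t2
  ext ξ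
  have hc : ∀ η, 𝓕 f η - rootSymbol p q η = 𝓕 f ξ - rootSymbol p q ξ := fun η =>
    is_const_of_deriv_eq_zero (fun x => (hd x).differentiableAt) (fun x => (hd x).deriv) η ξ
  simp only [hc] at t3
  have := tendsto_nhds_unique t3 tendsto_const_nhds
  rw [sub_zero] at this
  exact (sub_eq_zero.1 this.symm)

/-! ### Gamma densities and their convolutions -/

/-- The density `y^(p-1) e^(-y/2) / Γ(p)` on the positive half-line. -/
noncomputable def gammaKernel (p : ℝ) : ℝ → ℂ :=
  (Ioi (0 : ℝ)).indicator fun y =>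
    ((y ^ (p - 1) * Real.exp (-(1 / 2 * y)) / Real.Gamma p : ℝ) : ℂ)

lemma integrable_gammaKernel {p : ℝ} (hp : 0 < p) : Integrable (gammaKernel p) := by
  refine IntegrableOn.integrable_indicator ?_ measurableSet_Ioi
  exact (((integrableOn_rpow_mul_exp hp (by norm_num : (0 : ℝ) < 1 / 2)).div_const _)).ofReal

/-- Integration by parts applied to y^p e^(-zy), whose boundary values vanish. -/
lemma fourier_gammaKernel_add_one {p : ℝ} (hp : 0 < p) (ξ : ℝ) :
    rootFactor ξ * 𝓕 (gammaKernel (p + 1)) ξ = 𝓕 (gammaKernel p) ξ := by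
  have hG : (Real.Gamma p : ℂ) ≠ 0 := by exact_mod_cast (Real.Gamma_pos_of_pos hp).ne'
  have hpc : (p : ℂ) ≠ 0 := by exact_mod_cast hp.ne'
  have hp1 : 0 < p + 1 := by linarith
  set e : ℝ → ℂ := fun y => Complex.exp (((-2 * Real.pi * y * ξ : ℝ) : ℂ) * Complex.I) with he
  have hem : Continuous e := by simp only [he]; fun_prop
  have hen : ∀ y, ‖e y‖ = 1 := fun y => Complex.norm_exp_ofReal_mul_I _
  set E : ℝ → ℝ → ℂ := fun r y => e y * ((y ^ (r - 1) * Real.exp (-(1 / 2 * y)) : ℝ) : ℂ) with hE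
  have hEi : ∀ r, 0 < r → IntegrableOn (E r) (Ioi 0) := fun r hr => by
    have := (integrableOn_rpow_mul_exp hr (by norm_num : (0 : ℝ) < 1 / 2)).ofReal (𝕜 := ℂ)
    refine Integrable.bdd_mul (c := 1) this hem.aestronglyMeasurable ?_
    exact ae_of_all _ fun y => (hen y).le
  have hF : ∀ r, 0 < r → 𝓕 (gammaKernel r) ξ * Real.Gamma r = ∫ y in Ioi (0 : ℝ), E r y := by
    intro r hr
    have hGr : (Real.Gamma r : ℂ) ≠ 0 := by exact_mod_cast (Real.Gamma_pos_of_pos hr).ne'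
    rw [Real.fourier_real_eq_integral_exp_smul, ← integral_mul_const,
      ← integral_indicator measurableSet_Ioi]
    congr 1
    ext y
    by_cases hy : y ∈ Ioi (0 : ℝ)
    · simp only [gammaKernel, indicator_of_mem hy, hE, he, smul_eq_mul]
      push_cast
      field_simp
    · simp [gammaKernel, indicator_of_notMem hy]
  have key := integral_Ioi_of_hasDerivAt_of_tendsto
    (f := fun y : ℝ => e y * ((y ^ p * Real.exp (-(1 / 2 * y)) : ℝ) : ℂ)) (a := 0) (m := 0)
    (f' := fun y => (p : ℂ) * E p y - rootFactor ξ * E (p + 1) y) ?_ ?_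
    (((hEi p hp).const_mul _).sub ((hEi (p + 1) hp1).const_mul _)) ?_
  · rw [integral_sub ((hEi p hp).const_mul _) ((hEi (p + 1) hp1).const_mul _),
      integral_const_mul, integral_const_mul, ← hF p hp, ← hF (p + 1) hp1,
      Real.Gamma_add_one hp.ne', Real.zero_rpow hp.ne'] at key
    push_cast at key
    simp only [zero_mul, mul_zero, sub_zero] at key
    refine mul_left_cancel₀ (mul_ne_zero hpc hG) ?_
    linear_combination -key
  · refine (hem.continuousAt.mul ?_).continuousWithinAt
    refine Complex.continuous_ofReal.continuousAt.comp ?_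
    exact (Real.continuousAt_rpow_const _ _ (Or.inr hp.le)).mul (by fun_prop)
  · intro y (hy : 0 < y)
    have d1 : HasDerivAt e (e y * (((-2 * Real.pi * ξ : ℝ) : ℂ) * Complex.I)) y := by
      have h0 : HasDerivAt (fun y : ℝ => -2 * Real.pi * y * ξ) (-2 * Real.pi * ξ) y := by
        have := ((hasDerivAt_id y).const_mul (-2 * Real.pi)).mul_const ξ
        simpa using this
      exact (h0.ofReal_comp.mul_const Complex.I).cexp
    have d2 := ((Real.hasDerivAt_rpow_const (x := y) (p := p) (Or.inl hy.ne')).mul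
      (((hasDerivAt_id y).const_mul (1 / 2 : ℝ)).neg.exp)).ofReal_comp
    refine (d1.mul d2).congr_deriv ?_
    simp only [hE, rootFactor, id, add_sub_cancel_right, Pi.neg_apply, Pi.mul_apply]
    push_cast
    ring
  · rw [tendsto_zero_iff_norm_tendsto_zero]
    have := tendsto_rpow_mul_exp_neg_mul_atTop_nhds_zero p (1 / 2) (by norm_num)
    refine this.congr' ?_
    filter_upwards [eventually_gt_atTop 0] with y hy
    rw [norm_mul, hen, one_mul, Complex.norm_real, Real.norm_of_nonneg (by positivity)]
    ring_nf

lemma rootSymbol_zero_zero (ξ : ℝ) : rootSymbol 0 0 ξ = 1 := by simp [rootSymbol]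

lemma mul_gammaKernel {p : ℝ} (hp : 0 < p) (y : ℝ) :
    (y : ℂ) * gammaKernel p y = p * gammaKernel (p + 1) y := by
  by_cases hy : y ∈ Ioi (0 : ℝ)
  · have hG : Real.Gamma p ≠ 0 := (Real.Gamma_pos_of_pos hp).ne'
    have hy' : (0 : ℝ) < y := hy
    have e : y ^ (p + 1 - 1) = y ^ (p - 1) * y := by
      rw [show p + 1 - 1 = p - 1 + 1 by ring, Real.rpow_add hy', Real.rpow_one]
    simp only [gammaKernel, indicator_of_mem hy]
    rw [e, Real.Gamma_add_one hp.ne']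
    norm_cast
    field_simp
  · simp [gammaKernel, indicator_of_notMem hy]

lemma fourier_gammaKernel_zero {p : ℝ} (hp : 0 < p) :
    𝓕 (gammaKernel p) 0 = ((2 : ℝ) ^ p : ℝ) := by
  have hG : Real.Gamma p ≠ 0 := (Real.Gamma_pos_of_pos hp).ne'
  rw [Real.fourier_real_eq_integral_exp_smul]
  simp only [mul_zero, Complex.ofReal_zero, zero_mul, Complex.exp_zero, one_smul]
  rw [gammaKernel, integral_indicator measurableSet_Ioi, integral_complex_ofReal,
    integral_div, Real.integral_rpow_mul_exp_neg_mul_Ioi hp (by norm_num)]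
  norm_num [hG]

lemma hasFourier_gammaKernel {p : ℝ} (hp : 0 < p) :
    HasFourier (gammaKernel p) (rootSymbol p 0) := by
  have hp1 : 0 < p + 1 := by linarith
  refine ⟨integrable_gammaKernel hp, ?_⟩
  have hy : HasFourier (fun y : ℝ => (y : ℂ) * gammaKernel p y)
      (fun ξ => p * 𝓕 (gammaKernel (p + 1)) ξ) := by
    have h := (HasFourier.mk (integrable_gammaKernel hp1) rfl).lin
      (HasFourier.mk (integrable_gammaKernel hp1) rfl) (p : ℂ) 0
    simpa [mul_gammaKernel hp] using h
  -- The transform times z^p is constant, hence equal to its value at ξ = 0, which needs only a real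
  -- Gamma integral.
  have hd : ∀ ξ, HasDerivAt (fun ξ => 𝓕 (gammaKernel p) ξ * rootSymbol (-p) 0 ξ) 0 ξ := by
    intro ξ
    have h1 := HasFourier.hasDerivAt ⟨integrable_gammaKernel hp, rfl⟩ hy ξ
    refine (h1.mul (hasDerivAt_rootSymbol (-p) 0 ξ)).congr_deriv ?_
    have e1 := rootSymbol_add_one_left (-p) 0 ξ
    have e2 := fourier_gammaKernel_add_one hp ξ
    rw [← e1, ← e2]
    push_cast
    ring
  have hc : ∀ ξ, 𝓕 (gammaKernel p) ξ * rootSymbol (-p) 0 ξ = 1 := by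
    intro ξ
    rw [is_const_of_deriv_eq_zero (fun x => (hd x).differentiableAt) (fun x => (hd x).deriv) ξ 0,
      fourier_gammaKernel_zero hp]
    have e : rootSymbol (-p) 0 0 = (((1 / 2 : ℝ) ^ p : ℝ) : ℂ) := by
      rw [Complex.ofReal_cpow (by norm_num)]
      simp [rootSymbol, rootFactor]
    rw [e, ← Complex.ofReal_mul, ← Real.mul_rpow (by norm_num) (by norm_num)]
    norm_num
  ext ξ
  have h2 : rootSymbol p 0 ξ * rootSymbol (-p) 0 ξ = 1 := by
    rw [rootSymbol_mul, add_neg_cancel, add_zero, rootSymbol_zero_zero]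
  exact mul_right_cancel₀ (right_ne_zero_of_mul_eq_one h2) ((hc ξ).trans h2.symm)

lemma HasFourier.comp_neg {f u : ℝ → ℂ} (hf : HasFourier f u) :
    HasFourier (fun y => f (-y)) (fun ξ => u (-ξ)) := by
  refine ⟨hf.integrable.comp_neg, ?_⟩
  ext ξ
  rw [← hf.eq]
  simp only [Real.fourier_real_eq_integral_exp_smul]
  rw [← integral_neg_eq_self]
  simp

/-- The convolution of a Gamma density with a reflected Gamma density, in closed form. -/
noncomputable def gammaConv (p q y : ℝ) : ℝ :=
  if 0 < y then Real.exp (-(1 / 2 * y)) * shiftedGammaInt q (p - 1) y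
    / (Real.Gamma p * Real.Gamma q)
  else if y < 0 then Real.exp (1 / 2 * y) * shiftedGammaInt p (q - 1) (-y)
    / (Real.Gamma p * Real.Gamma q)
  else 0

lemma gammaConv_neg (p q y : ℝ) : gammaConv p q (-y) = gammaConv q p y := by
  rcases lt_trichotomy y 0 with h | rfl | h
  · simp [gammaConv, h, not_lt.2 h.le, mul_comm (Real.Gamma p)]
  · simp [gammaConv]
  · simp [gammaConv, h, not_lt.2 h.le, mul_comm (Real.Gamma p)]

lemma gammaKernel_convolution_of_pos (p q : ℝ) {y : ℝ} (hy : 0 < y) :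
    ∫ t, gammaKernel q (-t) * gammaKernel p (y - t) = gammaConv p q y := by
  rw [← integral_neg_eq_self]
  simp only [neg_neg, sub_neg_eq_add]
  rw [gammaConv, if_pos hy, shiftedGammaInt, ← integral_const_mul, ← integral_div,
    ← integral_complex_ofReal, ← integral_indicator measurableSet_Ioi]
  congr 1
  ext s
  by_cases hs : s ∈ Ioi (0 : ℝ)
  · have hs' : (0 : ℝ) < s := hs
    have hys : y + s ∈ Ioi (0 : ℝ) := add_pos hy hs'
    have e : Real.exp (-(1 / 2 * s)) * Real.exp (-(1 / 2 * (y + s)))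
        = Real.exp (-(1 / 2 * y)) * Real.exp (-s) := by
      rw [← Real.exp_add, ← Real.exp_add]; ring_nf
    simp only [gammaKernel, indicator_of_mem hs, indicator_of_mem hys]
    rw [← Complex.ofReal_mul]
    congr 1
    rw [div_mul_div_comm, mul_comm (Real.Gamma q)]
    congr 1
    linear_combination s ^ (q - 1) * (y + s) ^ (p - 1) * e
  · simp [gammaKernel, indicator_of_notMem hs]

lemma gammaKernel_convolution {p q y : ℝ} (hy : y ≠ 0) :
    ∫ t, gammaKernel q (-t) * gammaKernel p (y - t) = gammaConv p q y := by
  rcases lt_or_gt_of_ne hy with h | h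
  · rw [← neg_neg y, gammaConv_neg, ← gammaKernel_convolution_of_pos q p (neg_pos.2 h),
      ← integral_add_left_eq_self _ (- -y)]
    congr 1
    ext t
    rw [mul_comm, show - -y - (- -y + t) = -t by ring, show -(- -y + t) = -y - t by ring]
  · exact gammaKernel_convolution_of_pos p q h

/-- Convolution theorem: reflecting the second density turns z^(-q) into z̄^(-q). -/
lemma hasFourier_gammaConv {p q : ℝ} (hp : 0 < p) (hq : 0 < q) :
    HasFourier (fun y => (gammaConv p q y : ℂ)) (rootSymbol p q) := by
  have h1 := (hasFourier_gammaKernel hq).comp_neg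
  have h2 := hasFourier_gammaKernel hp
  have hi := h1.integrable.integrable_convolution (ContinuousLinearMap.mul ℂ ℂ) h2.integrable
  have hF : HasFourier ((fun y => gammaKernel q (-y)) ⋆[ContinuousLinearMap.mul ℂ ℂ]
      gammaKernel p) (rootSymbol p q) := by
    refine ⟨hi, ?_⟩
    ext ξ
    rw [Real.fourier_mul_convolution_eq h1.integrable h2.integrable, h1.eq, h2.eq]
    beta_reduce
    rw [rootSymbol_neg, rootSymbol_mul, zero_add, add_zero]
  refine hF.congr_ae ?_
  filter_upwards [compl_mem_ae_iff.2 (measure_singleton (0 : ℝ))] with y hy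
  rw [← gammaKernel_convolution hy]
  simp [convolution]

/-! ### Integrability of weighted Tricomi functions -/

/-- All the functions `y^k f(y)` lie in `L¹ ∩ L²`. -/
def HasMoments (f : ℝ → ℝ) : Prop :=
  ∀ k : ℕ, MemLp (fun y => y ^ k * f y) 1 ∧ MemLp (fun y => y ^ k * f y) 2

lemma HasMoments.lin {f g : ℝ → ℝ} (hf : HasMoments f) (hg : HasMoments g) (a b : ℝ) :
    HasMoments fun y => a * f y + b * g y := by
  intro k
  have e : (fun y => y ^ k * (a * f y + b * g y))
      = fun y => a * (y ^ k * f y) + b * (y ^ k * g y) := by ext y; ring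
  rw [e]
  exact ⟨((hf k).1.const_mul a).add ((hg k).1.const_mul b),
    ((hf k).2.const_mul a).add ((hg k).2.const_mul b)⟩

lemma HasMoments.mul_id {f : ℝ → ℝ} (hf : HasMoments f) : HasMoments fun y => y * f y := by
  intro k
  have e : (fun y => y ^ k * (y * f y)) = fun y => y ^ (k + 1) * f y := by ext y; ring
  rw [e]
  exact hf (k + 1)

lemma HasMoments.comp_neg {f : ℝ → ℝ} (hf : HasMoments f) : HasMoments fun y => f (-y) := by
  intro k
  have e : (fun y => y ^ k * f (-y))
      = fun y => (-1) ^ k * ((fun y => y ^ k * f y) ∘ fun y => -y) y := by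
    ext y
    simp only [Function.comp, neg_pow y]
    rw [← mul_assoc, ← mul_assoc, ← mul_pow]
    simp
  rw [e]
  have hm := Measure.measurePreserving_neg (volume : Measure ℝ)
  exact ⟨((hf k).1.comp_measurePreserving hm).const_mul _,
    ((hf k).2.comp_measurePreserving hm).const_mul _⟩

lemma HasMoments.memLp_one {f : ℝ → ℝ} (hf : HasMoments f) : MemLp f 1 := by
  simpa using (hf 0).1

lemma HasMoments.memLp_two {f : ℝ → ℝ} (hf : HasMoments f) : MemLp f 2 := by
  simpa using (hf 0).2

lemma HasMoments.integrable {f : ℝ → ℝ} (hf : HasMoments f) : Integrable f :=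
  memLp_one_iff_integrable.1 hf.memLp_one

lemma memLp_rpow_mul_exp {r : ℝ} (hr : -(1 / 2) < r) :
    MemLp ((Ioi (0 : ℝ)).indicator fun y => y ^ r * Real.exp (-(1 / 2 * y))) 1 ∧
    MemLp ((Ioi (0 : ℝ)).indicator fun y => y ^ r * Real.exp (-(1 / 2 * y))) 2 := by
  have hm : Measurable fun y : ℝ => y ^ r * Real.exp (-(1 / 2 * y)) := by fun_prop
  constructor
  · rw [memLp_one_iff_integrable]
    have := integrableOn_rpow_mul_exp (by linarith : 0 < r + 1) (by norm_num : (0 : ℝ) < 1 / 2)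
    rw [add_sub_cancel_right] at this
    exact this.integrable_indicator measurableSet_Ioi
  · rw [memLp_two_iff_integrable_sq (hm.indicator measurableSet_Ioi).aestronglyMeasurable]
    have := (integrableOn_rpow_mul_exp (by linarith : 0 < 2 * r + 1)
      (by norm_num : (0 : ℝ) < 1)).integrable_indicator measurableSet_Ioi
    refine this.congr (ae_of_all _ fun y => ?_)
    by_cases hy : y ∈ Ioi (0 : ℝ)
    · have hy' : (0 : ℝ) < y := hy
      simp only [indicator_of_mem hy]
      rw [mul_pow, ← Real.exp_nat_mul, ← Real.rpow_natCast, ← Real.rpow_mul hy'.le]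
      congr 2
      · push_cast; ring
      · push_cast; ring
    · simp [indicator_of_notMem hy]

/-- `y^(σ-1) e^(-y/2) Ψ(a, σ; y)` on the positive half-line, extended by zero. -/
noncomputable def halfTricomi (σ a y : ℝ) : ℝ :=
  if 0 < y then y ^ (σ - 1) * Real.exp (-(1 / 2 * y)) * tricomiPsi a σ y else 0

lemma halfTricomi_of_nonpos (σ a : ℝ) {y : ℝ} (hy : y ≤ 0) : halfTricomi σ a y = 0 :=
  if_neg (not_lt.2 hy)

lemma halfTricomi_recurrence {σ : ℝ} (h0 : 0 < σ) (h2 : σ < 2) (a y : ℝ) :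
    halfTricomi σ (a - 1) y + (σ - 2 * a - y) * halfTricomi σ a y
      + a * (a - σ + 1) * halfTricomi σ (a + 1) y = 0 := by
  rcases le_or_gt y 0 with hy | hy
  · simp [halfTricomi_of_nonpos _ _ hy]
  · simp only [halfTricomi, if_pos hy]
    linear_combination (y ^ (σ - 1) * Real.exp (-(1 / 2 * y))) * tricomiPsi_recurrence h0 h2 a hy

lemma halfTricomi_eq_laplaceInt {σ a : ℝ} (ha : 0 < a) (h0 : 0 < σ) (h2 : σ < 2) {y : ℝ}
    (hy : 0 < y) : halfTricomi σ a y
      = y ^ (σ - 1) * Real.exp (-(1 / 2 * y)) * (laplaceInt a (σ - a - 1) y / Real.Gamma a) := by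
  rw [halfTricomi, if_pos hy, tricomiPsi_eq_laplaceInt ha h0 h2 hy]

lemma measurable_halfTricomi_of_pos {σ a : ℝ} (ha : 0 < a) (h0 : 0 < σ) (h2 : σ < 2) :
    Measurable (halfTricomi σ a) := by
  have e : halfTricomi σ a = (Ioi (0 : ℝ)).indicator fun y =>
      y ^ (σ - 1) * Real.exp (-(1 / 2 * y)) *
        (((Ioi (0 : ℝ)).indicator (laplaceInt a (σ - a - 1)) y) / Real.Gamma a) := by
    ext y
    by_cases hy : 0 < y
    · rw [indicator_of_mem (show y ∈ Ioi (0 : ℝ) from hy),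
        indicator_of_mem (show y ∈ Ioi (0 : ℝ) from hy), halfTricomi_eq_laplaceInt ha h0 h2 hy]
    · rw [indicator_of_notMem (by simpa using hy), halfTricomi, if_neg hy]
  have hL : Measurable ((Ioi (0 : ℝ)).indicator (laplaceInt a (σ - a - 1))) := by
    have hc : ContinuousOn (laplaceInt a (σ - a - 1)) (Ioi 0) := fun y hy =>
      (hasDerivAt_laplaceInt ha _ hy).continuousAt.continuousWithinAt
    have := hc.measurable_piecewise (continuousOn_const (c := (0 : ℝ))) measurableSet_Ioi
    rwa [← Pi.zero_def, piecewise_eq_indicator] at this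
  rw [e]
  exact Measurable.indicator (by fun_prop) measurableSet_Ioi

lemma hasMoments_halfTricomi_of_pos {σ a : ℝ} (ha : 0 < a) (h0 : 1 / 2 < σ) (h2 : σ < 3 / 2) :
    HasMoments (halfTricomi σ a) := by
  -- `laplaceInt_le` asks for τ > 1 and τ ≥ σ; τ < σ + 1/2 makes y^(σ-τ) square integrable at 0.
  -- Such τ exists because σ > 1/2.
  obtain ⟨τ, hτ1, hτ2⟩ := exists_between (max_lt (by linarith : 1 < σ + 1 / 2)
    (by linarith : σ < σ + 1 / 2))
  have ht1 : 1 < τ := (le_max_left _ _).trans_lt hτ1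
  have ht2 : σ < τ := (le_max_right _ _).trans_lt hτ1
  obtain ⟨C, hC, hle⟩ := laplaceInt_le (a := a) (k := σ - a - 1) ha ht1 (by linarith)
  have hG : 0 < Real.Gamma a := Real.Gamma_pos_of_pos ha
  intro k
  have hm : AEStronglyMeasurable (fun y => y ^ k * halfTricomi σ a y) volume :=
    ((measurable_id.pow_const k).mul
      (measurable_halfTricomi_of_pos ha (by linarith) (by linarith))).aestronglyMeasurable
  obtain ⟨a1, a2⟩ := memLp_rpow_mul_exp (r := k + (σ - 1)) (by
    have : (0 : ℝ) ≤ k := k.cast_nonneg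
    linarith)
  obtain ⟨b1, b2⟩ := memLp_rpow_mul_exp (r := k + (σ - τ)) (by
    have : (0 : ℝ) ≤ k := k.cast_nonneg
    linarith)
  have hb : ∀ y : ℝ, ‖y ^ k * halfTricomi σ a y‖ ≤
      (C / Real.Gamma a) * ((Ioi (0 : ℝ)).indicator
          (fun y => y ^ (k + (σ - 1)) * Real.exp (-(1 / 2 * y))) y
        + (Ioi (0 : ℝ)).indicator
          (fun y => y ^ (k + (σ - τ)) * Real.exp (-(1 / 2 * y))) y) := by
    intro y
    by_cases hy : y ∈ Ioi (0 : ℝ)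
    · have hy' : (0 : ℝ) < y := hy
      simp only [indicator_of_mem hy]
      rw [halfTricomi_eq_laplaceInt ha (by linarith) (by linarith) hy',
        Real.norm_of_nonneg (by have := laplaceInt_nonneg a (σ - a - 1) y; positivity),
        show (k : ℝ) + (σ - τ) = k + (σ - 1) + (1 - τ) by ring, Real.rpow_add hy' _ (1 - τ),
        Real.rpow_add hy', Real.rpow_natCast]
      calc y ^ k * (y ^ (σ - 1) * Real.exp (-(1 / 2 * y))
            * (laplaceInt a (σ - a - 1) y / Real.Gamma a))
          ≤ y ^ k * (y ^ (σ - 1) * Real.exp (-(1 / 2 * y))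
            * (C * (1 + y ^ (1 - τ)) / Real.Gamma a)) := by
            gcongr
            exact hle y hy'
        _ = _ := by ring
    · rw [halfTricomi_of_nonpos _ _ (not_lt.1 hy)]
      simp [indicator_of_notMem hy]
  have hb' : ∀ y : ℝ, ‖y ^ k * halfTricomi σ a y‖ ≤
      ‖(C / Real.Gamma a) * ((Ioi (0 : ℝ)).indicator
          (fun y => y ^ (k + (σ - 1)) * Real.exp (-(1 / 2 * y))) y
        + (Ioi (0 : ℝ)).indicator
          (fun y => y ^ (k + (σ - τ)) * Real.exp (-(1 / 2 * y))) y)‖ :=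
    fun y => (hb y).trans (le_abs_self _)
  exact ⟨((a1.add b1).const_mul _).mono hm (ae_of_all _ hb'),
    ((a2.add b2).const_mul _).mono hm (ae_of_all _ hb')⟩

/-- Descent in a by the recurrence. Its coefficient contains y, which is why all moments are carried
along. -/
lemma hasMoments_halfTricomi {σ : ℝ} (h0 : 1 / 2 < σ) (h2 : σ < 3 / 2) (a : ℝ) :
    HasMoments (halfTricomi σ a) := by
  have main : ∀ n : ℕ, ∀ a : ℝ, 0 < a + n → HasMoments (halfTricomi σ a) := by
    intro n
    induction n with
    | zero => exact fun a ha => hasMoments_halfTricomi_of_pos (by simpa using ha) h0 h2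
    | succ n ih =>
      intro a ha
      push_cast at ha
      have h1 := ih (a + 1) (by linarith)
      have h3 := ih (a + 1 + 1) (by linarith)
      have h4 := (h1.lin h1.mul_id (-(σ - 2 * (a + 1))) 1).lin h3 1
        (-((a + 1) * (a + 1 - σ + 1)))
      convert h4 using 2 with y
      have := halfTricomi_recurrence (by linarith) (by linarith) (σ := σ) (a + 1) y
      rw [add_sub_cancel_right] at this
      linear_combination this
  obtain ⟨n, hn⟩ := exists_nat_gt (-a)
  exact main n a (by linarith)

/-! ### Tricomi pairs and their contiguous relations -/

/-- The inverse Fourier transform of `(1/2 + 2πiξ)^(-p) (1/2 - 2πiξ)^(-q)` in terms of Tricomi's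
function. -/
noncomputable def tricomiPair (p q y : ℝ) : ℝ :=
  1 / Real.Gamma p * halfTricomi (p + q) q y + 1 / Real.Gamma q * halfTricomi (p + q) p (-y)

lemma tricomiPair_neg (p q y : ℝ) : tricomiPair p q (-y) = tricomiPair q p y := by
  rw [tricomiPair, tricomiPair, neg_neg, add_comm q p, add_comm]

lemma hasMoments_tricomiPair {p q : ℝ} (h0 : 1 / 2 < p + q) (h2 : p + q < 3 / 2) :
    HasMoments (tricomiPair p q) :=
  (hasMoments_halfTricomi h0 h2 q).lin (hasMoments_halfTricomi h0 h2 p).comp_neg _ _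

lemma tricomiPair_recurrence {p q : ℝ} (h0 : 0 < p + q) (h2 : p + q < 2) (y : ℝ) :
    y * tricomiPair p q y = p * (tricomiPair p q y + tricomiPair (p + 1) (q - 1) y)
      - q * (tricomiPair p q y + tricomiPair (p - 1) (q + 1) y) := by
  have r1 := halfTricomi_recurrence h0 h2 q y
  have r2 := halfTricomi_recurrence h0 h2 p (-y)
  have g1 := one_div_Gamma_eq p
  have g2 := one_div_Gamma_eq (p - 1)
  have g3 := one_div_Gamma_eq q
  have g4 := one_div_Gamma_eq (q - 1)
  rw [sub_add_cancel] at g2 g4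
  simp only [tricomiPair, show p + 1 + (q - 1) = p + q by ring,
    show p - 1 + (q + 1) = p + q by ring]
  linear_combination (-(1 / Real.Gamma p)) * r1 + (1 / Real.Gamma q) * r2
    + halfTricomi (p + q) (q - 1) y * g1 - p * halfTricomi (p + q) (p + 1) (-y) * g4
    + q * halfTricomi (p + q) (q + 1) y * g2 - halfTricomi (p + q) (p - 1) (-y) * g3

lemma gammaConv_of_pos {p q y : ℝ} (hy : 0 < y) : gammaConv p q y
    = y ^ (p + q - 1) * Real.exp (-(1 / 2 * y)) * laplaceInt q (p - 1) y
      / (Real.Gamma p * Real.Gamma q) := by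
  have e : y ^ (p + q - 1) * y ^ (-(q + (p - 1))) = 1 := by
    rw [← Real.rpow_add hy]; ring_nf; simp
  rw [gammaConv, if_pos hy, laplaceInt_eq_shiftedGammaInt _ _ hy]
  congr 1
  linear_combination (-(Real.exp (-(1 / 2 * y)) * shiftedGammaInt q (p - 1) y)) * e

lemma tricomiPair_of_pos {p q y : ℝ} (hy : 0 < y) :
    tricomiPair p q y = 1 / Real.Gamma p * halfTricomi (p + q) q y := by
  rw [tricomiPair, halfTricomi_of_nonpos _ p (by linarith : -y ≤ 0)]
  ring

section base

variable {p q : ℝ}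

/-- Gives access to first parameters in (-1, 0], where the Laplace integral itself diverges. -/
lemma halfTricomi_lower {σ a y : ℝ} (ha : 0 < a) (h0 : 0 < σ) (h2 : σ < 2) (hy : 0 < y) :
    halfTricomi σ (a - 1) y = y ^ (σ - 1) * Real.exp (-(1 / 2 * y)) / Real.Gamma a *
      (-(σ - 2 * a - y) * laplaceInt a (σ - a - 1) y
        - (a - σ + 1) * laplaceInt (a + 1) (σ - a - 2) y) := by
  have hG := (Real.Gamma_pos_of_pos ha).ne'
  have r := halfTricomi_recurrence h0 h2 a y
  rw [halfTricomi_eq_laplaceInt ha h0 h2 hy,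
    halfTricomi_eq_laplaceInt (by linarith : 0 < a + 1) h0 h2 hy, Real.Gamma_add_one ha.ne',
    show σ - (a + 1) - 1 = σ - a - 2 by ring] at r
  have e : halfTricomi σ (a - 1) y = -((σ - 2 * a - y) * (y ^ (σ - 1) * Real.exp (-(1 / 2 * y))
      * (laplaceInt a (σ - a - 1) y / Real.Gamma a)) + a * (a - σ + 1) * (y ^ (σ - 1)
      * Real.exp (-(1 / 2 * y)) * (laplaceInt (a + 1) (σ - a - 2) y / (a * Real.Gamma a)))) := by
    linarith
  rw [e]
  field_simp
  ring

/-- Contiguous relations on the half-line where the second parameter may be negative. -/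
lemma tricomiPair_base_pos (hp : 0 < p) (hq : -1 < q) (h0 : 0 < p + q) (h2 : p + q < 2) {y : ℝ}
    (hy : 0 < y) :
    tricomiPair (p - 1) (q + 1) y + tricomiPair p q y = gammaConv p (q + 1) y ∧
    y * tricomiPair p q y = p * gammaConv (p + 1) (q + 1) y - (p + q) * gammaConv p (q + 1) y := by
  have hq1 : 0 < q + 1 := by linarith
  have hGp := (Real.Gamma_pos_of_pos hp).ne'
  have hGq := (Real.Gamma_pos_of_pos hq1).ne'
  have g2 := one_div_Gamma_eq (p - 1)
  rw [sub_add_cancel] at g2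
  have hZ := halfTricomi_lower hq1 h0 h2 hy
  have hZ1 := halfTricomi_eq_laplaceInt hq1 h0 h2 hy
  rw [add_sub_cancel_right] at hZ
  have e2 : y ^ (p + q) = y ^ (p + q - 1) * y := by
    conv_lhs => rw [show p + q = p + q - 1 + 1 by ring, Real.rpow_add hy, Real.rpow_one]
  have e3 : y ^ (p + q + 1) = y ^ (p + q - 1) * y * y := by
    rw [Real.rpow_add hy, Real.rpow_one, e2]
  have t1 := laplaceInt_parts hq1 (p - 2) hy
  have t3 := laplaceInt_add_one_right hq1 (p - 2) hy
  have t4 := laplaceInt_add_one_right hq1 (p - 1) hy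
  have t7 := laplaceInt_parts hq1 (p - 3) hy
  rw [show p - 2 + 1 = p - 1 by ring] at t1 t3
  rw [show p - 1 + 1 = p by ring] at t4
  rw [show p - 3 + 1 = p - 2 by ring] at t7
  rw [tricomiPair_of_pos hy, tricomiPair_of_pos hy, gammaConv_of_pos hy, gammaConv_of_pos hy,
    show p - 1 + (q + 1) = p + q by ring, hZ, hZ1, g2, Real.Gamma_add_one hp.ne',
    show p + (q + 1) - 1 = p + q by ring, show p + 1 + (q + 1) - 1 = p + q + 1 by ring, e2, e3,
    show p + q - (q + 1) - 1 = p - 2 by ring, show p + q - (q + 1) - 2 = p - 3 by ring,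
    show p + 1 - 1 = p by ring]
  have hpp : p * (y ^ (p + q - 1) * y * y * Real.exp (-(1 / 2 * y)) * laplaceInt (q + 1) p y
      / (p * Real.Gamma p * Real.Gamma (q + 1))) = y ^ (p + q - 1) * y * y
      * Real.exp (-(1 / 2 * y)) * laplaceInt (q + 1) p y
      / (Real.Gamma p * Real.Gamma (q + 1)) := by
    field_simp
  rw [hpp]
  -- Once this common factor is pulled out, both claims are linear relations between Laplace
  -- integrals.
  set K := y ^ (p + q - 1) * Real.exp (-(1 / 2 * y)) / (Real.Gamma p * Real.Gamma (q + 1)) with hK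
  constructor
  · linear_combination K * (t7 - y * t3)
  · linear_combination K * y * (t7 + t1 - (y - p + 1) * t3 - y * t4)

/-- Contiguous relations on the half-line where the second parameter is positive. -/
lemma tricomiPair_base_neg (hp : 0 < p) (hq : -1 < q) (h0 : 0 < p + q) (h2 : p + q < 2) {y : ℝ}
    (hy : 0 < y) :
    tricomiPair (q + 1) (p - 1) y + tricomiPair q p y = gammaConv (q + 1) p y ∧
    -y * tricomiPair q p y = p * gammaConv (q + 1) (p + 1) y - (p + q) * gammaConv (q + 1) p y := by
  have hq1 : 0 < q + 1 := by linarith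
  have hGp := (Real.Gamma_pos_of_pos hp).ne'
  have hGq := (Real.Gamma_pos_of_pos hq1).ne'
  have g2 := one_div_Gamma_eq q
  rw [add_comm p q] at h0 h2 ⊢
  have hZ := halfTricomi_lower hp h0 h2 hy
  have hZ1 := halfTricomi_eq_laplaceInt hp h0 h2 hy
  have e2 : y ^ (q + p) = y ^ (q + p - 1) * y := by
    conv_lhs => rw [show q + p = q + p - 1 + 1 by ring, Real.rpow_add hy, Real.rpow_one]
  have e3 : y ^ (q + p + 1) = y ^ (q + p - 1) * y * y := by
    rw [Real.rpow_add hy, Real.rpow_one, e2]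
  have t1 := laplaceInt_parts hp (q - 2) hy
  have t2 := laplaceInt_parts hp (q - 1) hy
  have t3 := laplaceInt_add_one_right hp (q - 1) hy
  rw [show q - 2 + 1 = q - 1 by ring] at t1
  rw [sub_add_cancel] at t2 t3
  rw [tricomiPair_of_pos hy, tricomiPair_of_pos hy, gammaConv_of_pos hy, gammaConv_of_pos hy,
    show q + 1 + (p - 1) = q + p by ring, hZ, hZ1, g2, Real.Gamma_add_one hp.ne',
    show q + 1 + p - 1 = q + p by ring, show q + 1 + (p + 1) - 1 = q + p + 1 by ring, e2, e3,
    show q + p - p - 1 = q - 1 by ring, show q + p - p - 2 = q - 2 by ring,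
    show q + 1 - 1 = q by ring]
  have hpp : p * (y ^ (q + p - 1) * y * y * Real.exp (-(1 / 2 * y)) * laplaceInt (p + 1) q y
      / (Real.Gamma (q + 1) * (p * Real.Gamma p))) = y ^ (q + p - 1) * y * y
      * Real.exp (-(1 / 2 * y)) * laplaceInt (p + 1) q y
      / (Real.Gamma p * Real.Gamma (q + 1)) := by
    field_simp
  rw [hpp]
  set K := y ^ (q + p - 1) * Real.exp (-(1 / 2 * y)) / (Real.Gamma p * Real.Gamma (q + 1)) with hK
  constructor
  · linear_combination K * (t1 - y * t3)
  · linear_combination K * y * (t2 + q * t3)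

end base

/-! ### The Fourier transform of a Tricomi pair -/

lemma HasMoments.integrable_ofReal {f : ℝ → ℝ} (hf : HasMoments f) :
    Integrable fun y => (f y : ℂ) :=
  hf.integrable.ofReal

lemma HasMoments.integrable_mul_ofReal {f : ℝ → ℝ} (hf : HasMoments f) :
    Integrable fun y : ℝ => (y : ℂ) * (f y : ℂ) := by
  simpa using hf.mul_id.integrable_ofReal

/-- Since q may be negative, the pair need not be a Gamma convolution. However, y times it is a
combination of convolutions with positive parameters, and `HasFourier.of_mul_id` removes the factor
y. The neighbouring pair follows because the two add up to a convolution. -/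
lemma hasFourier_tricomiPair_base {p q : ℝ} (hp : 0 < p) (hq : -1 < q) (h0 : 1 / 2 < p + q)
    (h2 : p + q < 3 / 2) :
    HasFourier (fun y => (tricomiPair p q y : ℂ)) (rootSymbol p q) ∧
    HasFourier (fun y => (tricomiPair (p - 1) (q + 1) y : ℂ)) (rootSymbol (p - 1) (q + 1)) := by
  have hq1 : 0 < q + 1 := by linarith
  have rel : ∀ y : ℝ, y ≠ 0 →
      tricomiPair (p - 1) (q + 1) y + tricomiPair p q y = gammaConv p (q + 1) y ∧
      y * tricomiPair p q y
        = p * gammaConv (p + 1) (q + 1) y - (p + q) * gammaConv p (q + 1) y := by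
    intro y hy
    rcases lt_or_gt_of_ne hy with h | h
    · have := tricomiPair_base_neg hp hq (by linarith) (by linarith) (neg_pos.2 h)
      simpa only [tricomiPair_neg, gammaConv_neg, neg_neg] using this
    · exact tricomiPair_base_pos hp hq (by linarith) (by linarith) h
  have hne : ∀ᵐ y : ℝ, y ≠ 0 := compl_mem_ae_iff.2 (measure_singleton (0 : ℝ))
  have hm := hasMoments_tricomiPair h0 h2
  have c1 := hasFourier_gammaConv hp hq1
  have c2 := hasFourier_gammaConv (by linarith : 0 < p + 1) hq1
  have F1 : HasFourier (fun y => (tricomiPair p q y : ℂ)) (rootSymbol p q) := by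
    refine HasFourier.of_mul_id (by linarith) hm.integrable_ofReal ?_
    have c3 := c2.lin c1 p (-(p + q))
    refine HasFourier.congr_ae (f := fun y => (p : ℂ) * (gammaConv (p + 1) (q + 1) y : ℂ)
      + -((p : ℂ) + q) * (gammaConv p (q + 1) y : ℂ)) ⟨c3.integrable, ?_⟩ ?_
    · rw [c3.eq]
      ext ξ
      rw [rootSymbol_add_one_add]
      ring
    · filter_upwards [hne] with y hy
      have h := congrArg (fun x : ℝ => (x : ℂ)) (rel y hy).2
      push_cast at h
      rw [h]
      ring
  refine ⟨F1, ?_⟩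
  have c4 := c1.lin F1 1 (-1)
  refine HasFourier.congr_ae (f := fun y => (1 : ℂ) * (gammaConv p (q + 1) y : ℂ)
      + -1 * (tricomiPair p q y : ℂ)) ⟨c4.integrable, ?_⟩ ?_
  · rw [c4.eq]
    ext ξ
    have s1 := rootSymbol_add_one_right p q ξ
    have s2 := rootSymbol_add_one_left (p - 1) (q + 1) ξ
    rw [sub_add_cancel] at s2
    rw [← s1, ← s2]
    linear_combination (-rootSymbol p (q + 1) ξ) * rootFactor_add_neg ξ
  · filter_upwards [hne] with y hy
    rw [← (rel y hy).1]
    push_cast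
    ring

/-- The counterpart for symbols of `tricomiPair_recurrence`. -/
lemma rootSymbol_three_term (p q ξ : ℝ) :
    p * rootSymbol (p + 1) q ξ - q * rootSymbol p (q + 1) ξ
      = p * (rootSymbol p q ξ + rootSymbol (p + 1) (q - 1) ξ)
        - q * (rootSymbol p q ξ + rootSymbol (p - 1) (q + 1) ξ) := by
  have s1 := rootSymbol_add_one_add p (q - 1) ξ
  have s2 := rootSymbol_add_one_add (p - 1) q ξ
  rw [sub_add_cancel] at s1 s2
  rw [s1, s2]
  ring

/-- Both three-term relations are solved for their last term, which requires division by q. -/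
lemma hasFourier_tricomiPair_sub_one {p q : ℝ} (h0 : 1 / 2 < p + q) (h2 : p + q < 3 / 2)
    (hq : q ≠ 0) (F0 : HasFourier (fun y => (tricomiPair p q y : ℂ)) (rootSymbol p q))
    (F1 : HasFourier (fun y => (tricomiPair (p + 1) (q - 1) y : ℂ))
      (rootSymbol (p + 1) (q - 1))) :
    HasFourier (fun y => (tricomiPair (p - 1) (q + 1) y : ℂ)) (rootSymbol (p - 1) (q + 1)) := by
  have hqc : (q : ℂ) ≠ 0 := by exact_mod_cast hq
  have Fy := F0.mul_id_rootSymbol (hasMoments_tricomiPair h0 h2).integrable_mul_ofReal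
  have c := (F0.lin F1 ((p - q : ℂ) / q) (p / q)).lin Fy 1 (-1 / q)
  refine HasFourier.congr_ae ⟨c.integrable, c.eq.trans ?_⟩ (ae_of_all _ fun y => ?_)
  · ext ξ
    rw [rootSymbol_three_term]
    field_simp
    ring
  · have h := congrArg (fun x : ℝ => (x : ℂ))
      (tricomiPair_recurrence (p := p) (q := q) (by linarith) (by linarith) y)
    push_cast at h
    beta_reduce
    rw [h]
    field_simp
    ring

lemma hasFourier_tricomiPair_symm {p q : ℝ}
    (F : HasFourier (fun y => (tricomiPair p q y : ℂ)) (rootSymbol p q)) :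
    HasFourier (fun y => (tricomiPair q p y : ℂ)) (rootSymbol q p) := by
  have := F.comp_neg
  simpa only [tricomiPair_neg, rootSymbol_neg] using this

lemma hasFourier_tricomiPair_cast {p q p' q' : ℝ}
    (F : HasFourier (fun y => (tricomiPair p q y : ℂ)) (rootSymbol p q)) (hp : p = p')
    (hq : q = q') : HasFourier (fun y => (tricomiPair p' q' y : ℂ)) (rootSymbol p' q') := by
  subst hp hq
  exact F

theorem hasFourier_tricomiPair {p q : ℝ} (h0 : 1 / 2 < p + q) (h2 : p + q < 3 / 2)
    (hp : ∀ k : ℤ, p ≠ k) (hq : ∀ k : ℤ, q ≠ k) :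
    HasFourier (fun y => (tricomiPair p q y : ℂ)) (rootSymbol p q) := by
  -- With r in (0, 1) and r + s = p + q > 1/2, s exceeds -1/2, so the base case gives two adjacent
  -- pairs. Non-integrality of p and q keeps every divisor in the two inductions nonzero.
  set r := Int.fract p
  set s := p + q - r
  have hr0 : 0 < r := Int.fract_pos.2 (hp _)
  have hr1 : r < 1 := Int.fract_lt_one p
  have hrp : p = r + ⌊p⌋ := (Int.fract_add_floor p).symm
  have hsq : q = s - ⌊p⌋ := by simp only [s]; linarith
  have hbase := hasFourier_tricomiPair_base (p := r) (q := s) hr0 (by simp only [s]; linarith)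
    (by simp only [s]; linarith) (by simp only [s]; linarith)
  have hrn : ∀ n : ℤ, r + n ≠ 0 := fun n h => hp (⌊p⌋ - n) (by push_cast; linarith)
  have hsn : ∀ n : ℤ, s + n ≠ 0 := fun n h => hq (-n - ⌊p⌋) (by push_cast; linarith)
  set P : ℤ → Prop := fun n =>
    HasFourier (fun y => (tricomiPair (r - n) (s + n) y : ℂ)) (rootSymbol (r - n) (s + n))
  have up : ∀ n : ℕ, P n ∧ P (n + 1) := by
    intro n
    induction n with
    | zero => simpa [P] using hbase
    | succ n ih =>
      refine ⟨by simpa using ih.2, ?_⟩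
      have h1 := ih.1
      have h2' := ih.2
      simp only [P] at h1 h2' ⊢
      push_cast at h1 h2' ⊢
      have := hasFourier_tricomiPair_sub_one (p := r - (n + 1)) (q := s + (n + 1))
        (by simp only [s]; linarith) (by simp only [s]; linarith)
        (by exact_mod_cast hsn (n + 1)) h2'
        (hasFourier_tricomiPair_cast h1 (by ring) (by ring))
      exact hasFourier_tricomiPair_cast this (by ring) (by ring)
  -- Reflection exchanges the two parameters, so the same step serves the other direction.
  have down : ∀ n : ℕ, P (-n) ∧ P (-n + 1) := by
    intro n
    induction n with
    | zero => simpa [P] using hbase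
    | succ n ih =>
      refine ⟨?_, by simpa using ih.1⟩
      have h1 := hasFourier_tricomiPair_symm ih.1
      have h2' := hasFourier_tricomiPair_symm ih.2
      refine hasFourier_tricomiPair_symm ?_
      push_cast at h1 h2' ⊢
      have := hasFourier_tricomiPair_sub_one (p := s + -n) (q := r - -n)
        (by simp only [s]; linarith) (by simp only [s]; linarith)
        (by have := hrn n; simpa using this) h1
        (hasFourier_tricomiPair_cast h2' (by ring) (by ring))
      exact hasFourier_tricomiPair_cast this (by ring) (by ring)
  have key : ∀ n : ℤ, P n := by
    intro n
    rcases Int.eq_nat_or_neg n with ⟨m, rfl | rfl⟩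
    · exact (up m).1
    · exact (down m).1
  have h := key (-⌊p⌋)
  simp only [P] at h
  push_cast at h
  rw [sub_neg_eq_add, ← sub_eq_add_neg, ← hrp, ← hsq] at h
  exact h

/-! ### Plancherel and almost everywhere inversion -/

lemma integral_fourier_mul {f g : ℝ → ℂ} (hf : Integrable f) (hg : Integrable g) :
    ∫ ξ, 𝓕 f ξ * g ξ = ∫ x, f x * 𝓕 g x := by
  simpa using! (VectorFourier.integral_fourierIntegral_smul_eq_flip (L := innerₗ ℝ)
    Real.continuous_fourierChar continuous_inner hf hg)

lemma continuous_fourier {f : ℝ → ℂ} (hf : Integrable f) : Continuous (𝓕 f) :=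
  VectorFourier.fourierIntegral_continuous Real.continuous_fourierChar
    (innerSL ℝ).continuous₂ hf

lemma norm_fourier_le (f : ℝ → ℂ) (ξ : ℝ) : ‖𝓕 f ξ‖ ≤ ∫ x, ‖f x‖ :=
  VectorFourier.norm_fourierIntegral_le_integral_norm _ _ _ _ _

/-- Two locally integrable functions with the same integrals against Schwartz functions agree. -/
lemma ae_eq_of_integral_schwartz {f g : ℝ → ℂ} (hf : LocallyIntegrable f)
    (hg : LocallyIntegrable g)
    (h : ∀ φ : SchwartzMap ℝ ℂ, ∫ x, φ x * f x = ∫ x, φ x * g x) : f =ᵐ[volume] g := by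
  refine ae_eq_of_integral_contDiff_smul_eq hf hg fun φ hφ hc => ?_
  have hg₁ : HasCompactSupport (Complex.ofRealCLM ∘ φ) := hc.comp_left rfl
  have hg₂ : ContDiff ℝ ∞ (Complex.ofRealCLM ∘ φ) := by fun_prop
  simpa using h (hg₁.toSchwartzMap hg₂)

/-- Identifies the abstract L² transform with the integral: as tempered distributions both are
determined by the multiplication formula against Schwartz functions. -/
lemma fourier_toLp_ae {f : ℝ → ℂ} (hf : Integrable f) (h2 : MemLp f 2) :
    (𝓕 (h2.toLp f) : Lp ℂ 2 (volume : Measure ℝ)) =ᵐ[volume] 𝓕 f := by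
  refine ae_eq_of_integral_schwartz ((Lp.memLp _).locallyIntegrable (by norm_num))
    (continuous_fourier hf).locallyIntegrable fun φ => ?_
  have h1 := congrArg (fun T : TemperedDistribution ℝ ℂ => T φ)
    (Lp.fourier_toTemperedDistribution_eq (h2.toLp f))
  simp only [TemperedDistribution.fourier_apply, Lp.toTemperedDistribution_apply] at h1
  have h3 : ∫ x, (𝓕 φ : SchwartzMap ℝ ℂ) x • (h2.toLp f) x = ∫ x, f x * 𝓕 (φ : ℝ → ℂ) x := by
    refine integral_congr_ae ?_
    filter_upwards [h2.coeFn_toLp] with x hx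
    rw [hx, SchwartzMap.fourier_coe, smul_eq_mul, mul_comm]
  rw [h3, ← integral_fourier_mul hf φ.integrable] at h1
  simp only [smul_eq_mul] at h1
  rw [← h1]
  congr 1
  ext x
  ring

lemma HasFourier.memLp {f u : ℝ → ℂ} (hf : HasFourier f u) (h2 : MemLp f 2) : MemLp u 2 := by
  have h := fourier_toLp_ae hf.integrable h2
  rw [hf.eq] at h
  exact (memLp_congr_ae h).1 (Lp.memLp _)

lemma HasFourier.integral_conj_mul {f u g v : ℝ → ℂ} (hf : HasFourier f u) (hf2 : MemLp f 2)
    (hg : HasFourier g v) (hg2 : MemLp g 2) :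
    ∫ x, conj (f x) * g x = ∫ ξ, conj (u ξ) * v ξ := by
  have h1 := fourier_toLp_ae hf.integrable hf2
  have h2 := fourier_toLp_ae hg.integrable hg2
  rw [hf.eq] at h1
  rw [hg.eq] at h2
  have h := Lp.inner_fourier_eq (hf2.toLp f) (hg2.toLp g)
  rw [L2.inner_def, L2.inner_def] at h
  have e1 : ∫ x, inner ℂ ((hf2.toLp f) x) ((hg2.toLp g) x) = ∫ x, conj (f x) * g x := by
    refine integral_congr_ae ?_
    filter_upwards [hf2.coeFn_toLp, hg2.coeFn_toLp] with x hx hy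
    rw [hx, hy, RCLike.inner_apply, mul_comm]
  have e2 : ∫ x, inner ℂ ((𝓕 (hf2.toLp f) : Lp ℂ 2 (volume : Measure ℝ)) x)
      ((𝓕 (hg2.toLp g) : Lp ℂ 2 (volume : Measure ℝ)) x) = ∫ ξ, conj (u ξ) * v ξ := by
    refine integral_congr_ae ?_
    filter_upwards [h1, h2] with x hx hy
    rw [hx, hy, RCLike.inner_apply, mul_comm]
  rw [← e1, ← e2, h]

lemma HasFourier.eLpNorm_eq {f u : ℝ → ℂ} (hf : HasFourier f u) (h2 : MemLp f 2) :
    eLpNorm f 2 volume = eLpNorm u 2 volume := by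
  have h := fourier_toLp_ae hf.integrable h2
  rw [hf.eq] at h
  have hn := Lp.norm_fourier_eq (h2.toLp f)
  rw [Lp.norm_def, Lp.norm_def, eLpNorm_congr_ae h, eLpNorm_congr_ae h2.coeFn_toLp] at hn
  exact ((ENNReal.toReal_eq_toReal_iff' (hf.memLp h2).eLpNorm_ne_top h2.eLpNorm_ne_top).1 hn).symm

/-- Fourier inversion almost everywhere. -/
lemma HasFourier.ae_eq {f u : ℝ → ℂ} (hf : HasFourier f u) (hu : Integrable u) :
    f =ᵐ[volume] 𝓕 fun ξ => u (-ξ) := by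
  refine ae_eq_of_integral_schwartz hf.integrable.locallyIntegrable
    (continuous_fourier hu.comp_neg).locallyIntegrable fun φ => ?_
  have e0 : 𝓕 ((𝓕⁻ φ : SchwartzMap ℝ ℂ) : ℝ → ℂ) = φ := by
    rw [← SchwartzMap.fourier_coe, FourierTransform.fourier_fourierInv_eq]
  calc ∫ x, φ x * f x = ∫ x, f x * 𝓕 ((𝓕⁻ φ : SchwartzMap ℝ ℂ) : ℝ → ℂ) x := by
        rw [e0]; simp only [mul_comm]
    _ = ∫ ξ, u ξ * 𝓕⁻ (φ : ℝ → ℂ) ξ := by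
        rw [← integral_fourier_mul hf.integrable (SchwartzMap.integrable _), hf.eq,
          SchwartzMap.fourierInv_coe]
    _ = ∫ ξ, u (-ξ) * 𝓕 (φ : ℝ → ℂ) ξ := by
        rw [← integral_neg_eq_self]
        simp only [Real.fourierInv_eq_fourier_neg, neg_neg]
    _ = ∫ x, φ x * 𝓕 (fun ξ => u (-ξ)) x := by
        rw [← integral_fourier_mul hu.comp_neg φ.integrable]
        simp only [mul_comm]

lemma HasFourier.ae_norm_le {f u : ℝ → ℂ} (hf : HasFourier f u) (hu : Integrable u) :
    ∀ᵐ y, ‖f y‖ ≤ ∫ ξ, ‖u ξ‖ := by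
  filter_upwards [hf.ae_eq hu] with y hy
  rw [hy]
  refine (norm_fourier_le _ y).trans ?_
  rw [integral_neg_eq_self (fun ξ => ‖u ξ‖)]

/-! ### Integrals of symbols -/

lemma one_add_norm_le_rootFactor (ξ : ℝ) : 1 + ‖ξ‖ ≤ 3 * ‖rootFactor ξ‖ := by
  have h1 := abs_le_norm_rootFactor ξ
  have h2 := Complex.abs_re_le_norm (rootFactor ξ)
  rw [rootFactor_re, abs_of_pos (by norm_num)] at h2
  rw [Real.norm_eq_abs]
  linarith

lemma integrable_rootSymbol {p q : ℝ} (h : 1 < p + q) : Integrable (rootSymbol p q) := by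
  have h1 : Integrable fun ξ : ℝ => (1 + ‖ξ‖) ^ (-(p + q)) :=
    integrable_one_add_norm (by simpa using h)
  refine (h1.const_mul (3 ^ (p + q))).mono' (continuous_rootSymbol p q).aestronglyMeasurable
    (ae_of_all _ fun ξ => ?_)
  have hr : 0 < ‖rootFactor ξ‖ := norm_pos_iff.2 (rootFactor_ne_zero ξ)
  have h0 : 0 ≤ ‖ξ‖ := norm_nonneg ξ
  rw [norm_rootSymbol]
  have h2 : (3 * ‖rootFactor ξ‖) ^ (-(p + q)) ≤ (1 + ‖ξ‖) ^ (-(p + q)) :=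
    Real.rpow_le_rpow_of_nonpos (by positivity) (one_add_norm_le_rootFactor ξ) (by linarith)
  rw [Real.mul_rpow (by norm_num) hr.le, Real.rpow_neg (by norm_num : (0 : ℝ) ≤ 3)] at h2
  have h3 : (0 : ℝ) < 3 ^ (p + q) := by positivity
  calc ‖rootFactor ξ‖ ^ (-(p + q))
      = 3 ^ (p + q) * ((3 ^ (p + q))⁻¹ * ‖rootFactor ξ‖ ^ (-(p + q))) := by field_simp
    _ ≤ _ := by gcongr

lemma integral_rootSymbol_one_one : ∫ ξ, rootSymbol 1 1 ξ = 1 := by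
  have e : ∀ ξ : ℝ, rootSymbol 1 1 ξ = ((4 * (1 + (4 * Real.pi * ξ) ^ 2)⁻¹ : ℝ) : ℂ) := by
    intro ξ
    simp only [rootSymbol, Complex.ofReal_one, Complex.cpow_neg_one, ← mul_inv]
    rw [← conj_rootFactor, Complex.mul_conj, Complex.normSq_apply, rootFactor_re, rootFactor_im,
      ← Complex.ofReal_inv]
    congr 1
    have : 0 < 1 + (4 * Real.pi * ξ) ^ 2 := by positivity
    have : 0 < 1 / 2 * (1 / 2) + 2 * Real.pi * ξ * (2 * Real.pi * ξ) := by nlinarith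
    field_simp
    ring
  simp only [e]
  rw [integral_complex_ofReal, integral_const_mul,
    Measure.integral_comp_mul_left (fun x => (1 + x ^ 2)⁻¹), integral_univ_inv_one_add_sq,
    abs_of_pos (by positivity)]
  have := Real.pi_ne_zero
  rw [smul_eq_mul]
  field_simp
  norm_num

lemma rootSymbol_one_neg_one (ξ : ℝ) : rootSymbol 1 (-1) ξ = rootSymbol 1 0 ξ - 1 := by
  have h1 := rootSymbol_add_one_right 1 (-1) ξ
  have h2 := rootSymbol_add_one_left 0 0 ξ
  rw [neg_add_cancel] at h1
  rw [zero_add, rootSymbol_zero_zero] at h2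
  rw [← h1, ← h2]
  linear_combination rootSymbol 1 0 ξ * rootFactor_add_neg ξ

lemma rootSymbol_intCast (k : ℤ) (ξ : ℝ) : rootSymbol k (-k) ξ = rootSymbol 1 (-1) ξ ^ k := by
  simp only [rootSymbol]
  push_cast
  rw [mul_zpow, ← Complex.cpow_mul_int, ← Complex.cpow_mul_int]
  simp

lemma tendsto_rootSymbol_intCast (k : ℤ) (l : Filter ℝ)
    (hl : Tendsto (fun ξ : ℝ => |ξ|) l atTop) :
    Tendsto (rootSymbol k (-k)) l (𝓝 ((-1) ^ k)) := by
  have h1 := (tendsto_rootSymbol (p := 1) (q := 0) (by norm_num) l hl).sub_const 1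
  rw [zero_sub] at h1
  have h2 := h1.zpow₀ k (Or.inl (by norm_num))
  refine h2.congr fun ξ => ?_
  rw [rootSymbol_intCast, rootSymbol_one_neg_one]

/-- For k ≠ 0 the integrand is a constant multiple of the derivative of w^k, and w^k tends to (-1)^k
at both ends. -/
lemma integral_rootSymbol_int (k : ℤ) :
    ∫ ξ, rootSymbol (1 + k) (1 - k) ξ = if k = 0 then 1 else 0 := by
  split_ifs with h
  · subst h
    simpa using integral_rootSymbol_one_one
  · have hk : (k : ℂ) ≠ 0 := by exact_mod_cast h
    have hi := integrable_rootSymbol (p := 1 + k) (q := 1 - k) (by linarith)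
    have hd : ∀ ξ, HasDerivAt (rootSymbol k (-k))
        (-(2 * Real.pi * Complex.I * k) * rootSymbol (1 + k) (1 - k) ξ) ξ := fun ξ => by
      refine (hasDerivAt_rootSymbol k (-k) ξ).congr_deriv ?_
      have := rootSymbol_add_one_add k (-k) ξ
      rw [show (1 : ℝ) + k = k + 1 by ring, show (1 : ℝ) - k = -k + 1 by ring, this]
      push_cast
      ring
    have key := integral_of_hasDerivAt_of_tendsto hd (hi.const_mul _)
      (tendsto_rootSymbol_intCast k atBot tendsto_abs_atBot_atTop)
      (tendsto_rootSymbol_intCast k atTop tendsto_abs_atTop_atTop)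
    rw [integral_const_mul, sub_self] at key
    exact (mul_eq_zero.1 key).resolve_left (by simp [Real.pi_ne_zero, hk])

/-! ### Stone–Weierstrass on the compactified line -/

/-- The function `rootSymbol n (-n)`, extended continuously to the compactified line. -/
noncomputable def rootMonomial (n : ℤ) : C(OnePoint ℝ, ℂ) :=
  OnePoint.continuousMapMk ⟨rootSymbol n (-n), continuous_rootSymbol _ _⟩ ((-1) ^ n)
    (by
      rw [coclosedCompact_eq_cocompact]
      exact tendsto_rootSymbol_intCast n _ (tendsto_norm_cocompact_atTop (E := ℝ)))

lemma rootMonomial_coe (n : ℤ) (ξ : ℝ) : rootMonomial n (ξ : OnePoint ℝ) = rootSymbol n (-n) ξ :=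
  rfl

lemma rootMonomial_infty (n : ℤ) : rootMonomial n OnePoint.infty = (-1) ^ n := rfl

lemma rootMonomial_zero : rootMonomial 0 = 1 := by
  ext x
  induction x using OnePoint.rec with
  | infty => simp [rootMonomial_infty]
  | coe ξ => simp [rootMonomial_coe, rootSymbol_zero_zero]

lemma rootSymbol_one_neg_one_ne_zero (ξ : ℝ) : rootSymbol 1 (-1) ξ ≠ 0 := by
  rw [← norm_ne_zero_iff, norm_rootSymbol]
  simp

lemma rootMonomial_add (m n : ℤ) :
    rootMonomial (m + n) = rootMonomial m * rootMonomial n := by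
  ext x
  induction x using OnePoint.rec with
  | infty =>
    simp only [ContinuousMap.mul_apply, rootMonomial_infty]
    exact zpow_add₀ (by norm_num) m n
  | coe ξ =>
    simp only [ContinuousMap.mul_apply, rootMonomial_coe, rootSymbol_intCast]
    exact zpow_add₀ (rootSymbol_one_neg_one_ne_zero ξ) m n

lemma star_rootMonomial (n : ℤ) : star (rootMonomial n) = rootMonomial (-n) := by
  ext x
  induction x using OnePoint.rec with
  | infty =>
    simp only [ContinuousMap.star_apply, rootMonomial_infty, star_zpow₀, star_neg, star_one,
      zpow_neg, ← inv_zpow]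
    norm_num
  | coe ξ =>
    simp only [ContinuousMap.star_apply, rootMonomial_coe, RCLike.star_def, conj_rootSymbol]
    push_cast
    rw [neg_neg]

lemma rootMonomial_one_coe (ξ : ℝ) : rootMonomial 1 (ξ : OnePoint ℝ) = (rootFactor ξ)⁻¹ - 1 := by
  rw [rootMonomial_coe, rootSymbol_intCast, zpow_one, rootSymbol_one_neg_one]
  simp [rootSymbol, Complex.cpow_neg_one]

/-- w = 1/z - 1 determines z, and takes the value -1 only at infinity; hence w alone separates
points. -/
lemma rootMonomial_one_injective : Function.Injective (rootMonomial 1) := by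
  intro x y h
  induction x using OnePoint.rec with
  | infty =>
    induction y using OnePoint.rec with
    | infty => rfl
    | coe η =>
      rw [rootMonomial_one_coe, rootMonomial_infty] at h
      exact absurd (by linear_combination -h) (inv_ne_zero (rootFactor_ne_zero η))
  | coe ξ =>
    induction y using OnePoint.rec with
    | infty =>
      rw [rootMonomial_one_coe, rootMonomial_infty] at h
      exact absurd (by linear_combination h) (inv_ne_zero (rootFactor_ne_zero ξ))
    | coe η =>
      rw [rootMonomial_one_coe, rootMonomial_one_coe] at h
      have h' := congrArg Complex.im (inv_injective (sub_left_injective h))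
      rw [rootFactor_im, rootFactor_im] at h'
      rw [mul_left_cancel₀ (by positivity) h']

/-- The star subalgebra generated by the functions `rootMonomial n`. -/
noncomputable def rootSubalgebra : StarSubalgebra ℂ C(OnePoint ℝ, ℂ) where
  toSubalgebra := Algebra.adjoin ℂ (range rootMonomial)
  star_mem' := by
    change Algebra.adjoin ℂ (range rootMonomial) ≤ star (Algebra.adjoin ℂ (range rootMonomial))
    refine Algebra.adjoin_le ?_
    rintro - ⟨n, rfl⟩
    exact Algebra.subset_adjoin ⟨-n, (star_rootMonomial n).symm⟩

lemma rootSubalgebra_coe : Subalgebra.toSubmodule rootSubalgebra.toSubalgebra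
    = Submodule.span ℂ (range rootMonomial) := by
  apply Algebra.adjoin_eq_span_of_subset
  refine Subset.trans ?_ Submodule.subset_span
  intro x hx
  refine Submonoid.closure_induction (fun _ => id) ⟨0, rootMonomial_zero⟩ ?_ hx
  rintro - - - - ⟨m, rfl⟩ ⟨n, rfl⟩
  exact ⟨m + n, rootMonomial_add m n⟩

lemma span_rootMonomial_closure :
    (Submodule.span ℂ (range rootMonomial)).topologicalClosure = ⊤ := by
  have h : rootSubalgebra.topologicalClosure = ⊤ :=
    ContinuousMap.starSubalgebra_topologicalClosure_eq_top_of_separatesPoints _ fun x y hxy =>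
      ⟨_, ⟨rootMonomial 1, Algebra.subset_adjoin ⟨1, rfl⟩, rfl⟩,
        rootMonomial_one_injective.ne hxy⟩
  rw [← rootSubalgebra_coe]
  exact congr_arg (Subalgebra.toSubmodule <| StarSubalgebra.toSubalgebra ·) h

lemma exists_rootSymbol_near {φ : ℝ → ℂ} (hc : Continuous φ)
    (h0 : Tendsto φ (cocompact ℝ) (𝓝 0)) {ε : ℝ} (hε : 0 < ε) :
    ∃ (s : Finset ℤ) (a : ℤ → ℂ), ∀ ξ, ‖φ ξ - ∑ n ∈ s, a n * rootSymbol n (-n) ξ‖ ≤ ε := by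
  let Φ : C(OnePoint ℝ, ℂ) := OnePoint.continuousMapMk ⟨φ, hc⟩ 0
    (by rwa [coclosedCompact_eq_cocompact])
  have hΦ : Φ ∈ closure (Submodule.span ℂ (range rootMonomial) : Set C(OnePoint ℝ, ℂ)) := by
    rw [← Submodule.topologicalClosure_coe, span_rootMonomial_closure]
    trivial
  obtain ⟨g, hg, hd⟩ := Metric.mem_closure_iff.1 hΦ ε hε
  obtain ⟨a, rfl⟩ := Finsupp.mem_span_range_iff_exists_finsupp.1 hg
  refine ⟨a.support, a, fun ξ => ?_⟩
  have h := (ContinuousMap.dist_apply_le_dist (ξ : OnePoint ℝ)).trans hd.le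
  rw [dist_eq_norm, Finsupp.sum, ContinuousMap.sum_apply] at h
  exact h

/-! ### Completeness of the Tricomi pairs -/

lemma norm_rootFactor_le (ξ : ℝ) : ‖rootFactor ξ‖ ≤ 7 * (1 + ‖ξ‖) := by
  have h := Complex.norm_le_abs_re_add_abs_im (rootFactor ξ)
  rw [rootFactor_re, rootFactor_im, abs_mul, abs_of_pos (by norm_num : (0 : ℝ) < 1 / 2),
    abs_of_pos (by positivity : 0 < 2 * Real.pi)] at h
  have := Real.pi_lt_d2
  rw [Real.norm_eq_abs]
  nlinarith [abs_nonneg ξ]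

lemma tendsto_schwartz_div_rootSymbol (ψ : SchwartzMap ℝ ℂ) {p q : ℝ} (h : p + q < 3) :
    Tendsto (fun ξ => ψ ξ / rootSymbol p q ξ) (cocompact ℝ) (𝓝 0) := by
  obtain ⟨C, hC⟩ : ∃ C, ∀ ξ : ℝ, (1 + ‖ξ‖) ^ 3 * ‖ψ ξ‖ ≤ C := by
    refine ⟨2 ^ 3 * ((Finset.Iic (3, 0)).sup fun m : ℕ × ℕ => SchwartzMap.seminorm ℂ m.1 m.2) ψ,
      fun ξ => ?_⟩
    simpa only [norm_iteratedFDeriv_zero] using SchwartzMap.one_add_le_sup_seminorm_apply (𝕜 := ℂ)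
      (m := (3, 0)) (k := 3) (n := 0) le_rfl le_rfl ψ ξ
  -- Cubic decay of ψ is enough as p + q < 3; the factor 343 is the cube of the 7 in
  -- `norm_rootFactor_le`.
  have ht := (tendsto_rootSymbol (p := 3 - (p + q)) (q := 0) (by linarith) _
    (tendsto_norm_cocompact_atTop (E := ℝ))).norm.const_mul (343 * C)
  rw [norm_zero, mul_zero] at ht
  refine squeeze_zero_norm (fun ξ => ?_) ht
  have hr : 0 < ‖rootFactor ξ‖ := norm_pos_iff.2 (rootFactor_ne_zero ξ)
  rw [norm_div, norm_rootSymbol, norm_rootSymbol, add_zero, neg_sub, Real.rpow_sub hr,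
    Real.rpow_neg hr.le, div_inv_eq_mul, mul_div_assoc', le_div_iff₀ (by positivity)]
  norm_cast
  have h3 : ‖rootFactor ξ‖ ^ 3 ≤ 343 * (1 + ‖ξ‖) ^ 3 := by
    calc _ ≤ (7 * (1 + ‖ξ‖)) ^ 3 := by gcongr; exact norm_rootFactor_le ξ
      _ = _ := by ring
  have h4 : ‖ψ ξ‖ * ‖rootFactor ξ‖ ^ 3 ≤ 343 * C := by
    calc _ ≤ ‖ψ ξ‖ * (343 * (1 + ‖ξ‖) ^ 3) := by gcongr
      _ ≤ _ := by linarith [hC ξ]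
  calc _ = ‖ψ ξ‖ * ‖rootFactor ξ‖ ^ 3 * ‖rootFactor ξ‖ ^ (p + q) := by ring
    _ ≤ _ := by gcongr

lemma HasFourier.sum {ι : Type*} (s : Finset ι) (a : ι → ℂ) {f u : ι → ℝ → ℂ}
    (h : ∀ i, HasFourier (f i) (u i)) :
    HasFourier (fun y => ∑ i ∈ s, a i * f i y) (fun ξ => ∑ i ∈ s, a i * u i ξ) := by
  classical
  induction s using Finset.induction_on with
  | empty =>
    refine ⟨by simp, ?_⟩
    ext ξ
    simp [Real.fourier_eq]
  | insert i s hi ih =>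
    simpa only [Finset.sum_insert hi, one_mul] using (h i).lin ih (a i) 1

/-- L¹ against the uniform bound on S, Cauchy–Schwarz off S. This is why the approximation must be
small both uniformly and in L². -/
lemma lintegral_mul_le_of_integrableOn_memLp {G e : ℝ → ℂ} {S : Set ℝ} (hS : MeasurableSet S)
    (hG : MemLp G 2 (volume.restrict Sᶜ)) (he : AEStronglyMeasurable e)
    {M : ENNReal} (hMt : M ≠ ⊤) (hM : ∀ᵐ y, ‖e y‖ₑ ≤ M) :
    ∫⁻ y, ‖G y * e y‖ₑ ≤ (∫⁻ y in S, ‖G y‖ₑ) * M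
      + eLpNorm G 2 (volume.restrict Sᶜ) * eLpNorm e 2 := by
  rw [← lintegral_add_compl _ hS]
  refine add_le_add ?_ ?_
  · rw [← lintegral_mul_const' _ _ hMt]
    refine lintegral_mono_ae ?_
    filter_upwards [ae_restrict_of_ae hM] with y hy
    rw [enorm_mul]
    gcongr
  · have h := eLpNorm_smul_le_mul_eLpNorm (p := 2) (q := 2) (r := 1) (he.restrict (s := Sᶜ))
      hG.aestronglyMeasurable
    rw [eLpNorm_one_eq_lintegral_enorm] at h
    refine h.trans ?_
    gcongr
    exact Measure.restrict_le_self

/-- Schwartz functions are approximated, in `L²` and uniformly, by linear combinations of functions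
with Fourier transforms `v wⁿ`, where `v = rootSymbol p q` and `w` is the unimodular function
`rootSymbol 1 (-1)`. -/
lemma exists_sub_sum_le {p q : ℝ} (h1 : 1 < p + q) (h3 : p + q < 3) {H : ℤ → ℝ → ℂ}
    (hH : ∀ n : ℤ, HasFourier (H n) (fun ξ => rootSymbol p q ξ * rootSymbol n (-n) ξ))
    (hH2 : ∀ n, MemLp (H n) 2) (f : SchwartzMap ℝ ℂ) {ε : NNReal} (hε : 0 < ε) :
    ∃ (s : Finset ℤ) (a : ℤ → ℂ), MemLp (fun y => f y - ∑ n ∈ s, a n * H n y) 2 ∧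
      eLpNorm (fun y => f y - ∑ n ∈ s, a n * H n y) 2 ≤ ε * eLpNorm (rootSymbol p q) 2 ∧
      ∀ᵐ y, ‖f y - ∑ n ∈ s, a n * H n y‖ₑ ≤ ε * eLpNorm (rootSymbol p q) 1 := by
  set v : ℝ → ℂ := rootSymbol p q with hv
  have hvi : Integrable v := integrable_rootSymbol h1
  have hvn : ∀ ξ, v ξ ≠ 0 := fun ξ => by
    rw [hv, ← norm_ne_zero_iff, norm_rootSymbol]
    exact (Real.rpow_pos_of_pos (norm_pos_iff.2 (rootFactor_ne_zero ξ)) _).ne'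
  have hfψ : HasFourier f (𝓕 f : SchwartzMap ℝ ℂ) :=
    ⟨f.integrable, by rw [SchwartzMap.fourier_coe]⟩
  generalize (𝓕 f : SchwartzMap ℝ ℂ) = ψ at hfψ
  obtain ⟨s, a, ha⟩ := exists_rootSymbol_near (φ := fun ξ => ψ ξ / v ξ)
    (ψ.continuous.div (continuous_rootSymbol _ _) hvn)
    (tendsto_schwartz_div_rootSymbol ψ h3) (NNReal.coe_pos.2 hε)
  have he : HasFourier (fun y => f y - ∑ n ∈ s, a n * H n y)
      (fun ξ => ψ ξ - ∑ n ∈ s, a n * (v ξ * rootSymbol n (-n) ξ)) := by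
    simpa only [one_mul, neg_mul, ← sub_eq_add_neg] using
      hfψ.lin (HasFourier.sum s a hH) 1 (-1)
  have he2 : MemLp (fun y => f y - ∑ n ∈ s, a n * H n y) 2 :=
    (f.memLp 2).sub (memLp_finsetSum s fun n _ => (hH2 n).const_mul (a n))
  set r : ℝ → ℂ := fun ξ => ψ ξ - ∑ n ∈ s, a n * (v ξ * rootSymbol n (-n) ξ) with hr
  -- The uniform error ε for ψ/v becomes ε|v| after multiplication by v; its L² and L¹ norms bound
  -- the error on the original side in L² and uniformly.
  have hrv : ∀ ξ, ‖r ξ‖ ≤ ε * ‖v ξ‖ := fun ξ => by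
    have : r ξ = (ψ ξ / v ξ - ∑ n ∈ s, a n * rootSymbol n (-n) ξ) * v ξ := by
      rw [sub_mul, div_mul_cancel₀ _ (hvn ξ), Finset.sum_mul]
      refine congrArg (ψ ξ - ·) ?_
      exact Finset.sum_congr rfl fun n _ => by ring
    rw [this, norm_mul]
    gcongr
    exact ha ξ
  have hrc : Continuous r := by
    have := continuous_fourier he.integrable
    rwa [he.eq] at this
  have hri : Integrable r := (hvi.norm.const_mul (ε : ℝ)).mono' hrc.aestronglyMeasurable
    (ae_of_all _ hrv)
  have hrL : ∀ t, eLpNorm r t ≤ ε * eLpNorm v t := fun t =>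
    eLpNorm_le_nnreal_smul_eLpNorm_of_ae_le_mul (ae_of_all _ hrv) t
  refine ⟨s, a, he2, (he.eLpNorm_eq he2).trans_le (hrL 2), ?_⟩
  filter_upwards [he.ae_norm_le hri] with y hy
  refine le_trans ?_ (hrL 1)
  rw [eLpNorm_one_eq_lintegral_enorm, ← ofReal_integral_norm_eq_lintegral_enorm hri,
    ← ofReal_norm]
  exact ENNReal.ofReal_le_ofReal hy

lemma eq_zero_of_forall_enorm_le {z : ℂ} {K : ENNReal} (hK : K ≠ ⊤)
    (h : ∀ ε : NNReal, 0 < ε → ‖z‖ₑ ≤ ε * K) : z = 0 := by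
  lift K to NNReal using hK
  have h0 : ‖z‖₊ ≤ 0 := by
    refine le_of_forall_pos_le_add fun δ hδ => ?_
    have h3 := h (δ / (K + 1)) (by positivity)
    rw [enorm_eq_nnnorm] at h3
    norm_cast at h3
    refine h3.trans ?_
    rw [zero_add, div_mul_eq_mul_div]
    refine div_le_of_le_mul₀ (by positivity) (by positivity) ?_
    gcongr
    simp
  simpa using h0

/-- If `G` is orthogonal to all functions `tricomiPair (p + n) (q - n)`, then it vanishes. -/
lemma ae_eq_zero_of_integral_tricomiPair {p q : ℝ} (h1 : 1 ≤ p + q) (h2 : p + q < 3 / 2)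
    (hp : ∀ k : ℤ, p ≠ k) (hq : ∀ k : ℤ, q ≠ k) {G : ℝ → ℂ} {S : Set ℝ} (hS : MeasurableSet S)
    (hGS : IntegrableOn G S) (hGc : MemLp G 2 (volume.restrict Sᶜ))
    (hGi : ∀ n : ℤ, Integrable fun y => G y * (tricomiPair (p + n) (q - n) y : ℂ))
    (hG0 : ∀ n : ℤ, ∫ y, G y * (tricomiPair (p + n) (q - n) y : ℂ) = 0) : G =ᵐ[volume] 0 := by
  set h : ℤ → ℝ → ℂ := fun n y => (tricomiPair (p + n) (q - n) y : ℂ) with hh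
  -- By z + z̄ = 1, adding neighbours raises the order of decay of the symbol from p + q, which may
  -- equal 1, to p + q + 1, so the new symbol is integrable.
  set H : ℤ → ℝ → ℂ := fun n y => h n y + h (n + 1) y with hH
  set v : ℝ → ℂ := rootSymbol (p + 1) q with hv
  have hF : ∀ n : ℤ, HasFourier (h n) (rootSymbol (p + n) (q - n)) := fun n =>
    hasFourier_tricomiPair (by linarith) (by linarith)
      (fun k hk => hp (k - n) (by push_cast; linarith))
      (fun k hk => hq (k + n) (by push_cast; linarith))
  have hm : ∀ n : ℤ, MemLp (h n) 2 := fun n =>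
    (hasMoments_tricomiPair (p := p + n) (q := q - n) (by linarith) (by linarith)).memLp_two.ofReal
  have hHF : ∀ n : ℤ, HasFourier (H n) (fun ξ => v ξ * rootSymbol n (-n) ξ) := fun n => by
    have := (hF n).lin (hF (n + 1)) 1 1
    simp only [one_mul] at this
    convert! this using 1
    ext ξ
    have e := rootSymbol_add_one_add (p + n) (q - n - 1) ξ
    rw [hv, rootSymbol_mul]
    rw [sub_add_cancel] at e
    push_cast
    rw [show p + 1 + n = p + n + 1 by ring, show q + -n = q - n by ring, e, add_comm,
      show p + (n + 1) = p + n + 1 by ring, show q - (n + 1) = q - n - 1 by ring]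
  have hHm : ∀ n : ℤ, MemLp (H n) 2 := fun n => (hm n).add (hm (n + 1))
  have hHi : ∀ n : ℤ, Integrable fun y => G y * H n y := fun n => by
    simp only [hH, mul_add]
    exact (hGi n).add (hGi (n + 1))
  have hH0 : ∀ n : ℤ, ∫ y, G y * H n y = 0 := fun n => by
    simp only [hH, mul_add]
    rw [integral_add (hGi n) (hGi (n + 1)), hG0, hG0, add_zero]
  have hvi : Integrable v := integrable_rootSymbol (by linarith)
  have hv2 : MemLp v 2 := by
    have := (hHF 0).memLp (hHm 0)
    simpa [rootSymbol_zero_zero] using this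
  have hGm : AEStronglyMeasurable G := by
    rw [← Measure.restrict_univ (μ := volume), ← union_compl_self S]
    exact aestronglyMeasurable_union_iff.2 ⟨hGS.aestronglyMeasurable, hGc.aestronglyMeasurable⟩
  have hloc : LocallyIntegrable G := by
    refine locallyIntegrable_iff.2 fun K hK => ?_
    have h3 : IntegrableOn G (K ∩ Sᶜ) := by
      have : IsFiniteMeasure (volume.restrict (K ∩ Sᶜ)) :=
        ⟨by
          rw [Measure.restrict_apply_univ]
          exact (measure_mono inter_subset_left).trans_lt hK.measure_lt_top⟩
      exact (hGc.mono_measure (Measure.restrict_mono inter_subset_right le_rfl)).integrable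
        (by norm_num)
    rw [← inter_union_compl K S]
    exact (hGS.mono_set inter_subset_right).union h3
  refine ae_eq_of_integral_schwartz hloc (locallyIntegrable_const 0) fun f => ?_
  simp only [Pi.zero_apply, zero_mul, integral_zero, mul_comm (f _)]
  set A := ∫⁻ y in S, ‖G y‖ₑ with hA
  have hAt : A ≠ ⊤ := hGS.2.ne
  set B := eLpNorm G 2 (volume.restrict Sᶜ) with hB
  have hBt : B ≠ ⊤ := hGc.eLpNorm_ne_top
  have hf2 : MemLp f 2 := f.memLp 2
  have hGf : Integrable fun y => G y * f y := by
    refine ⟨hGm.mul f.continuous.aestronglyMeasurable, ?_⟩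
    obtain ⟨C, hC⟩ : ∃ C : ℝ, ∀ y, ‖f y‖ ≤ C := by
      obtain ⟨C, -, hC⟩ := f.decay 0 0
      exact ⟨C, fun y => by simpa using hC y⟩
    refine (lintegral_mul_le_of_integrableOn_memLp hS hGc f.continuous.aestronglyMeasurable
      (M := ENNReal.ofReal C) ENNReal.ofReal_ne_top (ae_of_all _ fun y => ?_)).trans_lt ?_
    · rw [← ofReal_norm]
      exact ENNReal.ofReal_le_ofReal (hC y)
    · have := hf2.eLpNorm_ne_top
      finiteness
  have hv1t : eLpNorm v 1 ≠ ⊤ := (memLp_one_iff_integrable.2 hvi).eLpNorm_ne_top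
  have hv2t : eLpNorm v 2 ≠ ⊤ := hv2.eLpNorm_ne_top
  have key : ∀ ε : NNReal, 0 < ε →
      ‖∫ y, G y * f y‖ₑ ≤ ε * (A * eLpNorm v 1 + B * eLpNorm v 2) := by
    intro ε hε
    obtain ⟨s, a, hm2, he2, he1⟩ := exists_sub_sum_le (by linarith) (by linarith) hHF hHm f hε
    have hint : ∫ y, G y * (f y - ∑ n ∈ s, a n * H n y) = ∫ y, G y * f y := by
      have e1 : (fun y => G y * (f y - ∑ n ∈ s, a n * H n y))
          = fun y => G y * f y - ∑ n ∈ s, a n * (G y * H n y) := by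
        ext y
        rw [mul_sub, Finset.mul_sum]
        congr 1
        exact Finset.sum_congr rfl fun n _ => by ring
      rw [e1, integral_sub hGf (integrable_finsetSum _ fun n _ => (hHi n).const_mul _),
        integral_finsetSum _ fun n _ => (hHi n).const_mul _]
      simp only [integral_const_mul, hH0, mul_zero, Finset.sum_const_zero, sub_zero]
    rw [← hint]
    refine (enorm_integral_le_lintegral_enorm _).trans
      ((lintegral_mul_le_of_integrableOn_memLp hS hGc hm2.aestronglyMeasurable
        (ENNReal.mul_ne_top ENNReal.coe_ne_top hv1t) he1).trans ?_)
    rw [mul_add, mul_left_comm _ A, mul_left_comm _ B]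
    gcongr
  exact eq_zero_of_forall_enorm_le (by finiteness) key

/-! ### The functions 𝓛ₙ as Tricomi pairs, in two ways -/

/-- The piecewise constant factor of the weight. -/
noncomputable def weightSide (α β y : ℝ) : ℝ :=
  if 0 < y then Real.cos (Real.pi * β) else Real.cos (Real.pi * α)

lemma laguerreWeight_eq (α β y : ℝ) :
    laguerreWeight α β y = |y| ^ (β - α) * Real.exp (-|y|) * weightSide α β y := rfl

lemma measurable_weightSide (α β : ℝ) : Measurable (weightSide α β) :=
  Measurable.ite measurableSet_Ioi measurable_const measurable_const

lemma measurable_laguerreWeight (α β : ℝ) : Measurable (laguerreWeight α β) := by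
  have : Measurable fun y : ℝ => |y| := measurable_norm
  exact ((this.pow_const _).mul this.neg.exp).mul (measurable_weightSide α β)

lemma cos_pi_mul_ne_zero {γ : ℝ} (h : ∀ k : ℤ, γ ≠ (k : ℝ) + 1 / 2) :
    Real.cos (Real.pi * γ) ≠ 0 := by
  intro h0
  obtain ⟨k, hk⟩ := Real.cos_eq_zero_iff.1 h0
  refine h k (mul_left_cancel₀ Real.pi_ne_zero ?_)
  rw [hk]
  ring

lemma weightSide_ne_zero {α β : ℝ} (hα : ∀ k : ℤ, α ≠ (k : ℝ) + 1 / 2)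
    (hβ : ∀ k : ℤ, β ≠ (k : ℝ) + 1 / 2) (y : ℝ) : weightSide α β y ≠ 0 := by
  unfold weightSide
  split_ifs
  exacts [cos_pi_mul_ne_zero hβ, cos_pi_mul_ne_zero hα]

lemma abs_weightSide_le (α β y : ℝ) : |weightSide α β y| ≤ 1 := by
  unfold weightSide
  split_ifs <;> exact Real.abs_cos_le_one _

lemma Gamma_mul_Gamma_half (γ : ℝ) (n : ℤ) :
    Real.Gamma (1 / 2 + n + γ) * Real.Gamma (1 / 2 - n - γ)
      = (-1) ^ n * Real.pi / Real.cos (Real.pi * γ) := by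
  have h := Real.Gamma_mul_Gamma_one_sub (1 / 2 + n + γ)
  have e : Real.sin (Real.pi * (1 / 2 + n + γ)) = (-1) ^ n * Real.cos (Real.pi * γ) := by
    rw [show Real.pi * (1 / 2 + n + γ) = Real.pi * γ + n * Real.pi + Real.pi / 2 by ring,
      Real.sin_add_pi_div_two, Real.cos_add_int_mul_pi]
  rw [show 1 - (1 / 2 + n + γ) = 1 / 2 - n - γ by ring, e] at h
  rw [h]
  rcases Int.even_or_odd n with hn | hn
  · simp [hn.neg_one_zpow]
  · simp [hn.neg_one_zpow, div_neg, neg_div]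

lemma half_add_ne_intCast {γ : ℝ} (h : ∀ k : ℤ, γ ≠ (k : ℝ) + 1 / 2) (n k : ℤ) :
    1 / 2 + n + γ ≠ k := fun hk => h (k - n - 1) (by push_cast; linarith)

lemma half_sub_ne_intCast {γ : ℝ} (h : ∀ k : ℤ, γ ≠ (k : ℝ) + 1 / 2) (n k : ℤ) :
    1 / 2 - n - γ ≠ k := fun hk => h (-n - k) (by push_cast; linarith)

lemma Gamma_ne_zero_of_ne_intCast {s : ℝ} (h : ∀ k : ℤ, s ≠ k) : Real.Gamma s ≠ 0 :=
  Real.Gamma_ne_zero fun m => by simpa using h (-m)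

lemma laguerreSquare_ne_zero {α β : ℝ} (hα : ∀ k : ℤ, α ≠ (k : ℝ) + 1 / 2)
    (hβ : ∀ k : ℤ, β ≠ (k : ℝ) + 1 / 2) (n : ℤ) : laguerreSquare α β n ≠ 0 := by
  refine div_ne_zero (mul_ne_zero (zpow_ne_zero _ (by norm_num)) Real.pi_ne_zero) (mul_ne_zero ?_ ?_)
  exacts [Gamma_ne_zero_of_ne_intCast (half_add_ne_intCast hβ n),
    Gamma_ne_zero_of_ne_intCast (half_sub_ne_intCast hα n)]

lemma tricomiPair_eq_perturbedLaguerre (α β : ℝ) (n : ℤ) {y : ℝ} (hy : y ≠ 0) :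
    tricomiPair (1 / 2 - n - α) (1 / 2 + n + β) y
      = |y| ^ (β - α) * Real.exp (-(1 / 2 * |y|)) * perturbedLaguerre α β n y := by
  rcases hy.lt_or_gt with h | h
  · rw [← neg_neg y, tricomiPair_neg, neg_neg, tricomiPair_of_pos (neg_pos.2 h), halfTricomi,
      if_pos (neg_pos.2 h), perturbedLaguerre, if_neg h.not_gt, if_pos h, abs_of_neg h,
      show (1 / 2 + n + β + (1 / 2 - n - α) : ℝ) = 1 - α + β by ring,
      show 1 - α + β - 1 = β - α by ring]
    ring
  · rw [tricomiPair_of_pos h, halfTricomi, if_pos h, perturbedLaguerre, if_pos h, abs_of_pos h,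
      show (1 / 2 - n - α + (1 / 2 + n + β) : ℝ) = 1 - α + β by ring,
      show 1 - α + β - 1 = β - α by ring]
    ring

lemma halfTricomi_kummer {σ a y : ℝ} (h0 : 0 < σ) (h2 : σ < 2) (hy : 0 < y) :
    halfTricomi σ a y = Real.exp (-(1 / 2 * y)) * tricomiPsi (a - σ + 1) (2 - σ) y := by
  rw [halfTricomi, if_pos hy, tricomiPsi_kummer h0 h2 a hy]
  have : y ^ (σ - 1) * y ^ (1 - σ) = 1 := by
    rw [← Real.rpow_add hy]
    simp
  linear_combination (Real.exp (-(1 / 2 * y)) * tricomiPsi (a - σ + 1) (2 - σ) y) * this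

/-- Kummer's transformation turns second parameter 1 + α - β into 1 - α + β and absorbs the power of
y. Comparing Gamma factors by `Gamma_mul_Gamma_half` leaves cos πβ for y > 0 and cos πα for y < 0.
-/
lemma laguerreSquare_mul_tricomiPair {α β : ℝ} (hαβ : |α - β| < 1 / 2)
    (hα : ∀ k : ℤ, α ≠ (k : ℝ) + 1 / 2) (hβ : ∀ k : ℤ, β ≠ (k : ℝ) + 1 / 2) (n : ℤ) {y : ℝ}
    (hy : y ≠ 0) :
    laguerreSquare α β n * tricomiPair (1 / 2 - n - β) (1 / 2 + n + α) y
      = weightSide α β y * Real.exp (-(1 / 2 * |y|)) * perturbedLaguerre α β n y := by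
  obtain ⟨h1, h2⟩ := abs_lt.1 hαβ
  have hca := cos_pi_mul_ne_zero hα
  have hcb := cos_pi_mul_ne_zero hβ
  have ga := Gamma_mul_Gamma_half α n
  have gb := Gamma_mul_Gamma_half β n
  have g1 := Gamma_ne_zero_of_ne_intCast (half_add_ne_intCast hβ n)
  have g2 := Gamma_ne_zero_of_ne_intCast (half_sub_ne_intCast hα n)
  have g3 := Gamma_ne_zero_of_ne_intCast (half_add_ne_intCast hα n)
  have g4 := Gamma_ne_zero_of_ne_intCast (half_sub_ne_intCast hβ n)
  rw [eq_div_iff hca] at ga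
  rw [eq_div_iff hcb] at gb
  rcases hy.lt_or_gt with h | h
  · rw [← neg_neg y, tricomiPair_neg, neg_neg, tricomiPair_of_pos (neg_pos.2 h),
      halfTricomi_kummer (by linarith) (by linarith) (neg_pos.2 h), perturbedLaguerre,
      if_neg h.not_gt, if_pos h, abs_of_neg h, weightSide, if_neg h.not_gt, laguerreSquare, ← ga,
      show (1 / 2 - n - β - (1 / 2 + n + α + (1 / 2 - n - β)) + 1 : ℝ) = 1 / 2 - n - α by ring,
      show (2 - (1 / 2 + n + α + (1 / 2 - n - β)) : ℝ) = 1 - α + β by ring]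
    generalize Real.Gamma (1 / 2 + n + α) = A at g3 ⊢
    generalize Real.Gamma (1 / 2 - n - α) = B at g2 ⊢
    generalize Real.Gamma (1 / 2 + n + β) = C at g1 ⊢
    generalize Real.Gamma (1 / 2 - n - β) = D at g4 ⊢
    field_simp
  · rw [tricomiPair_of_pos h,
      halfTricomi_kummer (by linarith) (by linarith) h, perturbedLaguerre,
      if_pos h, abs_of_pos h, weightSide, if_pos h, laguerreSquare, ← gb,
      show (1 / 2 + n + α - (1 / 2 - n - β + (1 / 2 + n + α)) + 1 : ℝ) = 1 / 2 + n + β by ring,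
      show (2 - (1 / 2 - n - β + (1 / 2 + n + α)) : ℝ) = 1 - α + β by ring]
    generalize Real.Gamma (1 / 2 + n + α) = A at g3 ⊢
    generalize Real.Gamma (1 / 2 - n - α) = B at g2 ⊢
    generalize Real.Gamma (1 / 2 + n + β) = C at g1 ⊢
    generalize Real.Gamma (1 / 2 - n - β) = D at g4 ⊢
    field_simp

/-- One factor is taken in each representation; together they use up the weight exactly. -/
lemma perturbedLaguerre_mul_weight {α β : ℝ} (hαβ : |α - β| < 1 / 2)
    (hα : ∀ k : ℤ, α ≠ (k : ℝ) + 1 / 2) (hβ : ∀ k : ℤ, β ≠ (k : ℝ) + 1 / 2) (m n : ℤ) {y : ℝ}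
    (hy : y ≠ 0) :
    perturbedLaguerre α β m y * perturbedLaguerre α β n y * laguerreWeight α β y
      = laguerreSquare α β n * (tricomiPair (1 / 2 - m - α) (1 / 2 + m + β) y
        * tricomiPair (1 / 2 - n - β) (1 / 2 + n + α) y) := by
  have h := laguerreSquare_mul_tricomiPair hαβ hα hβ n hy
  have e : Real.exp (-|y|) = Real.exp (-(1 / 2 * |y|)) * Real.exp (-(1 / 2 * |y|)) := by
    rw [← Real.exp_add]
    ring_nf
  rw [mul_left_comm, h, tricomiPair_eq_perturbedLaguerre α β m hy, laguerreWeight_eq, e]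
  ring

/-! ### Orthogonality relations -/

lemma ae_ne_zero : ∀ᵐ y : ℝ, y ≠ 0 := by
  simp [ae_iff, measure_singleton]

lemma integrable_perturbedLaguerre_mul {α β : ℝ} (hαβ : |α - β| < 1 / 2)
    (hα : ∀ k : ℤ, α ≠ (k : ℝ) + 1 / 2) (hβ : ∀ k : ℤ, β ≠ (k : ℝ) + 1 / 2) (m n : ℤ) :
    Integrable fun y =>
      perturbedLaguerre α β m y * perturbedLaguerre α β n y * laguerreWeight α β y := by
  obtain ⟨h1, h2⟩ := abs_lt.1 hαβ
  have hm := (hasMoments_tricomiPair (p := 1 / 2 - m - α) (q := 1 / 2 + m + β) (by linarith)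
    (by linarith)).memLp_two
  have hn := (hasMoments_tricomiPair (p := 1 / 2 - n - β) (q := 1 / 2 + n + α) (by linarith)
    (by linarith)).memLp_two
  refine ((hm.integrable_mul hn).const_mul (laguerreSquare α β n)).congr ?_
  filter_upwards [ae_ne_zero] with y hy
  exact (perturbedLaguerre_mul_weight hαβ hα hβ m n hy).symm

lemma integral_perturbedLaguerre_mul {α β : ℝ} (hαβ : |α - β| < 1 / 2)
    (hα : ∀ k : ℤ, α ≠ (k : ℝ) + 1 / 2) (hβ : ∀ k : ℤ, β ≠ (k : ℝ) + 1 / 2) (m n : ℤ) :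
    ∫ y, perturbedLaguerre α β m y * perturbedLaguerre α β n y * laguerreWeight α β y
      = if m = n then laguerreSquare α β n else 0 := by
  obtain ⟨h1, h2⟩ := abs_lt.1 hαβ
  have hm := (hasMoments_tricomiPair (p := 1 / 2 - m - α) (q := 1 / 2 + m + β) (by linarith)
    (by linarith)).memLp_two
  have hn := (hasMoments_tricomiPair (p := 1 / 2 - n - β) (q := 1 / 2 + n + α) (by linarith)
    (by linarith)).memLp_two
  have fm : HasFourier _ _ := hasFourier_tricomiPair (p := 1 / 2 - m - α) (q := 1 / 2 + m + β)
    (by linarith) (by linarith) (half_sub_ne_intCast hα m) (half_add_ne_intCast hβ m)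
  have fn : HasFourier _ _ := hasFourier_tricomiPair (p := 1 / 2 - n - β) (q := 1 / 2 + n + α)
    (by linarith) (by linarith) (half_sub_ne_intCast hβ n) (half_add_ne_intCast hα n)
  have h := fm.integral_conj_mul hm.ofReal fn hn.ofReal
  -- Conjugation swaps the exponents, so α and β cancel in the product.
  have e1 : ∀ ξ, conj (rootSymbol (1 / 2 - m - α) (1 / 2 + m + β) ξ)
      * rootSymbol (1 / 2 - n - β) (1 / 2 + n + α) ξ
      = rootSymbol (1 + (m - n : ℤ)) (1 - (m - n : ℤ)) ξ := fun ξ => by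
    rw [conj_rootSymbol, rootSymbol_mul]
    congr 1 <;> push_cast <;> ring
  simp only [e1, integral_rootSymbol_int, Complex.conj_ofReal, ← Complex.ofReal_mul,
    integral_complex_ofReal, sub_eq_zero] at h
  have h' : ∫ y, tricomiPair (1 / 2 - m - α) (1 / 2 + m + β) y
      * tricomiPair (1 / 2 - n - β) (1 / 2 + n + α) y = if m = n then 1 else 0 := by
    apply Complex.ofReal_injective
    rw [h]
    split_ifs <;> simp
  rw [integral_congr_ae (g := fun y => laguerreSquare α β n *
    (tricomiPair (1 / 2 - m - α) (1 / 2 + m + β) y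
        * tricomiPair (1 / 2 - n - β) (1 / 2 + n + α) y)), integral_const_mul, h']
  · simp
  · filter_upwards [ae_ne_zero] with y hy
    exact perturbedLaguerre_mul_weight hαβ hα hβ m n hy

/-! ### Density in the weighted space -/

lemma integrable_withDensity_ofReal {ρ : ℝ → ℝ} (hρ : Measurable ρ) (h0 : ∀ y, 0 ≤ ρ y)
    {f : ℝ → ℂ} : Integrable f (volume.withDensity fun y => ENNReal.ofReal (ρ y)) ↔
      Integrable fun y => ρ y * f y := by
  rw [integrable_withDensity_iff_integrable_smul' hρ.ennreal_ofReal
    (ae_of_all _ fun _ => ENNReal.ofReal_lt_top)]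
  simp only [ENNReal.toReal_ofReal (h0 _), Complex.real_smul]

lemma integral_withDensity_ofReal {ρ : ℝ → ℝ} (hρ : Measurable ρ) (h0 : ∀ y, 0 ≤ ρ y)
    (f : ℝ → ℂ) : ∫ y, f y ∂(volume.withDensity fun y => ENNReal.ofReal (ρ y))
      = ∫ y, ρ y * f y := by
  rw [integral_withDensity_eq_integral_toReal_smul hρ.ennreal_ofReal
    (ae_of_all _ fun _ => ENNReal.ofReal_lt_top)]
  simp only [ENNReal.toReal_ofReal (h0 _), Complex.real_smul]

lemma memLp_sqrt_mul {ρ : ℝ → ℝ} (hρ : Measurable ρ) (h0 : ∀ y, 0 ≤ ρ y) {F : ℝ → ℂ}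
    (hFm : StronglyMeasurable F)
    (hF : MemLp F 2 (volume.withDensity fun y => ENNReal.ofReal (ρ y))) :
    MemLp (fun y => (Real.sqrt (ρ y) : ℂ) * F y) 2 := by
  have hm : AEStronglyMeasurable (fun y => (Real.sqrt (ρ y) : ℂ) * F y) volume :=
    ((Complex.measurable_ofReal.comp hρ.sqrt).mul hFm.measurable).aestronglyMeasurable
  rw [memLp_two_iff_integrable_sq_norm hm]
  have h : Integrable (fun y => ((‖F y‖ ^ 2 : ℝ) : ℂ)) _ :=
    ((memLp_two_iff_integrable_sq_norm hF.1).1 hF).ofReal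
  refine ((integrable_withDensity_ofReal hρ h0).1 h).re.congr (ae_of_all _ fun y => ?_)
  simp only [norm_mul, mul_pow, Complex.norm_real, Real.norm_eq_abs, sq_abs, Real.sq_sqrt (h0 y)]
  rw [← Complex.ofReal_mul]
  exact Complex.ofReal_re _

/-- A function that is square integrable with the weight `|y|^δ`, `0 ≤ δ < 1`, is integrable near
the origin. -/
lemma integrableOn_of_memLp_rpow_mul {δ : ℝ} (h1 : δ < 1) {G : ℝ → ℂ}
    (h : MemLp (fun y => ((|y| ^ (δ / 2) : ℝ) : ℂ) * G y) 2) : IntegrableOn G (Icc (-1) 1) := by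
  have hm : Measurable fun y : ℝ => |y| := measurable_norm
  have h2 : MemLp (fun y : ℝ => ((|y| ^ (-(δ / 2)) : ℝ) : ℂ)) 2 (volume.restrict (Icc (-1) 1)) := by
    suffices MemLp (fun y : ℝ => |y| ^ (-(δ / 2))) 2 (volume.restrict (Icc (-1) 1)) from
      this.ofReal
    rw [memLp_two_iff_integrable_sq (hm.pow_const _).aestronglyMeasurable]
    have h3 : IntervalIntegrable (fun y : ℝ => y ^ (-δ)) volume 0 1 :=
      intervalIntegral.intervalIntegrable_rpow' (by linarith)
    have h4 : IntervalIntegrable (fun y : ℝ => |y| ^ (-δ)) volume 0 1 :=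
      (intervalIntegrable_iff_integrableOn_Ioc_of_le zero_le_one).2
        (((intervalIntegrable_iff_integrableOn_Ioc_of_le zero_le_one).1 h3).congr_fun
          (fun y hy => by simp only [abs_of_pos hy.1]) measurableSet_Ioc)
    have h5 : IntervalIntegrable (fun y : ℝ => |y| ^ (-δ)) volume (-1) 0 := by
      have := ((IntervalIntegrable.iff_comp_neg (by finiteness)).1 h4).symm
      simpa only [abs_neg, neg_zero] using this
    refine (((intervalIntegrable_iff_integrableOn_Icc_of_le (by norm_num)).1
      (h5.trans h4))).congr (ae_of_all _ fun y => ?_)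
    simp only
    rw [← Real.rpow_natCast, ← Real.rpow_mul (abs_nonneg y)]
    congr 1
    push_cast
    ring
  have h5 := h2.integrable_mul (h.restrict (Icc (-1) 1))
  refine h5.congr (ae_restrict_of_ae ?_)
  filter_upwards [ae_ne_zero] with y hy
  simp only [Pi.mul_apply]
  rw [← mul_assoc, ← Complex.ofReal_mul, ← Real.rpow_add (abs_pos.2 hy)]
  simp

lemma memLp_of_memLp_rpow_mul {δ : ℝ} (h0 : 0 ≤ δ) {G : ℝ → ℂ} (hG : AEStronglyMeasurable G)
    (h : MemLp (fun y => ((|y| ^ (δ / 2) : ℝ) : ℂ) * G y) 2) :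
    MemLp G 2 (volume.restrict (Icc (-1) 1)ᶜ) := by
  refine (h.restrict _).mono hG.restrict ?_
  refine (ae_restrict_iff' measurableSet_Icc.compl).2 (ae_of_all _ fun y hy => ?_)
  have hy1 : 1 ≤ |y| := by
    by_contra! hlt
    exact hy ⟨(abs_lt.1 hlt).1.le, (abs_lt.1 hlt).2.le⟩
  rw [norm_mul, Complex.norm_real, Real.norm_of_nonneg (by positivity)]
  exact le_mul_of_one_le_left (norm_nonneg _) (Real.one_le_rpow hy1 (by linarith))

/-- A common frame for the two representations of 𝓛ₙ: t converts the pairs into multiples of ρLₙ, so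
G = Ft annihilates the pairs. The bound on t puts |y|^(δ/2) G in L² with δ = p + q - 1, whence G is
integrable near 0 and square integrable far out. -/
lemma ae_eq_zero_of_integral_weighted {p q : ℝ} (h1 : 1 ≤ p + q) (h2 : p + q < 3 / 2)
    (hp : ∀ k : ℤ, p ≠ k) (hq : ∀ k : ℤ, q ≠ k) {ρ t : ℝ → ℝ} (hρ : Measurable ρ)
    (hρ0 : ∀ y, 0 ≤ ρ y) (ht : Measurable t) (ht0 : ∀ y, y ≠ 0 → t y ≠ 0) {c : ℝ}
    (htc : ∀ y, y ≠ 0 → |y| ^ ((p + q - 1) / 2) * |t y| ≤ c * Real.sqrt (ρ y))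
    {L : ℤ → ℝ → ℝ} {d : ℤ → ℝ}
    (hL : ∀ n : ℤ, ∀ y, y ≠ 0 → t y * tricomiPair (p + n) (q - n) y = d n * (ρ y * L n y))
    {F : ℝ → ℂ} (hFm : StronglyMeasurable F)
    (hF : MemLp F 2 (volume.withDensity fun y => ENNReal.ofReal (ρ y)))
    (hi : ∀ n, Integrable fun y => (ρ y : ℂ) * (F y * L n y))
    (h0 : ∀ n, ∫ y, (ρ y : ℂ) * (F y * L n y) = 0) : F =ᵐ[volume] 0 := by
  have hm : Measurable fun y : ℝ => |y| := measurable_norm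
  set G : ℝ → ℂ := fun y => F y * t y with hG
  have hGm : Measurable G := hFm.measurable.mul (Complex.measurable_ofReal.comp ht)
  have hG2 : MemLp (fun y => ((|y| ^ ((p + q - 1) / 2) : ℝ) : ℂ) * G y) 2 := by
    refine (memLp_sqrt_mul hρ hρ0 hFm hF).of_le_mul (c := c)
      ((Complex.measurable_ofReal.comp (hm.pow_const _)).mul hGm).aestronglyMeasurable ?_
    filter_upwards [ae_ne_zero] with y hy
    simp only [hG, norm_mul, Complex.norm_real, Real.norm_eq_abs,
      abs_of_nonneg (Real.sqrt_nonneg _), abs_of_nonneg (Real.rpow_nonneg (abs_nonneg y) _)]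
    calc _ = (|y| ^ ((p + q - 1) / 2) * |t y|) * ‖F y‖ := by ring
      _ ≤ (c * Real.sqrt (ρ y)) * ‖F y‖ := mul_le_mul_of_nonneg_right (htc y hy) (norm_nonneg _)
      _ = _ := by ring
  have e : ∀ n : ℤ, (fun y => d n * ((ρ y : ℂ) * (F y * L n y))) =ᵐ[volume]
      fun y => G y * (tricomiPair (p + n) (q - n) y : ℂ) := fun n => by
    filter_upwards [ae_ne_zero] with y hy
    have := congrArg (fun x : ℝ => (x : ℂ)) (hL n y hy)
    push_cast at this
    simp only [hG]
    linear_combination -F y * this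
  have hG0 : G =ᵐ[volume] 0 := by
    refine ae_eq_zero_of_integral_tricomiPair h1 h2 hp hq measurableSet_Icc
      (integrableOn_of_memLp_rpow_mul (by linarith) hG2)
      (memLp_of_memLp_rpow_mul (by linarith) hGm.aestronglyMeasurable hG2)
      (fun n => ((hi n).const_mul _).congr (e n)) fun n => ?_
    rw [← integral_congr_ae (e n), integral_const_mul, h0, mul_zero]
  filter_upwards [hG0, ae_ne_zero] with y hy hy0
  exact (mul_eq_zero.1 hy).resolve_right (by exact_mod_cast ht0 y hy0)

lemma ae_laguerreMeasure {α β : ℝ} {P : ℝ → Prop} (h : ∀ᵐ y, P y) :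
    ∀ᵐ y ∂(laguerreMeasure α β), P y :=
  (withDensity_absolutelyContinuous _ _).ae_le h

lemma memLp_perturbedLaguerre {α β : ℝ} (hαβ : |α - β| < 1 / 2)
    (hα : ∀ k : ℤ, α ≠ (k : ℝ) + 1 / 2) (hβ : ∀ k : ℤ, β ≠ (k : ℝ) + 1 / 2) (n : ℤ) :
    MemLp (fun y : ℝ => (perturbedLaguerre α β n y : ℂ)) 2 (laguerreMeasure α β) := by
  obtain ⟨h1, h2⟩ := abs_lt.1 hαβ
  have hm : Measurable fun y : ℝ => |y| := measurable_norm
  have hh := (hasMoments_tricomiPair (p := 1 / 2 - n - α) (q := 1 / 2 + n + β) (by linarith)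
    (by linarith)).memLp_two.aestronglyMeasurable
  have h3 : AEStronglyMeasurable (perturbedLaguerre α β n) volume := by
    refine ((((hm.pow_const (β - α)).mul (hm.const_mul (1 / 2)).neg.exp).inv).aestronglyMeasurable
      |>.mul hh).congr ?_
    filter_upwards [ae_ne_zero] with y hy
    have := Real.rpow_pos_of_pos (abs_pos.2 hy) (β - α)
    simp only [Pi.mul_apply, Pi.inv_apply, Pi.neg_apply]
    rw [tricomiPair_eq_perturbedLaguerre α β n hy]
    field_simp
  have h4 := h3.mono_ac (withDensity_absolutelyContinuous volume
    (fun y : ℝ => ENNReal.ofReal |laguerreWeight α β y|))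
  refine MemLp.ofReal ((memLp_two_iff_integrable_sq h4).2 ?_)
  have h5 : Integrable fun y => ((|perturbedLaguerre α β n y * perturbedLaguerre α β n y *
      laguerreWeight α β y| : ℝ) : ℂ) := (integrable_perturbedLaguerre_mul hαβ hα hβ n n).abs.ofReal
  have h6 : Integrable (fun y => ((perturbedLaguerre α β n y ^ 2 : ℝ) : ℂ))
      (laguerreMeasure α β) := by
    refine (integrable_withDensity_ofReal (measurable_laguerreWeight α β).abs
      fun y => abs_nonneg _).2 (h5.congr (ae_of_all _ fun y => ?_))
    simp only
    rw [abs_mul, ← sq, abs_of_nonneg (sq_nonneg (perturbedLaguerre α β n y))]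
    push_cast
    ring
  exact h6.re

lemma eq_zero_of_inner_perturbedLaguerre {α β : ℝ} (hαβ : |α - β| < 1 / 2)
    (hα : ∀ k : ℤ, α ≠ (k : ℝ) + 1 / 2) (hβ : ∀ k : ℤ, β ≠ (k : ℝ) + 1 / 2)
    (F : Lp ℂ 2 (laguerreMeasure α β))
    (hF : ∀ n, inner ℂ ((memLp_perturbedLaguerre hαβ hα hβ n).toLp) F = 0) : F = 0 := by
  obtain ⟨h1, h2⟩ := abs_lt.1 hαβ
  have hm : Measurable fun y : ℝ => |y| := measurable_norm
  have hwm := (measurable_laguerreWeight α β).abs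
  have hw0 : ∀ y, 0 ≤ |laguerreWeight α β y| := fun y => abs_nonneg _
  have e : ∀ n, (fun y => inner ℂ (((memLp_perturbedLaguerre hαβ hα hβ n).toLp :
      Lp ℂ 2 (laguerreMeasure α β)) y) (F y)) =ᵐ[laguerreMeasure α β]
      fun y => F y * perturbedLaguerre α β n y := fun n => by
    filter_upwards [(memLp_perturbedLaguerre hαβ hα hβ n).coeFn_toLp] with y hy
    rw [hy, RCLike.inner_apply, Complex.conj_ofReal]
  have hi : ∀ n, Integrable fun y =>
      ((|laguerreWeight α β y| : ℝ) : ℂ) * (F y * perturbedLaguerre α β n y) := fun n =>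
    (integrable_withDensity_ofReal hwm hw0).1 ((L2.integrable_inner _ F).congr (e n))
  have h0 : ∀ n, ∫ y, ((|laguerreWeight α β y| : ℝ) : ℂ) * (F y * perturbedLaguerre α β n y) = 0 :=
    fun n => by
      rw [← integral_withDensity_ofReal hwm hw0, ← hF n, L2.inner_def]
      exact (integral_congr_ae (e n)).symm
  have hFm := Lp.stronglyMeasurable F
  have hF2 := Lp.memLp F
  have hk := weightSide_ne_zero hα hβ
  have hexp : ∀ y : ℝ, Real.exp (-|y|) = Real.exp (-(1 / 2 * |y|)) * Real.exp (-(1 / 2 * |y|)) :=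
    fun y => by
      rw [← Real.exp_add]
      ring_nf
  have hsqrt : ∀ y : ℝ, Real.sqrt |laguerreWeight α β y| = |y| ^ ((β - α) / 2)
      * Real.exp (-(1 / 2 * |y|)) * Real.sqrt |weightSide α β y| := fun y => by
    rw [laguerreWeight_eq, abs_mul, abs_of_nonneg (by positivity), Real.sqrt_mul (by positivity),
      Real.sqrt_mul (by positivity), hexp, Real.sqrt_mul_self (by positivity), Real.sqrt_eq_rpow,
      ← Real.rpow_mul (abs_nonneg y)]
    ring_nf
  have habs : ∀ y : ℝ, |laguerreWeight α β y| = |y| ^ (β - α) * (Real.exp (-(1 / 2 * |y|))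
      * Real.exp (-(1 / 2 * |y|))) * |weightSide α β y| := fun y => by
    rw [laguerreWeight_eq, abs_mul, abs_of_nonneg (by positivity), hexp]
  refine (Lp.eq_zero_iff_ae_eq_zero).2 (ae_laguerreMeasure ?_)
  -- The completeness argument needs p + q ≥ 1. The direct representation has p + q = 1 - α + β, the
  -- transformed one 1 + α - β, so the sign of β - α selects which to use. The index is -n because n
  -- raises p but lowers the first parameter of 𝓛ₙ.
  rcases le_or_gt α β with hle | hlt
  · refine ae_eq_zero_of_integral_weighted (p := 1 / 2 - α) (q := 1 / 2 + β) (by linarith)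
      (by linarith) (fun k => by simpa using half_sub_ne_intCast hα 0 k)
      (fun k => by simpa using half_add_ne_intCast hβ 0 k) hwm hw0
      (t := fun y => Real.exp (-(1 / 2 * |y|)) * |weightSide α β y|)
      ((hm.const_mul _).neg.exp.mul (measurable_weightSide α β).abs)
      (fun y _ => mul_ne_zero (Real.exp_pos _).ne' (abs_ne_zero.2 (hk y))) (c := 1) ?_
      (L := fun n => perturbedLaguerre α β (-n)) (d := 1) ?_ hFm hF2 (fun n => hi (-n))
      (fun n => h0 (-n))
    · intro y hy
      rw [hsqrt, show (1 / 2 - α + (1 / 2 + β) - 1) / 2 = (β - α) / 2 by ring, abs_mul, abs_abs,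
        abs_of_pos (Real.exp_pos _), one_mul, ← mul_assoc]
      gcongr
      exact Real.le_sqrt_of_sq_le
        (by nlinarith [abs_nonneg (weightSide α β y), abs_weightSide_le α β y])
    · intro n y hy
      have h := tricomiPair_eq_perturbedLaguerre α β (-n) hy
      rw [show (1 / 2 - ((-n : ℤ) : ℝ) - α) = 1 / 2 - α + n by push_cast; ring,
        show (1 / 2 + ((-n : ℤ) : ℝ) + β) = 1 / 2 + β - n by push_cast; ring] at h
      rw [h, habs, Pi.one_apply]
      ring
  -- Here t carries no cosine of its own, so the constant must compensate for the smaller of the two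
  -- cosines.
  · have hc : ∀ y, 1 ≤ (1 / Real.sqrt |Real.cos (Real.pi * β)|
        + 1 / Real.sqrt |Real.cos (Real.pi * α)|) * Real.sqrt |weightSide α β y| := fun y => by
      have ha := Real.sqrt_pos.2 (abs_pos.2 (cos_pi_mul_ne_zero hα))
      have hb := Real.sqrt_pos.2 (abs_pos.2 (cos_pi_mul_ne_zero hβ))
      unfold weightSide
      split_ifs
      · rw [add_mul, one_div_mul_cancel hb.ne']
        exact le_add_of_nonneg_right (by positivity)
      · rw [add_mul, one_div_mul_cancel ha.ne']
        exact le_add_of_nonneg_left (by positivity)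
    refine ae_eq_zero_of_integral_weighted (p := 1 / 2 - β) (q := 1 / 2 + α) (by linarith)
      (by linarith) (fun k => by simpa using half_sub_ne_intCast hβ 0 k)
      (fun k => by simpa using half_add_ne_intCast hα 0 k) hwm hw0
      (t := fun y => Real.exp (-(1 / 2 * |y|)) * |y| ^ (β - α)
        * (|weightSide α β y| / weightSide α β y))
      (((hm.const_mul _).neg.exp.mul (hm.pow_const _)).mul
        ((measurable_weightSide α β).abs.div (measurable_weightSide α β)))
      (fun y hy => mul_ne_zero (mul_ne_zero (Real.exp_pos _).ne'
        (Real.rpow_pos_of_pos (abs_pos.2 hy) _).ne')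
        (div_ne_zero (abs_ne_zero.2 (hk y)) (hk y)))
      (c := 1 / Real.sqrt |Real.cos (Real.pi * β)| + 1 / Real.sqrt |Real.cos (Real.pi * α)|) ?_
      (L := fun n => perturbedLaguerre α β (-n)) (d := fun n => 1 / laguerreSquare α β (-n)) ?_
      hFm hF2 (fun n => hi (-n)) (fun n => h0 (-n))
    · intro y hy
      have hy' := abs_pos.2 hy
      have hr : |y| ^ ((1 / 2 - β + (1 / 2 + α) - 1) / 2) * |y| ^ (β - α)
          = |y| ^ ((β - α) / 2) := by
        rw [← Real.rpow_add hy']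
        ring_nf
      rw [hsqrt, abs_mul, abs_div, abs_abs, div_self (abs_ne_zero.2 (hk y)), mul_one,
        abs_of_pos (mul_pos (Real.exp_pos _) (Real.rpow_pos_of_pos hy' _))]
      calc _ = |y| ^ ((1 / 2 - β + (1 / 2 + α) - 1) / 2) * |y| ^ (β - α)
            * Real.exp (-(1 / 2 * |y|)) := by ring
        _ = |y| ^ ((β - α) / 2) * Real.exp (-(1 / 2 * |y|)) * 1 := by rw [hr, mul_one]
        _ ≤ |y| ^ ((β - α) / 2) * Real.exp (-(1 / 2 * |y|)) * _ :=
          mul_le_mul_of_nonneg_left (hc y) (by positivity)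
        _ = _ := by ring
    · intro n y hy
      have h := laguerreSquare_mul_tricomiPair hαβ hα hβ (-n) hy
      rw [show (1 / 2 - ((-n : ℤ) : ℝ) - β) = 1 / 2 - β + n by push_cast; ring,
        show (1 / 2 + ((-n : ℤ) : ℝ) + α) = 1 / 2 + α - n by push_cast; ring] at h
      have hC := laguerreSquare_ne_zero hα hβ (-n)
      have hT := eq_div_of_mul_eq hC ((mul_comm _ _).trans h)
      have := hk y
      rw [habs, hT]
      field_simp

lemma span_perturbedLaguerre_topologicalClosure {α β : ℝ} (hαβ : |α - β| < 1 / 2)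
    (hα : ∀ k : ℤ, α ≠ (k : ℝ) + 1 / 2) (hβ : ∀ k : ℤ, β ≠ (k : ℝ) + 1 / 2) :
    (Submodule.span ℂ (range fun n : ℤ =>
      (memLp_perturbedLaguerre hαβ hα hβ n).toLp)).topologicalClosure = ⊤ := by
  rw [Submodule.topologicalClosure_eq_top_iff, Submodule.eq_bot_iff]
  intro F hF
  exact eq_zero_of_inner_perturbedLaguerre hαβ hα hβ F fun n =>
    (Submodule.mem_orthogonal _ F).1 hF _ (Submodule.subset_span ⟨n, rfl⟩)

/-! ### The Hilbert basis for a weight of constant sign -/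

lemma inner_perturbedLaguerre {α β : ℝ} (hαβ : |α - β| < 1 / 2)
    (hα : ∀ k : ℤ, α ≠ (k : ℝ) + 1 / 2) (hβ : ∀ k : ℤ, β ≠ (k : ℝ) + 1 / 2)
    (hpos : 0 < Real.cos (Real.pi * α) * Real.cos (Real.pi * β)) (m n : ℤ) :
    inner ℂ ((memLp_perturbedLaguerre hαβ hα hβ m).toLp)
      ((memLp_perturbedLaguerre hαβ hα hβ n).toLp)
      = if m = n then ((|laguerreSquare α β n| : ℝ) : ℂ) else 0 := by
  obtain ⟨ε, hε, hw⟩ : ∃ ε : ℝ, |ε| = 1 ∧ ∀ y, |laguerreWeight α β y| = ε * laguerreWeight α β y := by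
    have key : ∀ y, |laguerreWeight α β y|
        = |y| ^ (β - α) * Real.exp (-|y|) * |weightSide α β y| := fun y => by
      rw [laguerreWeight_eq, abs_mul, abs_of_nonneg (by positivity)]
    rcases pos_and_pos_or_neg_and_neg_of_mul_pos hpos with ⟨ha, hb⟩ | ⟨ha, hb⟩
    · refine ⟨1, abs_one, fun y => ?_⟩
      have : 0 ≤ weightSide α β y := by
        unfold weightSide
        split_ifs
        exacts [hb.le, ha.le]
      rw [key, abs_of_nonneg this, one_mul, laguerreWeight_eq]
    · refine ⟨-1, by norm_num, fun y => ?_⟩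
      have : weightSide α β y ≤ 0 := by
        unfold weightSide
        split_ifs
        exacts [hb.le, ha.le]
      rw [key, abs_of_nonpos this, laguerreWeight_eq]
      ring
  have hint : ∀ m n, ∫ y, |laguerreWeight α β y| *
      (perturbedLaguerre α β m y * perturbedLaguerre α β n y)
      = ε * if m = n then laguerreSquare α β n else 0 := fun m n => by
    rw [← integral_perturbedLaguerre_mul hαβ hα hβ m n, ← integral_const_mul]
    simp only [hw]
    congr 1
    ext y
    ring
  -- The sign of the Gamma expression is not computed: it is forced by the positivity of the
  -- integral.
  have hsq : ε * laguerreSquare α β n = |laguerreSquare α β n| := by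
    have h := hint n n
    rw [if_pos rfl] at h
    have h0 : 0 ≤ ε * laguerreSquare α β n := by
      rw [← h]
      exact integral_nonneg fun y => mul_nonneg (abs_nonneg _) (mul_self_nonneg _)
    rw [← abs_of_nonneg h0, abs_mul, hε, one_mul]
  have e : (fun y => inner ℂ (((memLp_perturbedLaguerre hαβ hα hβ m).toLp :
      Lp ℂ 2 (laguerreMeasure α β)) y) (((memLp_perturbedLaguerre hαβ hα hβ n).toLp :
      Lp ℂ 2 (laguerreMeasure α β)) y)) =ᵐ[laguerreMeasure α β]
      fun y => ((perturbedLaguerre α β m y * perturbedLaguerre α β n y : ℝ) : ℂ) := by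
    filter_upwards [(memLp_perturbedLaguerre hαβ hα hβ m).coeFn_toLp,
      (memLp_perturbedLaguerre hαβ hα hβ n).coeFn_toLp] with y hy hy'
    rw [hy, hy', RCLike.inner_apply, Complex.conj_ofReal, mul_comm, Complex.ofReal_mul]
  rw [L2.inner_def, integral_congr_ae e, laguerreMeasure,
    integral_withDensity_ofReal (measurable_laguerreWeight α β).abs fun y => abs_nonneg _]
  simp only [← Complex.ofReal_mul, integral_complex_ofReal, hint]
  split_ifs
  · rw [hsq]
  · simp

theorem propositionA2 (α β : ℝ) (hαβ : |α - β| < 1 / 2)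
    (hα : ∀ k : ℤ, α ≠ (k : ℝ) + 1 / 2) (hβ : ∀ k : ℤ, β ≠ (k : ℝ) + 1 / 2) :
    (∀ m n : ℤ, MeasureTheory.Integrable
      (fun y : ℝ => perturbedLaguerre α β m y * perturbedLaguerre α β n y * laguerreWeight α β y)) ∧
    (∀ m n : ℤ, m ≠ n →
      ∫ y : ℝ, perturbedLaguerre α β m y * perturbedLaguerre α β n y * laguerreWeight α β y = 0) ∧
    (∀ n : ℤ,
      ∫ y : ℝ, |perturbedLaguerre α β n y| ^ 2 * laguerreWeight α β y = laguerreSquare α β n) ∧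
    (∀ n : ℤ, laguerreSquare α β n ≠ 0) ∧
    (∃ hL : ∀ n : ℤ, MeasureTheory.MemLp (fun y : ℝ => (perturbedLaguerre α β n y : ℂ)) 2
        (laguerreMeasure α β),
      (Submodule.span ℂ (Set.range fun n : ℤ => (hL n).toLp)).topologicalClosure = ⊤) ∧
    (0 < Real.cos (Real.pi * α) * Real.cos (Real.pi * β) →
      ∃ b : HilbertBasis ℤ ℂ (MeasureTheory.Lp ℂ 2 (laguerreMeasure α β)),
        ∀ n : ℤ, ∀ᵐ y ∂(laguerreMeasure α β),
          b n y = (((perturbedLaguerre α β n y) / Real.sqrt |laguerreSquare α β n| : ℝ) : ℂ)) := by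
  refine ⟨integrable_perturbedLaguerre_mul hαβ hα hβ, fun m n hmn => ?_, fun n => ?_,
    laguerreSquare_ne_zero hα hβ, ⟨memLp_perturbedLaguerre hαβ hα hβ,
    span_perturbedLaguerre_topologicalClosure hαβ hα hβ⟩, fun hpos => ?_⟩
  · rw [integral_perturbedLaguerre_mul hαβ hα hβ, if_neg hmn]
  · have h := integral_perturbedLaguerre_mul hαβ hα hβ n n
    rw [if_pos rfl] at h
    simp only [sq_abs]
    simpa only [sq] using h
  · set u : ℤ → MeasureTheory.Lp ℂ 2 (laguerreMeasure α β) := fun n =>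
      (memLp_perturbedLaguerre hαβ hα hβ n).toLp with hu
    set s : ℤ → ℂ := fun n => ((1 / Real.sqrt |laguerreSquare α β n| : ℝ) : ℂ) with hs
    have hpos' : ∀ n, 0 < Real.sqrt |laguerreSquare α β n| := fun n =>
      Real.sqrt_pos.2 (abs_pos.2 (laguerreSquare_ne_zero hα hβ n))
    have hs0 : ∀ n, s n ≠ 0 := fun n =>
      Complex.ofReal_ne_zero.2 (one_div_ne_zero (hpos' n).ne')
    have hon : Orthonormal ℂ fun n => s n • u n := by
      rw [orthonormal_iff_ite]
      intro m n
      rw [inner_smul_left, inner_smul_right, hu,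
        inner_perturbedLaguerre hαβ hα hβ hpos, hs, Complex.conj_ofReal]
      split_ifs with hmn
      · subst hmn
        have h1 := (hpos' m).ne'
        have h2 := Real.mul_self_sqrt (abs_nonneg (laguerreSquare α β m))
        rw [← Complex.ofReal_mul, ← Complex.ofReal_mul, ← Complex.ofReal_one]
        congr 1
        nth_rewrite 3 [← h2]
        field_simp
      · simp
    have hspan : ⊤ ≤ (Submodule.span ℂ (Set.range fun n => s n • u n)).topologicalClosure := by
      rw [← span_perturbedLaguerre_topologicalClosure hαβ hα hβ]
      refine Submodule.topologicalClosure_mono (Submodule.span_le.2 ?_)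
      rintro - ⟨n, rfl⟩
      change u n ∈ _
      have h := Submodule.smul_mem _ (s n)⁻¹
        (Submodule.subset_span (R := ℂ) (Set.mem_range_self (f := fun n => s n • u n) n))
      rwa [inv_smul_smul₀ (hs0 n)] at h
    refine ⟨HilbertBasis.mk hon hspan, fun n => ?_⟩
    rw [HilbertBasis.coe_mk]
    filter_upwards [MeasureTheory.Lp.coeFn_smul (s n) (u n),
      (memLp_perturbedLaguerre hαβ hα hβ n).coeFn_toLp] with y h1 h2
    rw [h1, Pi.smul_apply, hu, h2, hs, smul_eq_mul, ← Complex.ofReal_mul, one_div_mul_eq_div]
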